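/- Let $p\ge 1$, $v_x,v_y>0$ and $v_w=\frac{v_xv_y}{v_x+v_y}$. Write $p_v(z|\mu)$ for the density at $z$ of $N_p(\mu,vI)$. Let $X\sim N_p(\mu,v_xI)$ and $Y\sim N_p(\mu,v_yI)$ be independent with common unknown mean $\mu\in\mathbb R^p$. Based on $X=x$ the density $p_{v_y}(\cdot|\mu)$ of $Y$ is to be estimated. A procedure is a function $\hat p(y|x)$, measurable in $(x,y)$, such that $\hat p(\cdot|x)$ is a probability density on $\mathbb R^p$ for every $x$. Its Kullback--Leibler risk is $$R_{\rm KL}(\mu,\hat p)=\int L(\mu,\hat p(\cdot|x))\,p_{v_x}(x|\mu)\,dx,\qquad L(\mu,g)=\int p_{v_y}(y|\mu)\log\frac{p_{v_y}(y|\mu)}{g(y)}\,dy$$ if $g>0$ a.e., and $L(\mu,g)=\infty$ otherwise. A procedure $\hat p$ is admissible under KL loss if there is no procedure $\hat p'$ with $R_{\rm KL}(\mu,\hat p')\le R_{\rm KL}(\mu,\hat p)$ for all $\mu$ and with strict inequality for some $\mu$. Let $\pi:\mathbb R^p\to[0,\infty)$ be a measurable, locally integrable, improper prior density ($\int\pi\,d\mu=\infty$)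 with a locally integrable weak gradient $\nabla\pi$ (for example, $\pi\in C^1$). Put $m_f(z;v)=\int p_v(z|\mu)f(\mu)\,d\mu$ for $f=\pi$ and $f=\nabla\pi$. Assume that $m_\pi(x;v_x)<\infty$ for all $x$, so that the formal Bayes rule $$\hat p_\pi(y|x)=\frac{\int p_{v_x}(x|\mu)\,p_{v_y}(y|\mu)\,\pi(\mu)\,d\mu}{\int p_{v_x}(x|\mu)\,\pi(\mu)\,d\mu}$$ is defined, and that $R_{\rm KL}(\mu,\hat p_\pi)<\infty$ for all $\mu$. **Theorem 2.** Suppose that for every $v\in[v_w,v_x]$ the improper prior $\pi$ satisfies both (i) the growth condition $\displaystyle\int_{\|\mu\|>1}\frac{\pi(\mu)}{\|\mu\|^2\log^2(\|\mu\|\vee2)}\,d\mu<\infty$, where $a\vee b=\max\{a,b\}$, and (ii) the asymptotic flatness condition: $m_{\nabla\pi}(z;v)$ converges absolutely for all $z$, and $$\iint\pi(\mu)\left\|\frac{m_{\nabla\pi}(z;v)}{m_\pi(z;v)}-\frac{\nabla\pi(\mu)}{\pi(\mu)}\right\|^2p_v(z|\mu)\,d\mu\,dz<\infty,$$ where the integrand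 is read as $0$ where $\pi(\mu)=0$. Then the formal Bayes rule $\hat p_\pi$ is admissible under KL loss. -/

import Mathlib

open MeasureTheory
open scoped ENNReal ContDiff

noncomputable section

namespace PredictiveDensity

/-- The density at `z` of the normal distribution `N_p(μ, v I)` on `ℝᵖ`. -/
def normalDensity {p : ℕ} (v : ℝ) (μ z : EuclideanSpace ℝ (Fin p)) : ℝ :=
  (2 * Real.pi * v) ^ (-((p : ℝ) / 2)) * Real.exp (-(‖z - μ‖ ^ 2 / (2 * v)))

/-- A density on `ℝᵖ`: a measurable, nonnegative function with integral one
(the integral being nonzero, the function is automatically integrable). -/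
def IsDensity {p : ℕ} (g : EuclideanSpace ℝ (Fin p) → ℝ) : Prop :=
  Measurable g ∧ (∀ y, 0 ≤ g y) ∧ ∫ y, g y = 1

/-- A nonrandomized procedure: to each observation `x` it assigns a density `q x` on `ℝᵖ`,
measurably in `(x, y)`. -/
def IsProcedure {p : ℕ} (q : EuclideanSpace ℝ (Fin p) → EuclideanSpace ℝ (Fin p) → ℝ) : Prop :=
  Measurable (fun z : EuclideanSpace ℝ (Fin p) × EuclideanSpace ℝ (Fin p) => q z.1 z.2) ∧
    ∀ x, IsDensity (q x)

open Classical in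
/-- Kullback–Leibler loss `L(μ, g)` of a density `g` as an estimate of the `N_p(μ, v_y I)` density:
`∫ p(y|μ) log (p(y|μ) / g(y)) dy` if `g > 0` a.e., and `∞` otherwise.
The negative part of the integrand is always integrable (`t log (t / s) ≥ t - s`), so that the
integral is `+∞` when the integrand is not integrable; when it is, the integral is nonnegative. -/
def klLoss {p : ℕ} (vy : ℝ) (μ : EuclideanSpace ℝ (Fin p)) (g : EuclideanSpace ℝ (Fin p) → ℝ) :
    ℝ≥0∞ :=
  if (∀ᵐ y, 0 < g y) ∧
      Integrable (fun y => normalDensity vy μ y * Real.log (normalDensity vy μ y / g y)) then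
    ENNReal.ofReal (∫ y, normalDensity vy μ y * Real.log (normalDensity vy μ y / g y))
  else ⊤

/-- Kullback–Leibler risk `R_KL(μ, q) = ∫ L(μ, q(·|x)) p(x|μ) dx`, with `X ∼ N_p(μ, v_x I)`. -/
def klRisk {p : ℕ} (vx vy : ℝ) (μ : EuclideanSpace ℝ (Fin p))
    (q : EuclideanSpace ℝ (Fin p) → EuclideanSpace ℝ (Fin p) → ℝ) : ℝ≥0∞ :=
  ∫⁻ x, klLoss vy μ (q x) * ENNReal.ofReal (normalDensity vx μ x)

/-- `q₁` dominates `q₂`: its risk is nowhere larger and somewhere strictly smaller. -/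
def Dominates {p : ℕ} (vx vy : ℝ)
    (q₁ q₂ : EuclideanSpace ℝ (Fin p) → EuclideanSpace ℝ (Fin p) → ℝ) : Prop :=
  (∀ μ, klRisk vx vy μ q₁ ≤ klRisk vx vy μ q₂) ∧ ∃ μ, klRisk vx vy μ q₁ < klRisk vx vy μ q₂

/-- Admissibility: a procedure that no procedure dominates. -/
def IsAdmissible {p : ℕ} (vx vy : ℝ)
    (q : EuclideanSpace ℝ (Fin p) → EuclideanSpace ℝ (Fin p) → ℝ) : Prop :=
  IsProcedure q ∧
    ¬ ∃ q' : EuclideanSpace ℝ (Fin p) → EuclideanSpace ℝ (Fin p) → ℝ,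
      IsProcedure q' ∧ Dominates vx vy q' q

/-- The formal Bayes rule under the prior density `π`:
`∫ p(x|μ) p(y|μ) π(μ) dμ / ∫ p(x|μ) π(μ) dμ`. -/
def bayesRule {p : ℕ} (vx vy : ℝ) (π : EuclideanSpace ℝ (Fin p) → ℝ)
    (x y : EuclideanSpace ℝ (Fin p)) : ℝ :=
  (∫ μ, normalDensity vx μ x * normalDensity vy μ y * π μ) / ∫ μ, normalDensity vx μ x * π μ

/-- `m_f(z; v) = ∫ p(z|μ) f(μ) dμ` with `p(·|μ)` the `N_p(μ, v I)` density, for a real- or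
vector-valued `f`. -/
def marginal {p : ℕ} {F : Type*} [NormedAddCommGroup F] [NormedSpace ℝ F] (v : ℝ)
    (f : EuclideanSpace ℝ (Fin p) → F) (z : EuclideanSpace ℝ (Fin p)) : F :=
  ∫ μ, normalDensity v μ z • f μ

/-- `m_f(z; v)` exists (the integral converges absolutely) for every `z`. -/
def HasMarginal {p : ℕ} {F : Type*} [NormedAddCommGroup F] [NormedSpace ℝ F] (v : ℝ)
    (f : EuclideanSpace ℝ (Fin p) → F) : Prop :=
  ∀ z, Integrable (fun μ => normalDensity v μ z • f μ)

/-- `G` is the weak (distributional) gradient of `f`, both being locally integrable. -/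
structure HasWeakGradient {p : ℕ} (f : EuclideanSpace ℝ (Fin p) → ℝ)
    (G : EuclideanSpace ℝ (Fin p) → EuclideanSpace ℝ (Fin p)) : Prop where
  locallyIntegrable : LocallyIntegrable f
  locallyIntegrable_gradient : LocallyIntegrable G
  integral_smul_gradient : ∀ φ : EuclideanSpace ℝ (Fin p) → ℝ,
    ContDiff ℝ ∞ φ → HasCompactSupport φ →
      ∫ μ, f μ • gradient φ μ = -∫ μ, φ μ • G μ

/-- The growth condition `∫_{‖μ‖ > 1} π(μ) / (‖μ‖² log² (‖μ‖ ∨ 2)) dμ < ∞`. -/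
def GrowthCondition {p : ℕ} (π : EuclideanSpace ℝ (Fin p) → ℝ) : Prop :=
  ∫⁻ μ in {μ : EuclideanSpace ℝ (Fin p) | 1 < ‖μ‖},
    ENNReal.ofReal (π μ / (‖μ‖ ^ 2 * Real.log (max ‖μ‖ 2) ^ 2)) < ⊤

/-- The asymptotic flatness condition
`∫∫ π(μ) ‖m_{∇π}(z; v) / m_π(z; v) - ∇π(μ) / π(μ)‖² p(z|μ) dμ dz < ∞` at the variance `v`,
where `G = ∇π`. The integrand is zero where `π` vanishes. -/
def FlatnessCondition {p : ℕ} (v : ℝ) (π : EuclideanSpace ℝ (Fin p) → ℝ)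
    (G : EuclideanSpace ℝ (Fin p) → EuclideanSpace ℝ (Fin p)) : Prop :=
  HasMarginal v G ∧
    ∫⁻ z, ∫⁻ μ, ENNReal.ofReal
      (π μ * ‖(marginal v π z)⁻¹ • marginal v G z - (π μ)⁻¹ • G μ‖ ^ 2 * normalDensity v μ z) < ⊤

end PredictiveDensity

end

/-!
The proof is Blyth's method along cut-off priors `k_n² π ↑ π`. For a prior `g` with compact
support, the Bayes risk of any procedure `q` is the finite Bayes risk of the Bayes rule of `g`
plus the excess `bayesExcess`, the average divergence of `q` from that Bayes rule. If the excess
of the formal Bayes rule under `k_n² π` tends to zero, so does that of a procedure dominating it;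
by Fatou's lemma the dominating procedure agrees with the formal Bayes rule almost everywhere, and
hence has the same risk everywhere. Fatou's lemma also reduces the convergence required to a bound
between the Bayes rules of `k_n² π` and `k_m² π` (`isAdmissible_of_bayesExcess_le`), so that all
integrals concern compactly supported priors.

The predictive problem turns into a problem about the heat flow `v ↦ m_f(·; v)`. The product of
the densities of `X` and `Y` factors through the precision-weighted mean of the two, of variance
`v_w`, and the excess under `f₁` of the Bayes rule of `f₂` is the relative entropy of `m_{f₁}`
with respect to `m_{f₂}` at `v_w`, minus the same at `v_x` (`bayesExcess_bayesRule`). By de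
Bruijn's identity the relative entropy has derivative `-1/2` times the relative Fisher information
(`hasDerivAt_relEntropy`), which is the weighted square distance between the scores of the two
marginals.

Both scores are compared with the posterior mean of `U = ∇π / π`. Moving the derivative onto the
prior, the score of the marginal of `k² π` is a posterior mean of `U + 2 ∇k / k`
(`gradMarginal_cutPrior`), so that its distance to the posterior mean of `U` under `π` has two
parts (`scoreGap_le`). One is at most a multiple of `∫ π ‖∇k‖²`; for logarithmic cutoffs this
tends to zero by the growth condition (`tendsto_energy_logCutoff`). The other is dominated by the
posterior variance of `U`, which the flatness condition makes integrable, and tends to zero by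
dominated convergence. The integrated posterior variance increases with `v`, since more noise
means less information (`HasPosteriorMean.lintegral_posteriorVar_mono`), so that the bound at
`v_x` holds uniformly on `[v_w, v_x]` and the integral over `v` tends to zero as well.

Setting `U = 0` where `π = 0` loses nothing because the weak gradient of a nonnegative function
vanishes almost everywhere on its zero set (`HasWeakGradient.ae_gradient_eq_zero`).
-/

noncomputable section

namespace PredictiveDensity

variable {p : ℕ}

local notation "E" => EuclideanSpace ℝ (Fin p)

/-! ### The normal density -/

theorem normalDensity_pos {v : ℝ} (hv : 0 < v) (μ z : E) : 0 < normalDensity v μ z := by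
  unfold normalDensity; positivity

theorem normalDensity_nonneg {v : ℝ} (hv : 0 < v) (μ z : E) : 0 ≤ normalDensity v μ z :=
  (normalDensity_pos hv μ z).le

theorem normalDensity_comm (v : ℝ) (μ z : E) : normalDensity v μ z = normalDensity v z μ := by
  simp only [normalDensity, norm_sub_rev]

theorem measurable_normalDensity :
    Measurable fun a : ℝ × E × E => normalDensity a.1 a.2.1 a.2.2 := by
  unfold normalDensity
  fun_prop

theorem measurable_normalDensity' {α : Type*} [MeasurableSpace α] {v : α → ℝ} {f g : α → E}
    (hv : Measurable v) (hf : Measurable f) (hg : Measurable g) :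
    Measurable fun a => normalDensity (v a) (f a) (g a) :=
  measurable_normalDensity.comp (hv.prodMk (hf.prodMk hg))

theorem measurable_normalDensity_right (v : ℝ) (μ : E) :
    Measurable fun z => normalDensity v μ z :=
  measurable_normalDensity' measurable_const measurable_const measurable_id

theorem measurable_normalDensity_left (v : ℝ) (z : E) :
    Measurable fun μ => normalDensity v μ z :=
  measurable_normalDensity' measurable_const measurable_id measurable_const

theorem continuous_normalDensity (v : ℝ) {α : Type*} [TopologicalSpace α] {f g : α → E}
    (hf : Continuous f) (hg : Continuous g) :
    Continuous fun a => normalDensity v (f a) (g a) := by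
  unfold normalDensity
  fun_prop

theorem integrable_exp_neg_mul_sq_norm {b : ℝ} (hb : 0 < b) :
    Integrable fun z : E => Real.exp (-b * ‖z‖ ^ 2) := by
  by_contra h
  have h1 := GaussianFourier.integral_rexp_neg_mul_sq_norm (V := E) hb
  rw [integral_undef h] at h1
  have : 0 < (Real.pi / b) ^ ((Module.finrank ℝ E : ℝ) / 2) := by positivity
  exact this.ne h1

theorem integrable_normalDensity {v : ℝ} (hv : 0 < v) (μ : E) :
    Integrable fun z => normalDensity v μ z := by
  have h := ((integrable_exp_neg_mul_sq_norm (p := p) (b := 1 / (2 * v)) (by positivity)).comp_sub_right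
    μ).const_mul ((2 * Real.pi * v) ^ (-((p : ℝ) / 2)))
  refine h.congr (Filter.Eventually.of_forall fun z => ?_)
  simp only [normalDensity]
  congr 2
  ring

theorem integral_normalDensity {v : ℝ} (hv : 0 < v) (μ : E) :
    ∫ z, normalDensity v μ z = 1 := by
  have h := GaussianFourier.integral_rexp_neg_mul_sq_norm (V := E) (b := 1 / (2 * v))
    (by positivity)
  have h2 : ∀ z : E, normalDensity v μ z = (2 * Real.pi * v) ^ (-((p : ℝ) / 2)) *
      (fun z : E => Real.exp (-(1 / (2 * v)) * ‖z‖ ^ 2)) (z - μ) := fun z => by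
    simp only [normalDensity]
    congr 2
    ring
  simp_rw [h2]
  rw [integral_const_mul, integral_sub_right_eq_self
    (fun z : E => Real.exp (-(1 / (2 * v)) * ‖z‖ ^ 2)) μ, h, finrank_euclideanSpace_fin,
    show Real.pi / (1 / (2 * v)) = 2 * Real.pi * v by field_simp, ← Real.rpow_add (by positivity)]
  simp

theorem lintegral_normalDensity {v : ℝ} (hv : 0 < v) (μ : E) :
    ∫⁻ z, ENNReal.ofReal (normalDensity v μ z) = 1 := by
  rw [← ofReal_integral_eq_lintegral_ofReal (integrable_normalDensity hv μ)
    (Filter.Eventually.of_forall fun z => normalDensity_nonneg hv μ z), integral_normalDensity hv]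
  simp

theorem lintegral_normalDensity' {v : ℝ} (hv : 0 < v) (z : E) :
    ∫⁻ μ, ENNReal.ofReal (normalDensity v μ z) = 1 := by
  simp_rw [normalDensity_comm v _ z]
  exact lintegral_normalDensity hv z

/-- Completing the square: the product of the densities of `N(μ, a I)` at `x` and of `N(μ, b I)`
at `y` is the density of the precision-weighted mean times that of the difference `y - x`. -/
theorem normalDensity_mul_normalDensity {a b : ℝ} (ha : 0 < a) (hb : 0 < b) (μ x y : E) :
    normalDensity a μ x * normalDensity b μ y =
      normalDensity (a * b / (a + b)) μ (x + (a / (a + b)) • (y - x)) *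
        normalDensity (a + b) x y := by
  have hab : 0 < a + b := by positivity
  unfold normalDensity
  have hpi := Real.pi_pos
  rw [mul_mul_mul_comm, mul_mul_mul_comm (_ ^ _) _ (_ ^ _), ← Real.exp_add, ← Real.exp_add,
    ← Real.mul_rpow (by positivity) (by positivity),
    ← Real.mul_rpow (by positivity) (by positivity)]
  congr 1
  · congr 1
    field_simp
  · congr 1
    have h1 : y - x = (y - μ) - (x - μ) := by abel
    have h2 : x + (a / (a + b)) • (y - x) - μ =
        (b / (a + b)) • (x - μ) + (a / (a + b)) • (y - μ) := by
      have : (b / (a + b)) = 1 - a / (a + b) := by field_simp; ring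
      rw [this, h1, smul_sub, sub_smul, one_smul]
      abel
    rw [h2, h1]
    generalize x - μ = s
    generalize y - μ = t
    rw [norm_add_sq_real, norm_sub_sq_real, norm_smul, norm_smul, inner_smul_left,
      inner_smul_right, Real.norm_of_nonneg (by positivity), Real.norm_of_nonneg (by positivity),
      real_inner_comm s t]
    simp only [conj_trivial]
    field_simp
    ring

/-- The heat semigroup property of normal densities. -/
theorem lintegral_normalDensity_mul {a b : ℝ} (ha : 0 < a) (hb : 0 < b) (μ z : E) :
    ∫⁻ x, ENNReal.ofReal (normalDensity a x μ) * ENNReal.ofReal (normalDensity b x z) =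
      ENNReal.ofReal (normalDensity (a + b) μ z) := by
  have h : ∀ x : E, ENNReal.ofReal (normalDensity a x μ) * ENNReal.ofReal (normalDensity b x z) =
      ENNReal.ofReal (normalDensity (a * b / (a + b)) x (μ + (a / (a + b)) • (z - μ))) *
        ENNReal.ofReal (normalDensity (a + b) μ z) := fun x => by
    rw [← ENNReal.ofReal_mul (normalDensity_nonneg ha _ _),
      normalDensity_mul_normalDensity ha hb, ENNReal.ofReal_mul
        (normalDensity_nonneg (by positivity) _ _)]
  simp_rw [h]
  rw [lintegral_mul_const _ (by
    exact (measurable_normalDensity' measurable_const measurable_id measurable_const).ennreal_ofReal),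
    lintegral_normalDensity' (by positivity), one_mul]

theorem normalDensity_le_of_le {v w : ℝ} (hv : 0 < v) (hvw : v ≤ w) (μ z : E) :
    normalDensity v μ z ≤ (w / v) ^ ((p : ℝ) / 2) * normalDensity w μ z := by
  have hw : 0 < w := hv.trans_le hvw
  have hpi := Real.pi_pos
  unfold normalDensity
  have h : (2 * Real.pi * v) ^ (-((p : ℝ) / 2)) =
      (w / v) ^ ((p : ℝ) / 2) * (2 * Real.pi * w) ^ (-((p : ℝ) / 2)) := by
    rw [Real.rpow_neg (by positivity), Real.rpow_neg (by positivity),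
      ← Real.inv_rpow (by positivity), ← Real.inv_rpow (by positivity),
      ← Real.mul_rpow (by positivity) (by positivity)]
    congr 1
    field_simp
  rw [h, ← mul_assoc]
  gcongr

/-! ### Gaussian smoothing of compactly supported priors -/

/-- `f` is the density of a nonzero finite measure carried by the ball of radius `R`. -/
structure IsCompactPrior (f : E → ℝ) (R : ℝ) : Prop where
  measurable : Measurable f
  nonneg : ∀ μ, 0 ≤ f μ
  integrable : Integrable f
  eq_zero : ∀ μ, R < ‖μ‖ → f μ = 0
  integral_pos : 0 < ∫ μ, f μ

theorem marginal_eq_integral_mul (v : ℝ) (f : E → ℝ) (z : E) :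
    marginal v f z = ∫ μ, normalDensity v μ z * f μ := rfl

theorem measurable_integral_of_measurable_uncurry {α : Type*} [MeasurableSpace α] {F : Type*}
    [NormedAddCommGroup F] [NormedSpace ℝ F] [MeasurableSpace F] [BorelSpace F]
    [SecondCountableTopology F] {g : α → E → F}
    (hg : Measurable (Function.uncurry g)) : Measurable fun a => ∫ μ, g a μ :=
  (StronglyMeasurable.integral_prod_right hg.stronglyMeasurable).measurable

namespace IsCompactPrior

variable {f : EuclideanSpace ℝ (Fin p) → ℝ} {R : ℝ}

theorem integrable_mul (hf : IsCompactPrior f R) {g : E → ℝ} (hg : Continuous g) :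
    Integrable fun μ => g μ * f μ := by
  obtain ⟨C, hC⟩ := (isCompact_closedBall (0 : E) R).exists_bound_of_continuousOn hg.continuousOn
  refine (hf.integrable.const_mul C).mono'
    (hg.aestronglyMeasurable.mul hf.measurable.aestronglyMeasurable)
    (Filter.Eventually.of_forall fun μ => ?_)
  rw [norm_mul, Real.norm_of_nonneg (hf.nonneg μ)]
  by_cases h : ‖μ‖ ≤ R
  · exact mul_le_mul_of_nonneg_right (hC μ (by simpa using h)) (hf.nonneg μ)
  · simp [hf.eq_zero μ (not_le.1 h)]

/-- Differentiation under the integral sign against a compactly supported prior: continuity of the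
differentiated kernel is enough, since it gives the bound required for dominated convergence. -/
theorem hasDerivAt_integral (hf : IsCompactPrior f R) {K K' : ℝ → E → ℝ} {s ε : ℝ} (hε : 0 < ε)
    (hK : ∀ t, Continuous (K t))
    (hK' : ContinuousOn (Function.uncurry K') (Metric.closedBall s ε ×ˢ Set.univ))
    (hd : ∀ μ, ∀ t ∈ Metric.closedBall s ε, HasDerivAt (fun t => K t μ) (K' t μ) t) :
    HasDerivAt (fun t => ∫ μ, K t μ * f μ) (∫ μ, K' s μ * f μ) s := by
  obtain ⟨C, hC⟩ := ((isCompact_closedBall s ε).prod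
    (isCompact_closedBall (0 : E) R)).exists_bound_of_continuousOn
      (hK'.mono (Set.prod_mono_right (Set.subset_univ _)))
  have hcont : Continuous (K' s) := by
    rw [← continuousOn_univ]
    exact hK'.comp (f := fun μ => (s, μ)) (by fun_prop)
      fun μ _ => ⟨Metric.mem_closedBall_self hε.le, trivial⟩
  refine (hasDerivAt_integral_of_dominated_loc_of_deriv_le (bound := fun μ => C * f μ)
    (Metric.closedBall_mem_nhds s hε)
    (Filter.Eventually.of_forall fun t => (hf.integrable_mul (hK t)).aestronglyMeasurable)
    (hf.integrable_mul (hK s)) (hf.integrable_mul hcont).aestronglyMeasurable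
    (Filter.Eventually.of_forall fun μ t ht => ?_) (hf.integrable.const_mul C)
    (Filter.Eventually.of_forall fun μ t ht => (hd μ t ht).mul_const _)).2
  rw [norm_mul, Real.norm_of_nonneg (hf.nonneg μ)]
  by_cases h : ‖μ‖ ≤ R
  · exact mul_le_mul_of_nonneg_right (hC (t, μ) ⟨ht, by simpa using h⟩) (hf.nonneg μ)
  · simp [hf.eq_zero μ (not_le.1 h)]

theorem abs_integral_mul_le (hf : IsCompactPrior f R) {w g : E → ℝ} {C : ℝ} (hw : Continuous w)
    (hg : Continuous g) (hg0 : ∀ μ, 0 ≤ g μ) (h : ∀ μ, ‖μ‖ ≤ R → |w μ| ≤ C) :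
    |∫ μ, (w μ * g μ) * f μ| ≤ C * ∫ μ, g μ * f μ := by
  rw [← Real.norm_eq_abs, ← integral_const_mul]
  refine (norm_integral_le_integral_norm _).trans (integral_mono
    (hf.integrable_mul (hw.mul hg)).norm ((hf.integrable_mul hg).const_mul C) fun μ => ?_)
  simp only [norm_mul, Real.norm_eq_abs, abs_of_nonneg (hf.nonneg μ), abs_of_nonneg (hg0 μ)]
  by_cases hμ : ‖μ‖ ≤ R
  · rw [mul_assoc]
    exact mul_le_mul_of_nonneg_right (h μ hμ) (mul_nonneg (hg0 μ) (hf.nonneg μ))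
  · simp [hf.eq_zero μ (not_le.1 hμ)]

theorem integral_mul_mono (hf : IsCompactPrior f R) {g h : E → ℝ} (hg : Continuous g)
    (hh : Continuous h) (hgh : ∀ μ, ‖μ‖ ≤ R → g μ ≤ h μ) :
    ∫ μ, g μ * f μ ≤ ∫ μ, h μ * f μ := by
  refine integral_mono (hf.integrable_mul hg) (hf.integrable_mul hh) fun μ => ?_
  by_cases hμ : ‖μ‖ ≤ R
  · exact mul_le_mul_of_nonneg_right (hgh μ hμ) (hf.nonneg μ)
  · simp [hf.eq_zero μ (not_le.1 hμ)]

theorem radius_nonneg (hf : IsCompactPrior f R) : 0 ≤ R := by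
  by_contra h
  have : f = 0 := funext fun μ => hf.eq_zero μ ((not_le.1 h).trans_le (norm_nonneg μ))
  simpa [this] using hf.integral_pos

theorem marginal_pos (hf : IsCompactPrior f R) {v : ℝ} (hv : 0 < v) (z : E) :
    0 < marginal v f z := by
  rw [marginal_eq_integral_mul, integral_pos_iff_support_of_nonneg
    (fun μ => mul_nonneg (normalDensity_nonneg hv μ z) (hf.nonneg μ))
    (hf.integrable_mul (continuous_normalDensity v continuous_id continuous_const))]
  have h := hf.integral_pos
  rw [integral_pos_iff_support_of_nonneg hf.nonneg hf.integrable] at h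
  convert! h using 2
  ext μ
  simp [(normalDensity_pos hv μ z).ne']

end IsCompactPrior

/-- The gradient in `z` of the marginal `m_f(z; v)`, differentiated under the integral sign. -/
def gradMarginal (v : ℝ) (f : E → ℝ) (z : E) : E :=
  ∫ μ, (normalDensity v μ z * f μ) • (v⁻¹ • (μ - z))

/-- The second derivative in the `j`-th coordinate of the marginal `m_f(z; v)`, differentiated under
the integral sign. -/
def secondMarginal (v : ℝ) (f : E → ℝ) (j : Fin p) (z : E) : ℝ :=
  ∫ μ, (((z j - μ j) ^ 2 / v ^ 2 - 1 / v) * normalDensity v μ z) * f μ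

theorem measurable_marginal_uncurry {f : E → ℝ} (hf : Measurable f) :
    Measurable fun a : ℝ × E => marginal a.1 f a.2 := by
  refine measurable_integral_of_measurable_uncurry (g := fun (a : ℝ × E) μ =>
    normalDensity a.1 μ a.2 * f μ) ?_
  exact (measurable_normalDensity' (by fun_prop) (by fun_prop) (by fun_prop)).mul (by fun_prop)

theorem measurable_marginal {f : E → ℝ} (hf : Measurable f) (v : ℝ) : Measurable (marginal v f) :=
  (measurable_marginal_uncurry hf).comp (measurable_const.prodMk measurable_id)

theorem measurable_gradMarginal {f : E → ℝ} (hf : Measurable f) (v : ℝ) :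
    Measurable (gradMarginal v f) := by
  refine measurable_integral_of_measurable_uncurry (g := fun (z : E) μ =>
    (normalDensity v μ z * f μ) • (v⁻¹ • (μ - z))) ?_
  exact ((measurable_normalDensity' measurable_const measurable_snd measurable_fst).mul
    (by fun_prop)).smul (by fun_prop)

theorem measurable_secondMarginal {f : E → ℝ} (hf : Measurable f) (v : ℝ) (j : Fin p) :
    Measurable (secondMarginal v f j) := by
  refine measurable_integral_of_measurable_uncurry (g := fun (z : E) μ =>
    (((z j - μ j) ^ 2 / v ^ 2 - 1 / v) * normalDensity v μ z) * f μ) ?_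
  exact ((by fun_prop : Measurable fun a : E × E =>
    ((a.1 j - a.2 j) ^ 2 / v ^ 2 - 1 / v)).mul
      (measurable_normalDensity' measurable_const measurable_snd measurable_fst)).mul
        (by fun_prop)

theorem gradMarginal_apply {f : E → ℝ} {R : ℝ} (hf : IsCompactPrior f R) (v : ℝ) (j : Fin p)
    (z : E) :
    gradMarginal v f z j = ∫ μ, (((μ j - z j) / v) * normalDensity v μ z) * f μ := by
  have hint : Integrable fun μ => (normalDensity v μ z * f μ) • (v⁻¹ • (μ - z)) := by
    have h := hf.integrable_mul (g := fun μ => ‖v⁻¹ • (μ - z)‖ * normalDensity v μ z)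
      ((by fun_prop : Continuous fun μ : E => ‖v⁻¹ • (μ - z)‖).mul
        (continuous_normalDensity v continuous_id continuous_const))
    refine h.mono ?_ (Filter.Eventually.of_forall fun μ => ?_)
    · exact (((measurable_normalDensity' measurable_const measurable_id measurable_const).mul
        hf.measurable).smul (by fun_prop : Measurable fun μ : E => v⁻¹ • (μ - z))).aestronglyMeasurable
    · simp only [norm_smul, norm_mul, norm_norm]
      apply le_of_eq; ring
  have h := (EuclideanSpace.proj (𝕜 := ℝ) j).integral_comp_comm hint
  change (EuclideanSpace.proj (𝕜 := ℝ) j) (gradMarginal v f z) = _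
  rw [gradMarginal, ← h]
  refine integral_congr_ae (Filter.Eventually.of_forall fun μ => ?_)
  simp
  ring

/-! ### Derivatives of the kernel -/

theorem hasDerivAt_normalDensity_variance {v : ℝ} (hv : 0 < v) (μ z : E) :
    HasDerivAt (fun v => normalDensity v μ z)
      ((1 / 2 * ∑ j, ((z j - μ j) ^ 2 / v ^ 2 - 1 / v)) * normalDensity v μ z) v := by
  have hpi := Real.pi_pos
  have h1 : HasDerivAt (fun v : ℝ => (2 * Real.pi * v) ^ (-((p : ℝ) / 2)))
      (2 * Real.pi * (-((p : ℝ) / 2)) * (2 * Real.pi * v) ^ (-((p : ℝ) / 2) - 1)) v := by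
    have := ((hasDerivAt_id v).const_mul (2 * Real.pi)).rpow_const (p := -((p : ℝ) / 2))
      (Or.inl (by simp; positivity))
    simpa using this
  have h2 : HasDerivAt (fun v : ℝ => -(‖z - μ‖ ^ 2 / (2 * v))) (‖z - μ‖ ^ 2 / (2 * v ^ 2)) v := by
    have := (((hasDerivAt_id v).const_mul 2).inv (by simp; positivity)).const_mul (-‖z - μ‖ ^ 2)
    refine (this.congr_deriv ?_).congr_of_eventuallyEq ?_
    · simp
      field_simp
    · refine Filter.Eventually.of_forall fun v => ?_
      simp [div_eq_mul_inv]
  have h3 := h1.mul h2.exp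
  unfold normalDensity
  refine h3.congr_deriv ?_
  have hs : ∑ j, ((z j - μ j) ^ 2 / v ^ 2 - 1 / v) = ‖z - μ‖ ^ 2 / v ^ 2 - p / v := by
    rw [Finset.sum_sub_distrib, ← Finset.sum_div, EuclideanSpace.norm_sq_eq]
    simp [div_eq_mul_inv]
  rw [hs, Real.rpow_sub_one (by positivity)]
  field_simp
  ring

theorem hasDerivAt_normalDensity_line (v : ℝ) (μ z : E) (j : Fin p) (t : ℝ) :
    HasDerivAt (fun t : ℝ => normalDensity v μ (z + t • EuclideanSpace.single j 1))
      (((μ j - (z + t • EuclideanSpace.single j 1 : E) j) / v) *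
        normalDensity v μ (z + t • EuclideanSpace.single j 1)) t := by
  set e : E := EuclideanSpace.single j 1
  have h0 : HasDerivAt (fun t : ℝ => z + t • e - μ) e t := by
    simpa using (((hasDerivAt_id t).smul_const e).const_add z).sub_const μ
  have h1 := (((h0.norm_sq).div_const (2 * v)).neg).exp.const_mul
    ((2 * Real.pi * v) ^ (-((p : ℝ) / 2)))
  unfold normalDensity
  refine h1.congr_deriv ?_
  have h2 : inner ℝ (z + t • e - μ) e = (z + t • e) j - μ j := by
    simp [e, EuclideanSpace.inner_single_right]
  rw [h2]
  rcases eq_or_ne v 0 with rfl | hv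
  · simp
  · simp only [Pi.neg_apply]
    field_simp
    ring

theorem continuousOn_normalDensity {α : Type*} [TopologicalSpace α] {s : Set α} {v : α → ℝ}
    {f g : α → E} (hv : ContinuousOn v s) (hpos : ∀ a ∈ s, 0 < v a) (hf : ContinuousOn f s)
    (hg : ContinuousOn g s) : ContinuousOn (fun a => normalDensity (v a) (f a) (g a)) s := by
  have hpi := Real.pi_pos
  unfold normalDensity
  refine ContinuousOn.mul (ContinuousOn.rpow_const (by fun_prop) fun a ha => Or.inl ?_) ?_
  · have := hpos a ha
    positivity
  · refine Real.continuous_exp.comp_continuousOn (ContinuousOn.neg (ContinuousOn.div (by fun_prop)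
      (by fun_prop) fun a ha => ?_))
    have := hpos a ha
    positivity

/-! ### Derivatives and Gaussian bounds for marginals -/

namespace IsCompactPrior

variable {f : EuclideanSpace ℝ (Fin p) → ℝ} {R : ℝ}

/-- The marginals solve the heat equation `∂ᵥ m = Δ m / 2`. -/
theorem hasDerivAt_marginal_variance (hf : IsCompactPrior f R) {v : ℝ} (hv : 0 < v) (z : E) :
    HasDerivAt (fun v => marginal v f z) (1 / 2 * ∑ j, secondMarginal v f j z) v := by
  have hpos : ∀ t ∈ Metric.closedBall v (v / 2), 0 < t := fun t ht => by
    rw [Real.closedBall_eq_Icc] at ht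
    linarith [ht.1]
  have h := hf.hasDerivAt_integral (K := fun v μ => normalDensity v μ z)
    (K' := fun v μ => (1 / 2 * ∑ j, ((z j - μ j) ^ 2 / v ^ 2 - 1 / v)) * normalDensity v μ z)
    (s := v) (ε := v / 2) (by positivity)
    (fun t => continuous_normalDensity t continuous_id continuous_const) ?_
    (fun μ t ht => hasDerivAt_normalDensity_variance (hpos t ht) μ z)
  · refine h.congr_deriv ?_
    simp only [secondMarginal]
    rw [← integral_finsetSum, ← integral_const_mul]
    · refine integral_congr_ae (Filter.Eventually.of_forall fun μ => ?_)
      simp only [Finset.sum_mul, Finset.mul_sum]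
      exact Finset.sum_congr rfl fun j _ => by ring
    · intro j _
      exact hf.integrable_mul ((by fun_prop : Continuous fun μ : E =>
        ((z j - μ j) ^ 2 / v ^ 2 - 1 / v)).mul
          (continuous_normalDensity v continuous_id continuous_const))
  · have hpos' : ∀ a ∈ Metric.closedBall v (v / 2) ×ˢ (Set.univ : Set E), 0 < a.1 :=
      fun a ha => hpos _ ha.1
    refine ContinuousOn.mul (ContinuousOn.mul continuousOn_const ?_)
      (continuousOn_normalDensity (by fun_prop) hpos' (by fun_prop) (by fun_prop))
    refine continuousOn_finsetSum _ fun j _ => ContinuousOn.sub (ContinuousOn.div (by fun_prop)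
      (by fun_prop) fun a ha => ?_) (ContinuousOn.div (by fun_prop) (by fun_prop) fun a ha => ?_)
    · have := hpos' a ha
      positivity
    · exact (hpos' a ha).ne'

theorem hasLineDerivAt_marginal (hf : IsCompactPrior f R) (v : ℝ) (z : E) (j : Fin p) :
    HasLineDerivAt ℝ (marginal v f) (gradMarginal v f z j) z (EuclideanSpace.single j 1) := by
  have h := hf.hasDerivAt_integral
    (K := fun t μ => normalDensity v μ (z + t • EuclideanSpace.single j 1))
    (K' := fun t μ => ((μ j - (z + t • EuclideanSpace.single j 1 : E) j) / v) *
        normalDensity v μ (z + t • EuclideanSpace.single j 1))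
    (s := 0) (ε := 1) one_pos
    (fun t => continuous_normalDensity v continuous_id continuous_const) ?_
    (fun μ t _ => hasDerivAt_normalDensity_line v μ z j t)
  · refine HasDerivAt.congr_deriv h ?_
    rw [gradMarginal_apply hf]
    simp
  · refine Continuous.continuousOn ?_
    exact Continuous.mul (by fun_prop)
      (continuous_normalDensity v continuous_snd (by fun_prop))

theorem hasLineDerivAt_gradMarginal (hf : IsCompactPrior f R) (v : ℝ) (z : E) (j : Fin p) :
    HasLineDerivAt ℝ (fun z => gradMarginal v f z j) (secondMarginal v f j z) z
      (EuclideanSpace.single j 1) := by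
  have h := hf.hasDerivAt_integral
    (K := fun t μ => ((μ j - (z + t • EuclideanSpace.single j 1 : E) j) / v) *
        normalDensity v μ (z + t • EuclideanSpace.single j 1))
    (K' := fun t μ => (((z + t • EuclideanSpace.single j 1 : E) j - μ j) ^ 2 / v ^ 2 - 1 / v) *
        normalDensity v μ (z + t • EuclideanSpace.single j 1))
    (s := 0) (ε := 1) one_pos
    (fun t => Continuous.mul (by fun_prop)
      (continuous_normalDensity v continuous_id continuous_const)) ?_ (fun μ t _ => ?_)
  · have h' : HasDerivAt (fun t : ℝ => gradMarginal v f (z + t • EuclideanSpace.single j 1) j) _ 0 :=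
      h.congr_of_eventuallyEq (Filter.Eventually.of_forall fun t => gradMarginal_apply hf v j _)
    refine HasDerivAt.congr_deriv h' ?_
    simp [secondMarginal]
  · refine Continuous.continuousOn ?_
    exact Continuous.mul (by fun_prop)
      (continuous_normalDensity v continuous_snd (by fun_prop))
  · have h1 : HasDerivAt (fun t : ℝ =>
        (μ j - (z + t • EuclideanSpace.single j 1 : E) j) / v) (-1 / v) t := by
      have : HasDerivAt (fun t : ℝ => (μ j - (z j + t)) / v) (-1 / v) t := by
        simpa using (((hasDerivAt_id t).const_add (z j)).const_sub (μ j)).div_const v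
      simpa using this
    refine (h1.mul (hasDerivAt_normalDensity_line v μ z j t)).congr_deriv ?_
    ring

/-- The Gaussian bounds that make all integrals below converge, uniformly for variances in a compact
interval: the marginal has Gaussian decay, while its logarithm and the ratios of its derivatives to
itself grow at most quadratically. -/
theorem exists_bounds (hf : IsCompactPrior f R) {a b : ℝ} (ha : 0 < a) (hab : a ≤ b) :
    ∃ C c : ℝ, 0 < C ∧ 0 < c ∧ ∀ v ∈ Set.Icc a b, ∀ z : E,
      marginal v f z ≤ C * Real.exp (-c * ‖z‖ ^ 2) ∧
      |Real.log (marginal v f z)| ≤ C * (1 + ‖z‖ ^ 2) ∧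
      (∀ j, |gradMarginal v f z j| ≤ C * (1 + ‖z‖ ^ 2) * marginal v f z) ∧
      (∀ j, |secondMarginal v f j z| ≤ C * (1 + ‖z‖ ^ 2) * marginal v f z) := by
  have hb : 0 < b := ha.trans_le hab
  have hR := hf.radius_nonneg
  have hpi := Real.pi_pos
  set M := ∫ μ, f μ with hM
  have hMpos : 0 < M := hf.integral_pos
  set Ka := (2 * Real.pi * a) ^ (-((p : ℝ) / 2)) with hKa
  set Kb := (2 * Real.pi * b) ^ (-((p : ℝ) / 2)) with hKb
  have hKapos : 0 < Ka := by positivity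
  have hKbpos : 0 < Kb := by positivity
  have hnorm : ∀ v ∈ Set.Icc a b, Kb ≤ (2 * Real.pi * v) ^ (-((p : ℝ) / 2)) ∧
      (2 * Real.pi * v) ^ (-((p : ℝ) / 2)) ≤ Ka := fun v hv => by
    have hv0 : 0 < v := ha.trans_le hv.1
    constructor
    · apply Real.rpow_le_rpow_of_nonpos (by positivity)
      · gcongr; exact hv.2
      · simp; positivity
    · apply Real.rpow_le_rpow_of_nonpos (by positivity)
      · gcongr; exact hv.1
      · simp; positivity
  -- upper and lower Gaussian bounds, from `‖z‖²/2 - R² ≤ ‖z - μ‖² ≤ 2‖z‖² + 2R²`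
  have hup : ∀ v ∈ Set.Icc a b, ∀ z : E, marginal v f z ≤
      Ka * Real.exp (R ^ 2 / (2 * a)) * M * Real.exp (-(1 / (4 * b)) * ‖z‖ ^ 2) := fun v hv z => by
    have hv0 : 0 < v := ha.trans_le hv.1
    have h := hf.integral_mul_mono (g := fun μ => normalDensity v μ z)
      (h := fun _ => Ka * Real.exp (R ^ 2 / (2 * a)) * Real.exp (-(1 / (4 * b)) * ‖z‖ ^ 2))
      (continuous_normalDensity v continuous_id continuous_const) continuous_const fun μ hμ => ?_
    · rw [integral_const_mul] at h
      rw [marginal_eq_integral_mul]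
      exact h.trans (le_of_eq (by ring))
    · rw [mul_assoc, ← Real.exp_add]
      unfold normalDensity
      gcongr
      · exact (hnorm v hv).2
      have h1 : ‖z‖ ≤ ‖z - μ‖ + ‖μ‖ := by simpa using norm_add_le (z - μ) μ
      have h2 : ‖z‖ ^ 2 ≤ 2 * ‖z - μ‖ ^ 2 + 2 * R ^ 2 := by
        nlinarith [norm_nonneg z, norm_nonneg (z - μ), norm_nonneg μ, sq_nonneg (‖z - μ‖ - ‖μ‖)]
      have h3 : ‖z‖ ^ 2 / (4 * b) ≤ ‖z‖ ^ 2 / (4 * v) := by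
        gcongr; exact hv.2
      have h4 : R ^ 2 / (2 * v) ≤ R ^ 2 / (2 * a) := by
        gcongr; exact hv.1
      have h5 : ‖z‖ ^ 2 / (4 * v) ≤ ‖z - μ‖ ^ 2 / (2 * v) + R ^ 2 / (2 * v) := by
        rw [← add_div, div_le_div_iff₀ (by positivity) (by positivity)]
        nlinarith
      have h6 : -(1 / (4 * b)) * ‖z‖ ^ 2 = -(‖z‖ ^ 2 / (4 * b)) := by ring
      rw [h6]
      linarith
  have hlow : ∀ v ∈ Set.Icc a b, ∀ z : E,
      Kb * M * Real.exp (-((‖z‖ ^ 2 + R ^ 2) / a)) ≤ marginal v f z := fun v hv z => by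
    have hv0 : 0 < v := ha.trans_le hv.1
    have h := hf.integral_mul_mono (h := fun μ => normalDensity v μ z)
      (g := fun _ => Kb * Real.exp (-((‖z‖ ^ 2 + R ^ 2) / a))) continuous_const
      (continuous_normalDensity v continuous_id continuous_const) fun μ hμ => ?_
    · rw [integral_const_mul] at h
      rw [marginal_eq_integral_mul]
      exact le_trans (le_of_eq (by ring)) h
    · unfold normalDensity
      refine mul_le_mul (hnorm v hv).1 (Real.exp_le_exp.2 (neg_le_neg ?_)) (by positivity)
        (by positivity)
      have h1 : ‖z - μ‖ ≤ ‖z‖ + ‖μ‖ := norm_sub_le z μ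
      have h2 : ‖z - μ‖ ^ 2 ≤ 2 * (‖z‖ ^ 2 + R ^ 2) := by
        nlinarith [norm_nonneg z, norm_nonneg (z - μ), norm_nonneg μ, sq_nonneg (‖z‖ - ‖μ‖)]
      calc ‖z - μ‖ ^ 2 / (2 * v) ≤ 2 * (‖z‖ ^ 2 + R ^ 2) / (2 * a) := by
            gcongr; exact hv.1
        _ = _ := by field_simp
  set C1 := Ka * Real.exp (R ^ 2 / (2 * a)) * M with hC1
  have hC1pos : 0 < C1 := by positivity
  set C2 := |Real.log C1| + |Real.log (Kb * M)| + (1 + R ^ 2) / a with hC2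
  set C3 := 2 * (1 + R ^ 2) / a ^ 2 + 1 / a + (1 + R) / a with hC3
  have hC2pos : 0 ≤ C2 := by positivity
  have hC3pos : 0 ≤ C3 := by positivity
  refine ⟨C1 + C2 + C3, 1 / (4 * b), by positivity, by positivity, fun v hv z => ?_⟩
  have hv0 : 0 < v := ha.trans_le hv.1
  have hu := hf.marginal_pos hv0 z
  have hz : 0 ≤ ‖z‖ ^ 2 := sq_nonneg _
  refine ⟨(hup v hv z).trans ?_, ?_, fun j => ?_, fun j => ?_⟩
  · gcongr
    linarith
  · have h1 : Real.log (marginal v f z) ≤ Real.log C1 := by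
      refine Real.log_le_log hu ((hup v hv z).trans ?_)
      refine mul_le_of_le_one_right hC1pos.le (Real.exp_le_one_iff.2 ?_)
      have : 0 ≤ 1 / (4 * b) * ‖z‖ ^ 2 := by positivity
      linarith
    have h2 : Real.log (Kb * M) - (‖z‖ ^ 2 + R ^ 2) / a ≤ Real.log (marginal v f z) := by
      have := Real.log_le_log (by positivity) (hlow v hv z)
      rwa [Real.log_mul (by positivity) (by positivity), Real.log_exp] at this
    have h3 := le_abs_self (Real.log C1)
    have h4 := neg_abs_le (Real.log (Kb * M))
    have h5 : (‖z‖ ^ 2 + R ^ 2) / a ≤ (1 + R ^ 2) / a * (1 + ‖z‖ ^ 2) := by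
      rw [div_mul_eq_mul_div]
      gcongr
      nlinarith [sq_nonneg R, mul_nonneg (sq_nonneg R) hz]
    have h6 : 0 ≤ |Real.log C1| * ‖z‖ ^ 2 := by positivity
    have h7 : 0 ≤ |Real.log (Kb * M)| * ‖z‖ ^ 2 := by positivity
    have h8 : 0 ≤ (C1 + C3) * (1 + ‖z‖ ^ 2) := by positivity
    have h9 : 0 ≤ (1 + R ^ 2) / a * (1 + ‖z‖ ^ 2) := by positivity
    have h10 : (C1 + C2 + C3) * (1 + ‖z‖ ^ 2) = (C1 + C3) * (1 + ‖z‖ ^ 2) +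
        (|Real.log C1| + |Real.log C1| * ‖z‖ ^ 2) +
        (|Real.log (Kb * M)| + |Real.log (Kb * M)| * ‖z‖ ^ 2) +
        (1 + R ^ 2) / a * (1 + ‖z‖ ^ 2) := by rw [hC2]; ring
    rw [abs_le, h10]
    constructor <;> linarith [abs_nonneg (Real.log C1), abs_nonneg (Real.log (Kb * M))]
  · rw [gradMarginal_apply hf, marginal_eq_integral_mul]
    refine hf.abs_integral_mul_le (by fun_prop)
      (continuous_normalDensity v continuous_id continuous_const)
      (fun μ => normalDensity_nonneg hv0 μ z) fun μ hμ => ?_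
    have h1 : |μ j - z j| ≤ ‖z‖ + R := by
      have h11 : |(μ - z) j| ≤ ‖μ - z‖ := by
        simpa using EuclideanSpace.norm_eq (μ - z) ▸ PiLp.norm_apply_le (μ - z) j
      have h12 := norm_sub_le μ z
      simp only [PiLp.sub_apply] at h11
      linarith
    rw [abs_div, abs_of_pos hv0]
    have h2 : |μ j - z j| / v ≤ (‖z‖ + R) / a := by gcongr; exact hv.1
    have h3 : (‖z‖ + R) / a ≤ (1 + R) / a * (1 + ‖z‖ ^ 2) := by
      rw [div_mul_eq_mul_div]
      gcongr
      nlinarith [sq_nonneg (‖z‖ - 1 / 2), mul_nonneg hR hz]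
    have h4 : (1 + R) / a * (1 + ‖z‖ ^ 2) ≤ (C1 + C2 + C3) * (1 + ‖z‖ ^ 2) := by
      gcongr
      have : 0 ≤ 2 * (1 + R ^ 2) / a ^ 2 + 1 / a := by positivity
      linarith
    linarith
  · rw [secondMarginal, marginal_eq_integral_mul]
    refine hf.abs_integral_mul_le (by fun_prop)
      (continuous_normalDensity v continuous_id continuous_const)
      (fun μ => normalDensity_nonneg hv0 μ z) fun μ hμ => ?_
    have h1 : |z j - μ j| ≤ ‖z‖ + R := by
      have h11 : |(z - μ) j| ≤ ‖z - μ‖ := by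
        simpa using EuclideanSpace.norm_eq (z - μ) ▸ PiLp.norm_apply_le (z - μ) j
      have h12 := norm_sub_le z μ
      simp only [PiLp.sub_apply] at h11
      linarith
    have h1' : (z j - μ j) ^ 2 ≤ 2 * (1 + R ^ 2) * (1 + ‖z‖ ^ 2) := by
      rw [← sq_abs]
      calc |z j - μ j| ^ 2 ≤ (‖z‖ + R) ^ 2 := by gcongr
        _ ≤ _ := by nlinarith [sq_nonneg (‖z‖ - R), mul_nonneg (sq_nonneg R) hz]
    have h2 : (z j - μ j) ^ 2 / v ^ 2 ≤ 2 * (1 + R ^ 2) * (1 + ‖z‖ ^ 2) / a ^ 2 := by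
      gcongr; exact hv.1
    have h3 : 1 / v ≤ 1 / a := by gcongr; exact hv.1
    have h4 : 0 ≤ (z j - μ j) ^ 2 / v ^ 2 := by positivity
    have h5 : 0 ≤ 1 / v := by positivity
    have h6 : 0 ≤ 1 / a * ‖z‖ ^ 2 := by positivity
    have h7 : 0 ≤ (C1 + C2 + (1 + R) / a) * (1 + ‖z‖ ^ 2) := by positivity
    have h8 : (C1 + C2 + C3) * (1 + ‖z‖ ^ 2) = (C1 + C2 + (1 + R) / a) * (1 + ‖z‖ ^ 2) +
        2 * (1 + R ^ 2) * (1 + ‖z‖ ^ 2) / a ^ 2 + (1 / a + 1 / a * ‖z‖ ^ 2) := by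
      rw [hC3]; ring
    rw [abs_le, h8]
    constructor <;> linarith

end IsCompactPrior

/-! ### Relative entropy along the heat flow -/

/-- The relative entropy `∫ m₁ log (m₁ / m₂)` of the marginals of two priors at variance `v`. -/
def relEntropy (f₁ f₂ : E → ℝ) (v : ℝ) : ℝ :=
  ∫ z, marginal v f₁ z * (Real.log (marginal v f₁ z) - Real.log (marginal v f₂ z))

/-- The score `∇ log m_f(z; v)` of a marginal. -/
def score (v : ℝ) (f : E → ℝ) (z : E) : E := (marginal v f z)⁻¹ • gradMarginal v f z

/-- The relative Fisher information `∫ m₁ ‖∇ log m₁ - ∇ log m₂‖²` of two marginals. -/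
def relFisher (f₁ f₂ : E → ℝ) (v : ℝ) : ℝ :=
  ∫ z, marginal v f₁ z * ‖score v f₁ z - score v f₂ z‖ ^ 2

theorem integrable_one_add_sq_mul_exp {c : ℝ} (hc : 0 < c) (D : ℝ) :
    Integrable fun z : E => D * ((1 + ‖z‖ ^ 2) ^ 2 * Real.exp (-c * ‖z‖ ^ 2)) := by
  refine Integrable.const_mul ?_ D
  refine ((integrable_exp_neg_mul_sq_norm (p := p) (half_pos hc)).const_mul
    ((1 + 4 / c) ^ 2)).mono' (by fun_prop) (Filter.Eventually.of_forall fun z => ?_)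
  have hz : 0 ≤ ‖z‖ ^ 2 := sq_nonneg _
  rw [Real.norm_of_nonneg (by positivity)]
  -- `1 + s ≤ (1 + 4 / c) (1 + c s / 4) ≤ (1 + 4 / c) exp (c s / 4)`
  have h1 : 1 + ‖z‖ ^ 2 ≤ (1 + 4 / c) * Real.exp (c / 4 * ‖z‖ ^ 2) := by
    have h2 := Real.add_one_le_exp (c / 4 * ‖z‖ ^ 2)
    calc 1 + ‖z‖ ^ 2 ≤ (1 + 4 / c) * (c / 4 * ‖z‖ ^ 2 + 1) := by
          have : (1 + 4 / c) * (c / 4 * ‖z‖ ^ 2 + 1) =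
            1 + ‖z‖ ^ 2 + (c / 4 * ‖z‖ ^ 2 + 4 / c) := by field_simp; ring
          rw [this]
          have : 0 ≤ c / 4 * ‖z‖ ^ 2 + 4 / c := by positivity
          linarith
      _ ≤ _ := by gcongr
  calc (1 + ‖z‖ ^ 2) ^ 2 * Real.exp (-c * ‖z‖ ^ 2)
      ≤ ((1 + 4 / c) * Real.exp (c / 4 * ‖z‖ ^ 2)) ^ 2 * Real.exp (-c * ‖z‖ ^ 2) := by gcongr
    _ = (1 + 4 / c) ^ 2 * Real.exp (-(c / 2) * ‖z‖ ^ 2) := by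
        rw [mul_pow, ← Real.exp_nat_mul, mul_assoc, ← Real.exp_add]
        congr 2
        push_cast
        ring

theorem integral_eq_zero_of_hasLineDerivAt {W W' : E → ℝ} {e : E} (hW : Integrable W)
    (hW' : Integrable W') (h : ∀ z, HasLineDerivAt ℝ W (W' z) z e) : ∫ z, W' z = 0 := by
  have := integral_bilinear_hasLineDerivAt_right_eq_neg_left_of_integrable (μ := volume)
    (f := fun _ : E => (1 : ℝ)) (f' := fun _ => 0) (g := W) (g' := W') (v := e)
    (B := ContinuousLinearMap.mul ℝ ℝ) (by simp) (by simpa using hW') (by simpa using hW)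
    (fun z _ => by simpa [HasLineDerivAt] using hasDerivAt_const (0 : ℝ) (1 : ℝ)) (fun z _ => h z)
  simpa using this

section

variable {f₁ f₂ : EuclideanSpace ℝ (Fin p) → ℝ} {R₁ R₂ : ℝ}

theorem exists_joint_bounds (h₁ : IsCompactPrior f₁ R₁) (h₂ : IsCompactPrior f₂ R₂) {a b : ℝ}
    (ha : 0 < a) (hab : a ≤ b) :
    ∃ C c : ℝ, 0 < C ∧ 0 < c ∧ ∀ v ∈ Set.Icc a b, ∀ z : E,
      marginal v f₁ z ≤ C * Real.exp (-c * ‖z‖ ^ 2) ∧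
      |Real.log (marginal v f₁ z) - Real.log (marginal v f₂ z)| ≤ C * (1 + ‖z‖ ^ 2) ∧
      (∀ j, |gradMarginal v f₁ z j| ≤ C * (1 + ‖z‖ ^ 2) * marginal v f₁ z) ∧
      (∀ j, |secondMarginal v f₁ j z| ≤ C * (1 + ‖z‖ ^ 2) * marginal v f₁ z) ∧
      (∀ j, |gradMarginal v f₂ z j| ≤ C * (1 + ‖z‖ ^ 2) * marginal v f₂ z) ∧
      (∀ j, |secondMarginal v f₂ j z| ≤ C * (1 + ‖z‖ ^ 2) * marginal v f₂ z) := by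
  obtain ⟨C₁, c, hC₁, hc, H₁⟩ := h₁.exists_bounds ha hab
  obtain ⟨C₂, c₂, hC₂, hc₂, H₂⟩ := h₂.exists_bounds ha hab
  refine ⟨C₁ + C₂, c, by positivity, hc, fun v hv z => ?_⟩
  obtain ⟨k1, k2, k3, k4⟩ := H₁ v hv z
  obtain ⟨-, l2, l3, l4⟩ := H₂ v hv z
  have hv0 := ha.trans_le hv.1
  have hu₁ := h₁.marginal_pos hv0 z
  have hu₂ := h₂.marginal_pos hv0 z
  refine ⟨k1.trans ?_, ?_, fun j => (k3 j).trans ?_, fun j => (k4 j).trans ?_,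
    fun j => (l3 j).trans ?_, fun j => (l4 j).trans ?_⟩
  · gcongr; linarith
  · refine (abs_sub _ _).trans ?_
    linarith
  all_goals gcongr; linarith

theorem integrable_relEntropy (h₁ : IsCompactPrior f₁ R₁) (h₂ : IsCompactPrior f₂ R₂) {v : ℝ}
    (hv : 0 < v) : Integrable fun z =>
      marginal v f₁ z * (Real.log (marginal v f₁ z) - Real.log (marginal v f₂ z)) := by
  obtain ⟨C, c, hC, hc, H⟩ := exists_joint_bounds h₁ h₂ hv le_rfl
  have hm₁ := measurable_marginal h₁.measurable v
  have hm₂ := measurable_marginal h₂.measurable v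
  refine (integrable_one_add_sq_mul_exp (p := p) hc (C * C)).mono'
    (by fun_prop) (Filter.Eventually.of_forall fun z => ?_)
  obtain ⟨k1, k2, -⟩ := H v ⟨le_rfl, le_rfl⟩ z
  have hu₁ := h₁.marginal_pos hv z
  rw [norm_mul, Real.norm_of_nonneg hu₁.le, Real.norm_eq_abs]
  have hz : 0 ≤ ‖z‖ ^ 2 := sq_nonneg _
  calc marginal v f₁ z * |Real.log (marginal v f₁ z) - Real.log (marginal v f₂ z)|
      ≤ (C * Real.exp (-c * ‖z‖ ^ 2)) * (C * (1 + ‖z‖ ^ 2) ^ 2) := by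
        gcongr
        refine k2.trans ?_
        gcongr
        nlinarith
    _ = _ := by ring

theorem integrable_of_abs_le_marginal (h₁ : IsCompactPrior f₁ R₁) {v : ℝ} (hv : 0 < v) {W : E → ℝ}
    {D : ℝ} (hW : Measurable W) (hD : 0 ≤ D)
    (hb : ∀ z, |W z| ≤ D * (1 + ‖z‖ ^ 2) ^ 2 * marginal v f₁ z) : Integrable W := by
  obtain ⟨C, c, hC, hc, H⟩ := h₁.exists_bounds hv le_rfl
  refine (integrable_one_add_sq_mul_exp (p := p) hc (D * C)).mono'
    hW.aestronglyMeasurable (Filter.Eventually.of_forall fun z => ?_)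
  rw [Real.norm_eq_abs]
  refine (hb z).trans ?_
  calc D * (1 + ‖z‖ ^ 2) ^ 2 * marginal v f₁ z
      ≤ D * (1 + ‖z‖ ^ 2) ^ 2 * (C * Real.exp (-c * ‖z‖ ^ 2)) := by
        gcongr; exact (H v ⟨le_rfl, le_rfl⟩ z).1
    _ = _ := by ring

theorem abs_mul_add_one_sub_le {u₁ u₂ l s₁ s₂ C q : ℝ} (hu₁ : 0 < u₁) (hu₂ : 0 < u₂) (hC : 0 < C)
    (hq : 1 ≤ q) (hl : |l| ≤ C * q) (h₁ : |s₁| ≤ C * q * u₁) (h₂ : |s₂| ≤ C * q * u₂) :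
    |s₁ * (l + 1) - u₁ / u₂ * s₂| ≤ C * (C + 2) * q ^ 2 * u₁ := by
  have hl' : |l + 1| ≤ (C + 1) * q := by
    refine (abs_add_le _ _).trans ?_
    rw [abs_one]
    linarith
  have e1 : |s₁ * (l + 1)| ≤ C * q * u₁ * ((C + 1) * q) := by
    rw [abs_mul]
    gcongr
  have e2 : |u₁ / u₂ * s₂| ≤ C * q * u₁ := by
    rw [abs_mul, abs_of_pos (div_pos hu₁ hu₂), div_mul_eq_mul_div, div_le_iff₀ hu₂]
    calc u₁ * |s₂| ≤ u₁ * (C * q * u₂) := by gcongr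
      _ = _ := by ring
  have e3 : C * q * u₁ ≤ C * q ^ 2 * u₁ := by
    gcongr
    nlinarith
  refine (abs_sub _ _).trans ?_
  linarith

theorem integrable_secondMarginal_mul (h₁ : IsCompactPrior f₁ R₁) (h₂ : IsCompactPrior f₂ R₂)
    {v : ℝ} (hv : 0 < v) (j : Fin p) :
    Integrable fun z => secondMarginal v f₁ j z *
        (Real.log (marginal v f₁ z) - Real.log (marginal v f₂ z) + 1) -
        marginal v f₁ z / marginal v f₂ z * secondMarginal v f₂ j z := by
  obtain ⟨C, c, hC, hc, H⟩ := exists_joint_bounds h₁ h₂ hv le_rfl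
  have hm₁ := measurable_marginal h₁.measurable v
  have hm₂ := measurable_marginal h₂.measurable v
  have hs₁ := measurable_secondMarginal h₁.measurable v j
  have hs₂ := measurable_secondMarginal h₂.measurable v j
  refine integrable_of_abs_le_marginal h₁ hv (D := C * (C + 2)) (by fun_prop) (by positivity)
    fun z => ?_
  obtain ⟨-, k2, -, k4, -, k6⟩ := H v ⟨le_rfl, le_rfl⟩ z
  exact abs_mul_add_one_sub_le (h₁.marginal_pos hv z) (h₂.marginal_pos hv z) hC
    (by nlinarith [sq_nonneg ‖z‖]) k2 (k4 j) (k6 j)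

theorem integrable_gradMarginal_mul (h₁ : IsCompactPrior f₁ R₁) (h₂ : IsCompactPrior f₂ R₂)
    {v : ℝ} (hv : 0 < v) (j : Fin p) :
    Integrable fun z => gradMarginal v f₁ z j *
        (Real.log (marginal v f₁ z) - Real.log (marginal v f₂ z) + 1) -
        marginal v f₁ z / marginal v f₂ z * gradMarginal v f₂ z j := by
  obtain ⟨C, c, hC, hc, H⟩ := exists_joint_bounds h₁ h₂ hv le_rfl
  have hm₁ := measurable_marginal h₁.measurable v
  have hm₂ := measurable_marginal h₂.measurable v
  have hs₁ := measurable_gradMarginal h₁.measurable v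
  have hs₂ := measurable_gradMarginal h₂.measurable v
  refine integrable_of_abs_le_marginal h₁ hv (D := C * (C + 2)) (by fun_prop) (by positivity)
    fun z => ?_
  obtain ⟨-, k2, k3, -, k5, -⟩ := H v ⟨le_rfl, le_rfl⟩ z
  exact abs_mul_add_one_sub_le (h₁.marginal_pos hv z) (h₂.marginal_pos hv z) hC
    (by nlinarith [sq_nonneg ‖z‖]) k2 (k3 j) (k5 j)

theorem score_apply (v : ℝ) (f : E → ℝ) (z : E) (j : Fin p) :
    score v f z j = gradMarginal v f z j / marginal v f z := by
  simp [score, div_eq_inv_mul]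

theorem measurable_score {f : E → ℝ} (hf : Measurable f) (v : ℝ) : Measurable (score v f) := by
  have h₁ := measurable_marginal hf v
  have h₂ := measurable_gradMarginal hf v
  unfold score
  fun_prop

theorem integrable_marginal_mul_score_sq (h₁ : IsCompactPrior f₁ R₁) (h₂ : IsCompactPrior f₂ R₂)
    {v : ℝ} (hv : 0 < v) (j : Fin p) :
    Integrable fun z => marginal v f₁ z * (score v f₁ z j - score v f₂ z j) ^ 2 := by
  obtain ⟨C, c, hC, hc, H⟩ := exists_joint_bounds h₁ h₂ hv le_rfl
  have hm₁ := measurable_marginal h₁.measurable v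
  have hs : ∀ {f : E → ℝ}, Measurable f → Measurable fun z => score v f z j := fun hf =>
    (EuclideanSpace.proj (𝕜 := ℝ) j).continuous.measurable.comp (measurable_score hf v)
  refine integrable_of_abs_le_marginal h₁ hv (D := (2 * C) ^ 2)
    (hm₁.mul (((hs h₁.measurable).sub (hs h₂.measurable)).pow_const 2)) (by positivity) fun z => ?_
  obtain ⟨-, -, k3, -, k5, -⟩ := H v ⟨le_rfl, le_rfl⟩ z
  have hu₁ := h₁.marginal_pos hv z
  have hu₂ := h₂.marginal_pos hv z
  have e1 : |score v f₁ z j| ≤ C * (1 + ‖z‖ ^ 2) := by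
    rw [score_apply, abs_div, abs_of_pos hu₁, div_le_iff₀ hu₁]
    exact k3 j
  have e2 : |score v f₂ z j| ≤ C * (1 + ‖z‖ ^ 2) := by
    rw [score_apply, abs_div, abs_of_pos hu₂, div_le_iff₀ hu₂]
    exact k5 j
  have e3 : |score v f₁ z j - score v f₂ z j| ≤ 2 * C * (1 + ‖z‖ ^ 2) :=
    (abs_sub _ _).trans (by linarith)
  rw [abs_mul, abs_of_pos hu₁, abs_pow, mul_comm, ← mul_pow]
  gcongr

/-- Integration by parts in one coordinate: the field
`∂ⱼm₁ (log (m₁/m₂) + 1) - (m₁/m₂) ∂ⱼm₂` has an integrable derivative, of integral zero. -/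
theorem integral_secondMarginal_eq (h₁ : IsCompactPrior f₁ R₁) (h₂ : IsCompactPrior f₂ R₂)
    {v : ℝ} (hv : 0 < v) (j : Fin p) :
    ∫ z, (secondMarginal v f₁ j z *
        (Real.log (marginal v f₁ z) - Real.log (marginal v f₂ z) + 1) -
        marginal v f₁ z / marginal v f₂ z * secondMarginal v f₂ j z) =
      -∫ z, marginal v f₁ z * (score v f₁ z j - score v f₂ z j) ^ 2 := by
  have hA := integrable_secondMarginal_mul h₁ h₂ hv j
  have hB := integrable_marginal_mul_score_sq h₁ h₂ hv j
  have hsum := integral_eq_zero_of_hasLineDerivAt (integrable_gradMarginal_mul h₁ h₂ hv j)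
    (hA.add hB) (e := EuclideanSpace.single j 1) fun z => ?_
  · rw [integral_add' hA hB] at hsum
    linarith
  · have d1 := h₁.hasLineDerivAt_marginal v z j
    have d2 := h₂.hasLineDerivAt_marginal v z j
    have dd1 := h₁.hasLineDerivAt_gradMarginal v z j
    have dd2 := h₂.hasLineDerivAt_gradMarginal v z j
    unfold HasLineDerivAt at d1 d2 dd1 dd2 ⊢
    have k1 : marginal v f₁ (z + (0 : ℝ) • EuclideanSpace.single j 1) ≠ 0 :=
      (h₁.marginal_pos hv _).ne'
    have k2 : marginal v f₂ (z + (0 : ℝ) • EuclideanSpace.single j 1) ≠ 0 :=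
      (h₂.marginal_pos hv _).ne'
    refine ((dd1.mul (((d1.log k1).sub (d2.log k2)).add_const 1)).sub
      ((d1.div d2 k2).mul dd2)).congr_deriv ?_
    have k1' := (h₁.marginal_pos hv z).ne'
    have k2' := (h₂.marginal_pos hv z).ne'
    simp only [zero_smul, add_zero, Pi.add_apply, Pi.sub_apply, score_apply, Pi.div_apply]
    field_simp
    ring

/-- De Bruijn's identity for the relative entropy of two Gaussian mixtures: its derivative in the
variance is minus one half of the relative Fisher information. -/
theorem hasDerivAt_relEntropy (h₁ : IsCompactPrior f₁ R₁) (h₂ : IsCompactPrior f₂ R₂) {v : ℝ}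
    (hv : 0 < v) : HasDerivAt (relEntropy f₁ f₂) (-(1 / 2) * relFisher f₁ f₂ v) v := by
  obtain ⟨C, c, hC, hc, H⟩ := exists_joint_bounds h₁ h₂ (half_pos hv)
    (show v / 2 ≤ 2 * v by linarith)
  have hnhds : Set.Icc (v / 2) (2 * v) ∈ nhds v := Icc_mem_nhds (by linarith) (by linarith)
  set T : (E → ℝ) → ℝ → E → ℝ := fun f v z => 1 / 2 * ∑ j, secondMarginal v f j z with hT
  have hmT : ∀ {f : E → ℝ} (_ : Measurable f) (v : ℝ), Measurable (T f v) := fun hf v => by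
    have := measurable_secondMarginal hf v
    simp only [hT]
    fun_prop
  have hTb : ∀ (f : E → ℝ) (v : ℝ) (z : E), (∀ j, |secondMarginal v f j z| ≤
      C * (1 + ‖z‖ ^ 2) * marginal v f z) →
      |T f v z| ≤ p * C * (1 + ‖z‖ ^ 2) * marginal v f z := by
    intro f v z h
    have h1 : |∑ j, secondMarginal v f j z| ≤ p * (C * (1 + ‖z‖ ^ 2) * marginal v f z) := by
      refine (Finset.abs_sum_le_sum_abs _ _).trans ((Finset.sum_le_sum fun j _ => h j).trans ?_)
      simp
    rw [hT, abs_mul, abs_of_pos (by norm_num : (0 : ℝ) < 1 / 2)]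
    have := abs_nonneg (∑ j, secondMarginal v f j z)
    linarith
  have key := hasDerivAt_integral_of_dominated_loc_of_deriv_le (μ := (volume : Measure E))
    (F := fun v z => marginal v f₁ z * (Real.log (marginal v f₁ z) - Real.log (marginal v f₂ z)))
    (F' := fun v z => T f₁ v z * (Real.log (marginal v f₁ z) - Real.log (marginal v f₂ z)) +
      marginal v f₁ z * (T f₁ v z / marginal v f₁ z - T f₂ v z / marginal v f₂ z))
    (bound := fun z => (p * C * (C + 2) * C) * ((1 + ‖z‖ ^ 2) ^ 2 * Real.exp (-c * ‖z‖ ^ 2)))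
    hnhds (Filter.Eventually.of_forall fun w => ?_) (integrable_relEntropy h₁ h₂ hv) ?_
    (Filter.Eventually.of_forall fun z w hw => ?_) (integrable_one_add_sq_mul_exp hc _)
    (Filter.Eventually.of_forall fun z w hw => ?_)
  · refine key.2.congr_deriv ?_
    have hfun : ∀ z, T f₁ v z * (Real.log (marginal v f₁ z) - Real.log (marginal v f₂ z)) +
        marginal v f₁ z * (T f₁ v z / marginal v f₁ z - T f₂ v z / marginal v f₂ z) =
        ∑ j, 1 / 2 * (secondMarginal v f₁ j z *
        (Real.log (marginal v f₁ z) - Real.log (marginal v f₂ z) + 1) -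
        marginal v f₁ z / marginal v f₂ z * secondMarginal v f₂ j z) := by
      intro z
      have k1 := (h₁.marginal_pos hv z).ne'
      have k2 := (h₂.marginal_pos hv z).ne'
      simp only [← Finset.mul_sum, Finset.sum_sub_distrib, ← Finset.sum_mul, hT]
      field_simp
      ring
    simp_rw [hfun]
    rw [integral_finsetSum _ fun j _ => (integrable_secondMarginal_mul h₁ h₂ hv j).const_mul _]
    simp_rw [integral_const_mul, integral_secondMarginal_eq h₁ h₂ hv]
    rw [relFisher, ← Finset.mul_sum, Finset.sum_neg_distrib, ← integral_finsetSum _ fun j _ =>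
      integrable_marginal_mul_score_sq h₁ h₂ hv j]
    simp_rw [EuclideanSpace.norm_sq_eq, ← Finset.mul_sum]
    simp
  · have hm₁ := measurable_marginal h₁.measurable w
    have hm₂ := measurable_marginal h₂.measurable w
    fun_prop
  · have hm₁ := measurable_marginal h₁.measurable v
    have hm₂ := measurable_marginal h₂.measurable v
    have := hmT h₁.measurable v
    have := hmT h₂.measurable v
    fun_prop
  · obtain ⟨k1, k2, -, k4, -, k6⟩ := H w hw z
    have hw0 : 0 < w := (half_pos hv).trans_le hw.1
    have hu₁ := h₁.marginal_pos hw0 z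
    have hu₂ := h₂.marginal_pos hw0 z
    have hz : 0 ≤ ‖z‖ ^ 2 := sq_nonneg _
    have t1 := hTb f₁ w z k4
    have t2 := hTb f₂ w z k6
    have e1 : |T f₁ w z / marginal w f₁ z| ≤ p * C * (1 + ‖z‖ ^ 2) := by
      rwa [abs_div, abs_of_pos hu₁, div_le_iff₀ hu₁]
    have e2 : |T f₂ w z / marginal w f₂ z| ≤ p * C * (1 + ‖z‖ ^ 2) := by
      rwa [abs_div, abs_of_pos hu₂, div_le_iff₀ hu₂]
    have e3 : T f₁ w z = marginal w f₁ z * (T f₁ w z / marginal w f₁ z) := by field_simp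
    have hp : (0 : ℝ) ≤ p := by positivity
    rw [Real.norm_eq_abs]
    set l := Real.log (marginal w f₁ z) - Real.log (marginal w f₂ z)
    have e4 : |(T f₁ w z / marginal w f₁ z) * l| ≤ (p * C * (1 + ‖z‖ ^ 2)) * (C * (1 + ‖z‖ ^ 2)) := by
      rw [abs_mul]; gcongr
    have e5 : |T f₁ w z / marginal w f₁ z - T f₂ w z / marginal w f₂ z| ≤
        2 * (p * C * (1 + ‖z‖ ^ 2)) := (abs_sub _ _).trans (by linarith)
    have e6 : p * C * (1 + ‖z‖ ^ 2) ≤ p * C * (1 + ‖z‖ ^ 2) ^ 2 := by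
      gcongr
      nlinarith
    have e7 : |(T f₁ w z / marginal w f₁ z) * l +
        (T f₁ w z / marginal w f₁ z - T f₂ w z / marginal w f₂ z)| ≤
        p * C * (C + 2) * (1 + ‖z‖ ^ 2) ^ 2 := by
      refine (abs_add_le _ _).trans ?_
      linarith
    calc |T f₁ w z * l + marginal w f₁ z * (T f₁ w z / marginal w f₁ z - T f₂ w z / marginal w f₂ z)|
        = marginal w f₁ z * |(T f₁ w z / marginal w f₁ z) * l +
        (T f₁ w z / marginal w f₁ z - T f₂ w z / marginal w f₂ z)| := by
          nth_rewrite 1 [e3]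
          rw [mul_assoc, ← mul_add, abs_mul, abs_of_pos hu₁]
      _ ≤ (C * Real.exp (-c * ‖z‖ ^ 2)) * (p * C * (C + 2) * (1 + ‖z‖ ^ 2) ^ 2) := by
          gcongr
      _ = _ := by ring
  · have hw0 : 0 < w := (half_pos hv).trans_le hw.1
    have k1 := (h₁.marginal_pos hw0 z).ne'
    have k2 := (h₂.marginal_pos hw0 z).ne'
    have d1 := h₁.hasDerivAt_marginal_variance hw0 z
    have d2 := h₂.hasDerivAt_marginal_variance hw0 z
    exact d1.mul ((d1.log k1).sub (d2.log k2))

theorem integrable_relFisher (h₁ : IsCompactPrior f₁ R₁) (h₂ : IsCompactPrior f₂ R₂) {v : ℝ}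
    (hv : 0 < v) : Integrable fun z =>
      marginal v f₁ z * ‖score v f₁ z - score v f₂ z‖ ^ 2 := by
  have h := integrable_finsetSum Finset.univ fun j _ =>
    integrable_marginal_mul_score_sq h₁ h₂ hv j
  refine h.congr (Filter.Eventually.of_forall fun z => ?_)
  simp [EuclideanSpace.norm_sq_eq, Finset.mul_sum]

end

/-! ### Kullback–Leibler loss as the integral of a nonnegative integrand -/

/-- The nonnegative integrand `a log (a / b) - a + b` of the Kullback–Leibler divergence of two
densities with values `a > 0` and `b`; it is `∞` where `b` vanishes. -/
def klIntegrand (a b : ℝ) : ℝ≥0∞ :=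
  if 0 < b then ENNReal.ofReal (a * Real.log (a / b) - a + b) else ⊤

theorem measurable_klIntegrand : Measurable fun q : ℝ × ℝ => klIntegrand q.1 q.2 := by
  unfold klIntegrand
  refine Measurable.ite (measurableSet_lt measurable_const measurable_snd) ?_ measurable_const
  fun_prop

theorem mul_log_div_nonneg {a b : ℝ} (ha : 0 < a) (hb : 0 < b) :
    0 ≤ a * Real.log (a / b) - a + b := by
  have h := Real.log_le_sub_one_of_pos (div_pos hb ha)
  rw [← inv_div b a, Real.log_inv]
  have := mul_le_mul_of_nonneg_left h ha.le
  have e : a * (b / a - 1) = b - a := by field_simp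
  rw [e] at this
  linarith

theorem eq_of_klIntegrand_eq_zero {a b : ℝ} (ha : 0 < a) (h : klIntegrand a b = 0) : b = a := by
  unfold klIntegrand at h
  split_ifs at h with hb
  · rw [ENNReal.ofReal_eq_zero] at h
    by_contra hne
    have hne' : b / a ≠ 1 := by rwa [ne_eq, div_eq_one_iff_eq ha.ne']
    have h' := Real.log_lt_sub_one_of_pos (div_pos hb ha) hne'
    rw [← inv_div b a, Real.log_inv] at h
    have := mul_lt_mul_of_pos_left h' ha
    have e : a * (b / a - 1) = b - a := by field_simp
    rw [e] at this
    linarith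
  · exact absurd h ENNReal.top_ne_zero

theorem tendsto_klIntegrand_left {ι : Type*} {l : Filter ι} {u : ι → ℝ} {a : ℝ} (b : ℝ)
    (ha : 0 < a) (hu : Filter.Tendsto u l (nhds a)) :
    Filter.Tendsto (fun i => klIntegrand (u i) b) l (nhds (klIntegrand a b)) := by
  unfold klIntegrand
  split_ifs with hb
  · refine (ENNReal.continuous_ofReal.tendsto _).comp ?_
    exact ((hu.mul ((hu.div_const b).log (div_pos ha hb).ne')).sub hu).add_const b
  · exact tendsto_const_nhds

theorem tendsto_klIntegrand_right {ι : Type*} {l : Filter ι} {u : ι → ℝ} {a b : ℝ}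
    (ha : 0 < a) (hb : 0 < b) (hu : Filter.Tendsto u l (nhds b)) :
    Filter.Tendsto (fun i => klIntegrand a (u i)) l (nhds (klIntegrand a b)) := by
  have h1 : Filter.Tendsto (fun i => ENNReal.ofReal (a * Real.log (a / u i) - a + u i)) l
      (nhds (ENNReal.ofReal (a * Real.log (a / b) - a + b))) := by
    refine (ENNReal.continuous_ofReal.tendsto _).comp ?_
    exact ((((tendsto_const_nhds.div hu hb.ne').log (div_pos ha hb).ne').const_mul a).sub_const a).add hu
  have h2 : klIntegrand a b = ENNReal.ofReal (a * Real.log (a / b) - a + b) := if_pos hb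
  rw [h2]
  refine h1.congr' ?_
  filter_upwards [hu.eventually (lt_mem_nhds hb)] with i hi
  exact (if_pos hi).symm

theorem IsDensity.integrable {g : E → ℝ} (hg : IsDensity g) : Integrable g := by
  by_contra h
  simpa [integral_undef h] using hg.2.2

theorem klLoss_eq_lintegral {vy : ℝ} (hvy : 0 < vy) (μ : E) {g : E → ℝ} (hg : IsDensity g) :
    klLoss vy μ g = ∫⁻ y, klIntegrand (normalDensity vy μ y) (g y) := by
  have hN := integrable_normalDensity hvy μ
  have hNm : Measurable fun y => normalDensity vy μ y :=
    measurable_normalDensity' measurable_const measurable_const measurable_id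
  have hgm := hg.1
  have hsub := hN.sub hg.integrable
  by_cases hpos : ∀ᵐ y, 0 < g y
  · have h1 : ∫⁻ y, klIntegrand (normalDensity vy μ y) (g y) =
        ∫⁻ y, ENNReal.ofReal (normalDensity vy μ y * Real.log (normalDensity vy μ y / g y) -
          normalDensity vy μ y + g y) :=
      lintegral_congr_ae (hpos.mono fun y hy => if_pos hy)
    have hnn : ∀ᵐ y, 0 ≤ normalDensity vy μ y * Real.log (normalDensity vy μ y / g y) -
          normalDensity vy μ y + g y :=
      hpos.mono fun y hy => mul_log_div_nonneg (normalDensity_pos hvy μ y) hy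
    rw [h1]
    by_cases hint : Integrable fun y =>
        normalDensity vy μ y * Real.log (normalDensity vy μ y / g y)
    · have hint' : Integrable fun y => normalDensity vy μ y *
          Real.log (normalDensity vy μ y / g y) - normalDensity vy μ y + g y :=
        (hint.sub hN).add hg.integrable
      have e1 := integral_add (hint.sub hN) hg.integrable
      have e2 := integral_sub hint hN
      simp only [Pi.sub_apply] at e1
      rw [klLoss, if_pos ⟨hpos, hint⟩, ← ofReal_integral_eq_lintegral_ofReal hint' hnn, e1, e2,
        integral_normalDensity hvy, hg.2.2]
      simp
    · rw [klLoss, if_neg fun h => hint h.2]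
      symm
      by_contra hfin
      have hint' : Integrable fun y => normalDensity vy μ y *
          Real.log (normalDensity vy μ y / g y) - normalDensity vy μ y + g y := by
        refine ⟨by fun_prop, ?_⟩
        rw [hasFiniteIntegral_iff_ofReal hnn]
        exact lt_top_iff_ne_top.2 hfin
      exact hint ((hint'.add hsub).congr (Filter.Eventually.of_forall fun y => by
        simp only [Pi.add_apply, Pi.sub_apply]; ring))
  · rw [klLoss, if_neg fun h => hpos h.1]
    symm
    by_contra hfin
    refine hpos ?_
    have hm : Measurable fun y => klIntegrand (normalDensity vy μ y) (g y) :=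
      measurable_klIntegrand.comp (hNm.prodMk hgm)
    refine (ae_lt_top hm hfin).mono fun y hy => ?_
    by_contra hy'
    simp [klIntegrand, hy'] at hy

theorem klRisk_eq_lintegral {vx vy : ℝ} (hvy : 0 < vy) (μ : E) {q : E → E → ℝ}
    (hq : IsProcedure q) :
    klRisk vx vy μ q = ∫⁻ x, (∫⁻ y, klIntegrand (normalDensity vy μ y) (q x y)) *
      ENNReal.ofReal (normalDensity vx μ x) := by
  simp only [klRisk, klLoss_eq_lintegral hvy μ (hq.2 _)]

/-- The risk depends on a procedure only up to null sets. -/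
theorem klRisk_congr {vx vy : ℝ} (hvy : 0 < vy) (μ : E) {q q' : E → E → ℝ}
    (hq : IsProcedure q) (hq' : IsProcedure q')
    (h : ∀ᵐ z : E × E, q z.1 z.2 = q' z.1 z.2) : klRisk vx vy μ q = klRisk vx vy μ q' := by
  rw [klRisk_eq_lintegral hvy μ hq, klRisk_eq_lintegral hvy μ hq']
  refine lintegral_congr_ae ?_
  filter_upwards [Measure.ae_ae_of_ae_prod h] with x hx
  congr 1
  refine lintegral_congr_ae ?_
  filter_upwards [hx] with y hy
  rw [hy]

/-! ### Bayes rules -/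

/-- `f` is a prior density, possibly improper, with positive and finite marginals at variance `v`. -/
structure IsPrior (v : ℝ) (f : E → ℝ) : Prop where
  measurable : Measurable f
  nonneg : ∀ μ, 0 ≤ f μ
  hasMarginal : HasMarginal v f
  marginal_pos : ∀ z, 0 < marginal v f z

theorem IsCompactPrior.isPrior {f : E → ℝ} {R : ℝ} (hf : IsCompactPrior f R) {v : ℝ} (hv : 0 < v) :
    IsPrior v f where
  measurable := hf.measurable
  nonneg := hf.nonneg
  hasMarginal _ := hf.integrable_mul (continuous_normalDensity v continuous_id continuous_const)
  marginal_pos := hf.marginal_pos hv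

/-- The numerator of the Bayes rule factors through the precision-weighted mean of `x` and `y`. -/
theorem integral_normalDensity_mul_mul {vx vy : ℝ} (hvx : 0 < vx) (hvy : 0 < vy) (f : E → ℝ)
    (x y : E) :
    ∫ μ, normalDensity vx μ x * normalDensity vy μ y * f μ =
      marginal (vx * vy / (vx + vy)) f (x + (vx / (vx + vy)) • (y - x)) *
        normalDensity (vx + vy) x y := by
  rw [marginal_eq_integral_mul, ← integral_mul_const]
  refine integral_congr_ae (Filter.Eventually.of_forall fun μ => ?_)
  simp only [normalDensity_mul_normalDensity hvx hvy]
  ring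

theorem bayesRule_eq {vx vy : ℝ} (hvx : 0 < vx) (hvy : 0 < vy) (f : E → ℝ) (x y : E) :
    bayesRule vx vy f x y =
      marginal (vx * vy / (vx + vy)) f (x + (vx / (vx + vy)) • (y - x)) *
        normalDensity (vx + vy) x y / marginal vx f x := by
  rw [bayesRule, integral_normalDensity_mul_mul hvx hvy]
  rfl

theorem normalDensity_le_const {v : ℝ} (hv : 0 < v) (μ z : E) :
    normalDensity v μ z ≤ (2 * Real.pi * v) ^ (-((p : ℝ) / 2)) := by
  unfold normalDensity
  refine mul_le_of_le_one_right (by positivity) (Real.exp_le_one_iff.2 ?_)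
  rw [neg_nonpos]
  positivity

namespace IsPrior

variable {f : EuclideanSpace ℝ (Fin p) → ℝ}

theorem integrable {v : ℝ} (hf : IsPrior v f) (z : E) :
    Integrable fun μ => normalDensity v μ z * f μ := hf.hasMarginal z

theorem of_le {v w : ℝ} (hf : IsPrior w f) (hv : 0 < v) (hvw : v ≤ w) : IsPrior v f := by
  have hw := hv.trans_le hvw
  have hint : HasMarginal v f := fun z => by
    refine ((hf.hasMarginal z).const_mul ((w / v) ^ ((p : ℝ) / 2))).mono'
      ((measurable_normalDensity' measurable_const measurable_id measurable_const).mul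
        hf.measurable).aestronglyMeasurable (Filter.Eventually.of_forall fun μ => ?_)
    rw [smul_eq_mul, smul_eq_mul,
      Real.norm_of_nonneg (mul_nonneg (normalDensity_nonneg hv _ _) (hf.nonneg μ)), ← mul_assoc]
    exact mul_le_mul_of_nonneg_right (normalDensity_le_of_le hv hvw μ z) (hf.nonneg μ)
  refine ⟨hf.measurable, hf.nonneg, hint, fun z => ?_⟩
  have h := hf.marginal_pos z
  rw [marginal_eq_integral_mul, integral_pos_iff_support_of_nonneg
    (fun μ => mul_nonneg (normalDensity_nonneg hw μ z) (hf.nonneg μ)) (hf.hasMarginal z)] at h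
  rw [marginal_eq_integral_mul, integral_pos_iff_support_of_nonneg
    (fun μ => mul_nonneg (normalDensity_nonneg hv μ z) (hf.nonneg μ)) (hint z)]
  convert! h using 2
  ext μ
  simp [(normalDensity_pos hv μ z).ne', (normalDensity_pos hw μ z).ne']

theorem integrable_joint {vx vy : ℝ} (hf : IsPrior vx f) (hvx : 0 < vx) (hvy : 0 < vy) (x y : E) :
    Integrable fun μ => normalDensity vx μ x * normalDensity vy μ y * f μ := by
  refine ((hf.hasMarginal x).const_mul ((2 * Real.pi * vy) ^ (-((p : ℝ) / 2)))).mono'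
    (((measurable_normalDensity' measurable_const measurable_id measurable_const).mul
      (measurable_normalDensity' measurable_const measurable_id measurable_const)).mul
        hf.measurable).aestronglyMeasurable (Filter.Eventually.of_forall fun μ => ?_)
  have h1 := normalDensity_nonneg hvx μ x
  have h2 := normalDensity_nonneg hvy μ y
  have h3 := hf.nonneg μ
  rw [Real.norm_of_nonneg (by positivity), smul_eq_mul]
  calc normalDensity vx μ x * normalDensity vy μ y * f μ =
      normalDensity vy μ y * (normalDensity vx μ x * f μ) := by ring
    _ ≤ _ := by
      gcongr
      exact normalDensity_le_const hvy μ y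

theorem bayesRule_pos {vx vy : ℝ} (hf : IsPrior vx f) (hvx : 0 < vx) (hvy : 0 < vy) (x y : E) :
    0 < bayesRule vx vy f x y := by
  have hw : vx * vy / (vx + vy) ≤ vx := by
    rw [div_le_iff₀ (by positivity)]
    nlinarith
  rw [bayesRule_eq hvx hvy]
  have h1 := (hf.of_le (by positivity) hw).marginal_pos (x + (vx / (vx + vy)) • (y - x))
  have h2 := hf.marginal_pos x
  have h3 := normalDensity_pos (add_pos hvx hvy) x y
  positivity

theorem measurable_bayesRule {vx vy : ℝ} (hf : IsPrior vx f) (hvx : 0 < vx) (hvy : 0 < vy) :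
    Measurable fun z : E × E => bayesRule vx vy f z.1 z.2 := by
  simp only [bayesRule_eq hvx hvy]
  refine Measurable.div (Measurable.mul ?_ ?_) ?_
  · exact (measurable_marginal hf.measurable _).comp (by fun_prop)
  · exact measurable_normalDensity' measurable_const measurable_fst measurable_snd
  · exact (measurable_marginal hf.measurable _).comp measurable_fst

theorem isDensity_bayesRule {vx vy : ℝ} (hf : IsPrior vx f) (hvx : 0 < vx) (hvy : 0 < vy)
    (x : E) :
    IsDensity (bayesRule vx vy f x) := by
  refine ⟨?_, fun y => (hf.bayesRule_pos hvx hvy x y).le, ?_⟩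
  · have h := (hf.measurable_bayesRule hvx hvy).comp (measurable_prodMk_left (x := x))
    exact h
  have hnn : ∀ y μ : E, 0 ≤ normalDensity vx μ x * normalDensity vy μ y * f μ := fun y μ =>
    mul_nonneg (mul_nonneg (normalDensity_nonneg hvx _ _) (normalDensity_nonneg hvy _ _))
      (hf.nonneg μ)
  have hmeas : Measurable fun a : E × E =>
      normalDensity vx a.2 x * normalDensity vy a.2 a.1 * f a.2 :=
    ((measurable_normalDensity' measurable_const measurable_snd measurable_const).mul
      (measurable_normalDensity' measurable_const measurable_snd measurable_fst)).mul
        (hf.measurable.comp measurable_snd)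
  have h1 : ∫⁻ y, ENNReal.ofReal (∫ μ, normalDensity vx μ x * normalDensity vy μ y * f μ) =
      ENNReal.ofReal (marginal vx f x) := by
    calc ∫⁻ y, ENNReal.ofReal (∫ μ, normalDensity vx μ x * normalDensity vy μ y * f μ)
        = ∫⁻ y, ∫⁻ μ, ENNReal.ofReal (normalDensity vx μ x * normalDensity vy μ y * f μ) := by
          refine lintegral_congr fun y => ?_
          exact ofReal_integral_eq_lintegral_ofReal (hf.integrable_joint hvx hvy x y)
            (Filter.Eventually.of_forall (hnn y))
      _ = ∫⁻ μ, ∫⁻ y, ENNReal.ofReal (normalDensity vx μ x * normalDensity vy μ y * f μ) :=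
          lintegral_lintegral_swap (f := fun y μ =>
            ENNReal.ofReal (normalDensity vx μ x * normalDensity vy μ y * f μ))
            hmeas.ennreal_ofReal.aemeasurable
      _ = ∫⁻ μ, ENNReal.ofReal (normalDensity vx μ x * f μ) := by
          refine lintegral_congr fun μ => ?_
          have : ∀ y, ENNReal.ofReal (normalDensity vx μ x * normalDensity vy μ y * f μ) =
              ENNReal.ofReal (normalDensity vx μ x * f μ) *
                ENNReal.ofReal (normalDensity vy μ y) := fun y => by
            rw [← ENNReal.ofReal_mul (mul_nonneg (normalDensity_nonneg hvx _ _) (hf.nonneg μ))]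
            congr 1
            ring
          simp_rw [this]
          rw [lintegral_const_mul _ (measurable_normalDensity_right vy μ).ennreal_ofReal, lintegral_normalDensity hvy, mul_one]
      _ = ENNReal.ofReal (marginal vx f x) :=
          (ofReal_integral_eq_lintegral_ofReal (hf.hasMarginal x) (Filter.Eventually.of_forall
            fun μ => mul_nonneg (normalDensity_nonneg hvx _ _) (hf.nonneg μ))).symm
  have hm := hf.marginal_pos x
  have hjm : Measurable fun y => ∫ μ, normalDensity vx μ x * normalDensity vy μ y * f μ :=
    measurable_integral_of_measurable_uncurry hmeas
  have h2 : ∫ y, ∫ μ, normalDensity vx μ x * normalDensity vy μ y * f μ = marginal vx f x := by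
    rw [integral_eq_lintegral_of_nonneg_ae (Filter.Eventually.of_forall fun y =>
      integral_nonneg (hnn y)) hjm.aestronglyMeasurable, h1, ENNReal.toReal_ofReal hm.le]
  have h3 : (fun y => bayesRule vx vy f x y) = fun y =>
    (∫ μ, normalDensity vx μ x * normalDensity vy μ y * f μ) / marginal vx f x := rfl
  rw [h3, integral_div, h2, div_self hm.ne']

theorem isProcedure_bayesRule {vx vy : ℝ} (hf : IsPrior vx f) (hvx : 0 < vx) (hvy : 0 < vy) :
    IsProcedure (bayesRule vx vy f) :=
  ⟨hf.measurable_bayesRule hvx hvy, hf.isDensity_bayesRule hvx hvy⟩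

end IsPrior

/-! ### The Bayes risk decomposition -/

/-- The Bayes risk `∫ R(μ, q) f(μ) dμ`. -/
def bayesRisk (vx vy : ℝ) (f : E → ℝ) (q : E → E → ℝ) : ℝ≥0∞ :=
  ∫⁻ μ, klRisk vx vy μ q * ENNReal.ofReal (f μ)

/-- The average under the marginal of `X` of the divergence from the Bayes rule of `f` to `q`; it is
the excess of the Bayes risk of `q` over the minimal one. -/
def bayesExcess (vx vy : ℝ) (f : E → ℝ) (q : E → E → ℝ) : ℝ≥0∞ :=
  ∫⁻ z : E × E, ENNReal.ofReal (marginal vx f z.1) *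
    klIntegrand (bayesRule vx vy f z.1 z.2) (q z.1 z.2)

section

variable {f : EuclideanSpace ℝ (Fin p) → ℝ} {R vx vy : ℝ}

theorem bayesRisk_eq_lintegral (hf : Measurable f) (hvx : 0 < vx) (hvy : 0 < vy) {q : E → E → ℝ}
    (hq : IsProcedure q) :
    bayesRisk vx vy f q = ∫⁻ z : E × E, ∫⁻ μ, klIntegrand (normalDensity vy μ z.2) (q z.1 z.2) *
      ENNReal.ofReal (normalDensity vx μ z.1 * f μ) := by
  have hk : Measurable fun a : E × (E × E) =>
      klIntegrand (normalDensity vy a.1 a.2.2) (q a.2.1 a.2.2) :=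
    measurable_klIntegrand.comp ((measurable_normalDensity' measurable_const (by fun_prop)
      (by fun_prop)).prodMk (hq.1.comp measurable_snd))
  have hm : Measurable fun a : E × (E × E) =>
      klIntegrand (normalDensity vy a.1 a.2.2) (q a.2.1 a.2.2) *
      ENNReal.ofReal (normalDensity vx a.1 a.2.1 * f a.1) :=
    hk.mul ((measurable_normalDensity' measurable_const (by fun_prop) (by fun_prop)).mul
      (by fun_prop)).ennreal_ofReal
  rw [← lintegral_lintegral_swap (f := fun μ (z : E × E) =>
    klIntegrand (normalDensity vy μ z.2) (q z.1 z.2) *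
      ENNReal.ofReal (normalDensity vx μ z.1 * f μ)) hm.aemeasurable]
  refine lintegral_congr fun μ => ?_
  have hswap := lintegral_prod (μ := (volume : Measure E)) (ν := (volume : Measure E))
    (fun z : E × E => klIntegrand (normalDensity vy μ z.2) (q z.1 z.2) *
      ENNReal.ofReal (normalDensity vx μ z.1 * f μ))
    (hm.comp (measurable_prodMk_left (x := μ))).aemeasurable
  rw [Measure.volume_eq_prod, hswap,
    klRisk_eq_lintegral hvy μ hq, ← lintegral_mul_const]
  · refine lintegral_congr fun x => ?_
    rw [mul_assoc, ← ENNReal.ofReal_mul (normalDensity_nonneg hvx μ x)]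
    refine (lintegral_mul_const _ ?_).symm
    exact hk.comp (f := fun y => (μ, (x, y))) (by fun_prop)
  · refine Measurable.mul ?_ (measurable_normalDensity' measurable_const measurable_const
      measurable_id).ennreal_ofReal
    exact Measurable.lintegral_prod_right (f := fun x y =>
      klIntegrand (normalDensity vy μ y) (q x y)) (hk.comp (f := fun z => (μ, z)) (by fun_prop))

/-- The compensation identity behind the Bayes risk decomposition, at a fixed pair `(x, y)`. -/
theorem lintegral_klIntegrand_eq (hf : IsCompactPrior f R) (hvx : 0 < vx) (hvy : 0 < vy) (x y : E)
    {b : ℝ} (hb : 0 ≤ b) :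
    ∫⁻ μ, klIntegrand (normalDensity vy μ y) b * ENNReal.ofReal (normalDensity vx μ x * f μ) =
      (∫⁻ μ, klIntegrand (normalDensity vy μ y) (bayesRule vx vy f x y) *
        ENNReal.ofReal (normalDensity vx μ x * f μ)) +
      ENNReal.ofReal (marginal vx f x) * klIntegrand (bayesRule vx vy f x y) b := by
  have hprior := hf.isPrior hvx
  have hm := hf.marginal_pos hvx x
  have hB := hprior.bayesRule_pos hvx hvy x y
  have hbase : Measurable fun μ => ENNReal.ofReal (normalDensity vx μ x * f μ) :=
    ((measurable_normalDensity' measurable_const measurable_id measurable_const).mul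
      hf.measurable).ennreal_ofReal
  have hnn : ∀ μ, 0 ≤ normalDensity vx μ x * f μ := fun μ =>
    mul_nonneg (normalDensity_nonneg hvx _ _) (hf.nonneg μ)
  rcases hb.eq_or_lt with rfl | hb
  · have h0 : ∀ a, klIntegrand a 0 = ⊤ := fun a => by simp [klIntegrand]
    simp only [h0]
    rw [lintegral_const_mul _ hbase, ← ofReal_integral_eq_lintegral_ofReal (hprior.integrable x)
      (Filter.Eventually.of_forall hnn)]
    have : ENNReal.ofReal (marginal vx f x) ≠ 0 := by simpa using hm
    have e : ENNReal.ofReal (∫ μ, normalDensity vx μ x * f μ) ≠ 0 := this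
    rw [ENNReal.mul_top this, add_top]
    exact ENNReal.top_mul e
  have hN : Continuous fun μ : E => normalDensity vy μ y :=
    continuous_normalDensity vy continuous_id continuous_const
  have hNx : Continuous fun μ : E => normalDensity vx μ x :=
    continuous_normalDensity vx continuous_id continuous_const
  have hne : ∀ μ : E, normalDensity vy μ y ≠ 0 := fun μ => (normalDensity_pos hvy μ y).ne'
  have key : ∀ c : ℝ, 0 < c →
      (Integrable fun μ => ((normalDensity vy μ y * Real.log (normalDensity vy μ y / c) -
        normalDensity vy μ y + c) * normalDensity vx μ x) * f μ) ∧
      ∫⁻ μ, klIntegrand (normalDensity vy μ y) c * ENNReal.ofReal (normalDensity vx μ x * f μ) =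
        ENNReal.ofReal (∫ μ, ((normalDensity vy μ y * Real.log (normalDensity vy μ y / c) -
          normalDensity vy μ y + c) * normalDensity vx μ x) * f μ) := by
    intro c hc
    have hcont : Continuous fun μ : E => (normalDensity vy μ y *
        Real.log (normalDensity vy μ y / c) - normalDensity vy μ y + c) * normalDensity vx μ x :=
      (((hN.mul ((hN.div_const c).log fun μ => div_ne_zero (hne μ) hc.ne')).sub hN).add
        continuous_const).mul hNx
    refine ⟨hf.integrable_mul hcont, ?_⟩
    rw [ofReal_integral_eq_lintegral_ofReal (hf.integrable_mul hcont)]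
    · refine lintegral_congr fun μ => ?_
      rw [klIntegrand, if_pos hc, ← ENNReal.ofReal_mul (mul_log_div_nonneg
        (normalDensity_pos hvy μ y) hc), mul_assoc]
    · refine Filter.Eventually.of_forall fun μ => ?_
      exact mul_nonneg (mul_nonneg (mul_log_div_nonneg (normalDensity_pos hvy μ y) hc)
        (normalDensity_nonneg hvx _ _)) (hf.nonneg μ)
  set B := bayesRule vx vy f x y with hBdef
  rw [(key b hb).2, (key B hB).2, klIntegrand, if_pos hb, ← ENNReal.ofReal_mul hm.le,
    ← ENNReal.ofReal_add]
  · congr 1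
    have hJ := hprior.integrable_joint hvx hvy x y
    have hM := hprior.integrable x
    have hJeq : ∫ μ, normalDensity vx μ x * normalDensity vy μ y * f μ = marginal vx f x * B := by
      rw [hBdef, bayesRule, ← mul_div_assoc]
      exact (mul_div_cancel_left₀ _ hm.ne').symm
    have e : ∀ μ, ((normalDensity vy μ y * Real.log (normalDensity vy μ y / b) -
        normalDensity vy μ y + b) * normalDensity vx μ x) * f μ =
        ((normalDensity vy μ y * Real.log (normalDensity vy μ y / B) -
        normalDensity vy μ y + B) * normalDensity vx μ x) * f μ +
        (Real.log (B / b) * (normalDensity vx μ x * normalDensity vy μ y * f μ) +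
          (b - B) * (normalDensity vx μ x * f μ)) := fun μ => by
      rw [Real.log_div (hne μ) hb.ne', Real.log_div (hne μ) hB.ne', Real.log_div hB.ne' hb.ne']
      ring
    simp_rw [e]
    have e1 := integral_add (key B hB).1 ((hJ.const_mul (Real.log (B / b))).add
      (hM.const_mul (b - B)))
    have e2 := integral_add (hJ.const_mul (Real.log (B / b))) (hM.const_mul (b - B))
    simp only [Pi.add_apply] at e1
    rw [e1, e2, integral_const_mul, integral_const_mul, hJeq, ← marginal_eq_integral_mul]
    ring
  · exact integral_nonneg fun μ => mul_nonneg (mul_nonneg (mul_log_div_nonneg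
      (normalDensity_pos hvy μ y) hB) (normalDensity_nonneg hvx _ _)) (hf.nonneg μ)
  · exact mul_nonneg hm.le (mul_log_div_nonneg hB hb)

theorem bayesRisk_eq_add_bayesExcess (hf : IsCompactPrior f R) (hvx : 0 < vx) (hvy : 0 < vy)
    {q : E → E → ℝ} (hq : IsProcedure q) :
    bayesRisk vx vy f q = bayesRisk vx vy f (bayesRule vx vy f) + bayesExcess vx vy f q := by
  have hprior := hf.isPrior hvx
  have hB := hprior.measurable_bayesRule hvx hvy
  rw [bayesRisk_eq_lintegral hf.measurable hvx hvy hq, bayesRisk_eq_lintegral hf.measurable hvx hvy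
    (hprior.isProcedure_bayesRule hvx hvy), bayesExcess, ← lintegral_add_right]
  · exact lintegral_congr fun z =>
      lintegral_klIntegrand_eq hf hvx hvy z.1 z.2 ((hq.2 z.1).2.1 z.2)
  · exact ((measurable_marginal hf.measurable vx).comp measurable_fst).ennreal_ofReal.mul
      (measurable_klIntegrand.comp (hB.prodMk hq.1))

/-- A compactly supported prior has finite minimal Bayes risk: even the constant procedure
`N(0, v_y I)` has finite Bayes risk. -/
theorem bayesRisk_bayesRule_lt_top (hf : IsCompactPrior f R) (hvx : 0 < vx) (hvy : 0 < vy) :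
    bayesRisk vx vy f (bayesRule vx vy f) < ⊤ := by
  have hNm : ∀ μ : E, Measurable fun y => normalDensity vy μ y := fun μ =>
    measurable_normalDensity' measurable_const measurable_const measurable_id
  have hq : IsProcedure fun (_ y : E) => normalDensity vy 0 y :=
    ⟨(hNm 0).comp measurable_snd, fun x => ⟨hNm 0, fun y => normalDensity_nonneg hvy _ _,
      integral_normalDensity hvy 0⟩⟩
  have hle : bayesRisk vx vy f (bayesRule vx vy f) ≤
      bayesRisk vx vy f fun _ y => normalDensity vy 0 y := by
    rw [bayesRisk_eq_add_bayesExcess hf hvx hvy hq]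
    exact le_self_add
  refine hle.trans_lt ?_
  have hrisk : ∀ μ : E, klRisk vx vy μ (fun _ y => normalDensity vy 0 y) ≤
      ENNReal.ofReal (Real.exp (‖μ‖ ^ 2 / vy)) + 1 := by
    intro μ
    have hNx : Measurable fun y => normalDensity vx μ y :=
      measurable_normalDensity' measurable_const measurable_const measurable_id
    rw [klRisk_eq_lintegral hvy μ hq, lintegral_const_mul _ hNx.ennreal_ofReal,
      lintegral_normalDensity hvx, mul_one]
    calc ∫⁻ y, klIntegrand (normalDensity vy μ y) (normalDensity vy 0 y)
        ≤ ∫⁻ y, (ENNReal.ofReal (Real.exp (‖μ‖ ^ 2 / vy)) *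
            ENNReal.ofReal (normalDensity vy ((2 : ℝ) • μ) y) +
              ENNReal.ofReal (normalDensity vy 0 y)) := by
          refine lintegral_mono fun y => ?_
          have ha := normalDensity_pos hvy μ y
          have hb := normalDensity_pos hvy 0 y
          rw [klIntegrand, if_pos hb, ← ENNReal.ofReal_mul (by positivity), ← ENNReal.ofReal_add
            (mul_nonneg (by positivity) (normalDensity_nonneg hvy _ _)) hb.le]
          refine ENNReal.ofReal_le_ofReal ?_
          -- `log t ≤ t` and `p(y|μ)² / p(y|0) = exp (‖μ‖² / v) p(y|2μ)`
          have hlog := mul_le_mul_of_nonneg_left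
            (Real.log_le_sub_one_of_pos (div_pos ha hb)) ha.le
          have hid : normalDensity vy μ y * (normalDensity vy μ y / normalDensity vy 0 y) =
              Real.exp (‖μ‖ ^ 2 / vy) * normalDensity vy ((2 : ℝ) • μ) y := by
            rw [mul_div_assoc', div_eq_iff hb.ne']
            unfold normalDensity
            have : ∀ c a b d e : ℝ, Real.exp a * Real.exp b = Real.exp d * Real.exp e * Real.exp 0 →
                c * Real.exp a * (c * Real.exp b) =
                Real.exp d * (c * Real.exp e) * (c * Real.exp 0) := by
              intro c a b d e h
              linear_combination c ^ 2 * h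
            have hexp : Real.exp (-(‖y - μ‖ ^ 2 / (2 * vy))) * Real.exp (-(‖y - μ‖ ^ 2 / (2 * vy))) =
                Real.exp (‖μ‖ ^ 2 / vy) * Real.exp (-(‖y - (2 : ℝ) • μ‖ ^ 2 / (2 * vy))) *
                  Real.exp (-(‖y - 0‖ ^ 2 / (2 * vy))) := by
              rw [← Real.exp_add, ← Real.exp_add, ← Real.exp_add]
              congr 1
              rw [norm_sub_sq_real, norm_sub_sq_real, norm_smul, inner_smul_right, sub_zero]
              norm_num
              field_simp
              ring
            linear_combination ((2 * Real.pi * vy) ^ (-((p : ℝ) / 2))) ^ 2 * hexp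
          rw [mul_sub, mul_one, hid] at hlog
          linarith
      _ = _ := by
          rw [lintegral_add_right _ (hNm 0).ennreal_ofReal, lintegral_const_mul _
            (hNm _).ennreal_ofReal, lintegral_normalDensity hvy, lintegral_normalDensity hvy,
            mul_one]
  have hR := hf.radius_nonneg
  calc bayesRisk vx vy f (fun _ y => normalDensity vy 0 y)
      ≤ ∫⁻ μ, (ENNReal.ofReal (Real.exp (R ^ 2 / vy)) + 1) * ENNReal.ofReal (f μ) := by
        refine lintegral_mono fun μ => ?_
        by_cases hμ : ‖μ‖ ≤ R
        · refine mul_le_mul_left ((hrisk μ).trans ?_) _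
          gcongr
        · simp [hf.eq_zero μ (not_le.1 hμ)]
    _ < ⊤ := by
        rw [lintegral_const_mul _ hf.measurable.ennreal_ofReal,
          ← ofReal_integral_eq_lintegral_ofReal hf.integrable
            (Filter.Eventually.of_forall hf.nonneg)]
        exact ENNReal.mul_lt_top (by simp) ENNReal.ofReal_lt_top

end

/-! ### The excess Bayes risk as a difference of relative entropies -/

theorem integrable_mul_procedure {q : E → E → ℝ} (hq : IsProcedure q) {g : E → ℝ}
    (hg : Integrable g) : (Integrable fun z : E × E => g z.1 * q z.1 z.2) ∧
      ∫ z : E × E, g z.1 * q z.1 z.2 = ∫ x, g x := by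
  have hm : AEStronglyMeasurable (fun z : E × E => g z.1 * q z.1 z.2)
      ((volume : Measure E).prod volume) :=
    hg.aestronglyMeasurable.comp_fst.mul hq.1.aestronglyMeasurable
  have hint : Integrable (fun z : E × E => g z.1 * q z.1 z.2) ((volume : Measure E).prod volume) := by
    refine (integrable_prod_iff hm).2 ⟨Filter.Eventually.of_forall fun x =>
      (hq.2 x).integrable.const_mul (g x), ?_⟩
    refine hg.norm.congr (Filter.Eventually.of_forall fun x => ?_)
    have : ∀ y, ‖g x * q x y‖ = ‖g x‖ * q x y := fun y => by
      rw [norm_mul, Real.norm_of_nonneg ((hq.2 x).2.1 y)]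
    simp_rw [this]
    rw [integral_const_mul, (hq.2 x).2.2, mul_one]
  refine ⟨hint, ?_⟩
  rw [Measure.volume_eq_prod, integral_prod _ hint]
  refine integral_congr_ae (Filter.Eventually.of_forall fun x => ?_)
  simp only
  rw [integral_const_mul, (hq.2 x).2.2, mul_one]

/-- The shear `(x, y) ↦ (x + α (y - x), y - x)` preserves Lebesgue measure. -/
theorem measurePreserving_shear (α : ℝ) :
    MeasurePreserving (fun z : E × E => (z.1 + α • (z.2 - z.1), z.2 - z.1))
      ((volume : Measure E).prod volume) ((volume : Measure E).prod volume) := by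
  have h1 : MeasurePreserving (fun z : E × E => (z.1, -z.1 + z.2))
      ((volume : Measure E).prod volume) ((volume : Measure E).prod volume) :=
    measurePreserving_prod_neg_add volume volume
  have h2 : MeasurePreserving (fun z : E × E => (z.1, z.2 + α • z.1))
      ((volume : Measure E).prod volume) ((volume : Measure E).prod volume) := by
    refine (MeasurePreserving.id volume).skew_product (g := fun t x => x + α • t) (by fun_prop)
      (Filter.Eventually.of_forall fun t => ?_)
    exact map_add_right_eq_self volume (α • t)
  have h3 := (Measure.measurePreserving_swap.comp (h2.comp (Measure.measurePreserving_swap.comp h1)))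
  convert! h3 using 1
  ext1 z
  simp [sub_eq_neg_add]

theorem integrable_comp_shear {v : ℝ} (hv : 0 < v) (α : ℝ) {g : E → ℝ} (hg : Integrable g) :
    (Integrable fun z : E × E => g (z.1 + α • (z.2 - z.1)) * normalDensity v z.1 z.2) ∧
      ∫ z : E × E, g (z.1 + α • (z.2 - z.1)) * normalDensity v z.1 z.2 = ∫ x, g x := by
  have hN := integrable_normalDensity hv (0 : E)
  have hprod := hg.mul_prod hN
  have hmp := measurePreserving_shear (p := p) α
  have he : (fun z : E × E => g (z.1 + α • (z.2 - z.1)) * normalDensity v z.1 z.2) =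
      (fun z : E × E => g z.1 * normalDensity v 0 z.2) ∘
        fun z : E × E => (z.1 + α • (z.2 - z.1), z.2 - z.1) := by
    funext z
    simp [normalDensity]
  have hemb : MeasurableEmbedding fun z : E × E => (z.1 + α • (z.2 - z.1), z.2 - z.1) := by
    refine MeasurableEmbedding.of_measurable_inverse (g := fun z : E × E =>
      (z.1 - α • z.2, z.2 + (z.1 - α • z.2))) (by fun_prop) ?_ (by fun_prop) fun z => by simp
    rw [Set.range_eq_univ.2]
    · exact MeasurableSet.univ
    · intro z
      exact ⟨(z.1 - α • z.2, z.2 + (z.1 - α • z.2)), by simp⟩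
  rw [Measure.volume_eq_prod, he]
  refine ⟨(hmp.integrable_comp_emb hemb).2 hprod, ?_⟩
  refine (hmp.integral_comp hemb fun z : E × E => g z.1 * normalDensity v 0 z.2).trans ?_
  rw [integral_prod_mul g (normalDensity v 0), integral_normalDensity hv,
    mul_one]

section

variable {f₁ f₂ : EuclideanSpace ℝ (Fin p) → ℝ} {R₁ R₂ vx vy : ℝ}

theorem IsCompactPrior.integrable_marginal (h₁ : IsCompactPrior f₁ R₁) {v : ℝ} (hv : 0 < v) :
    Integrable (marginal v f₁) := by
  obtain ⟨C, c, hC, hc, H⟩ := h₁.exists_bounds hv le_rfl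
  refine ((integrable_exp_neg_mul_sq_norm (p := p) hc).const_mul C).mono'
    (measurable_marginal h₁.measurable v).aestronglyMeasurable
    (Filter.Eventually.of_forall fun z => ?_)
  rw [Real.norm_of_nonneg (h₁.marginal_pos hv z).le]
  exact (H v ⟨le_rfl, le_rfl⟩ z).1

/-- The excess Bayes risk, under the prior `f₁`, of the Bayes rule of `f₂` is the loss of relative
entropy of the two marginals between the variances `v_x v_y / (v_x + v_y)` and `v_x`: the chain rule
for relative entropy, `x` being a noisy version of the sufficient statistic of `(x, y)`. -/
theorem bayesExcess_bayesRule (h₁ : IsCompactPrior f₁ R₁) (h₂ : IsCompactPrior f₂ R₂)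
    (hvx : 0 < vx) (hvy : 0 < vy) :
    bayesExcess vx vy f₁ (bayesRule vx vy f₂) =
      ENNReal.ofReal (relEntropy f₁ f₂ (vx * vy / (vx + vy)) - relEntropy f₁ f₂ vx) := by
  have hvw : 0 < vx * vy / (vx + vy) := by positivity
  have hp₁ := h₁.isPrior hvx
  have hp₂ := h₂.isPrior hvx
  have hT1 := integrable_comp_shear (add_pos hvx hvy) (vx / (vx + vy))
    (integrable_relEntropy h₁ h₂ hvw)
  have hT2 := integrable_mul_procedure (hp₁.isProcedure_bayesRule hvx hvy)
    (integrable_relEntropy h₁ h₂ hvx)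
  have hT3 := integrable_mul_procedure (hp₁.isProcedure_bayesRule hvx hvy)
    (h₁.integrable_marginal hvx)
  have hT4 := integrable_mul_procedure (hp₂.isProcedure_bayesRule hvx hvy)
    (h₁.integrable_marginal hvx)
  have hpt : ∀ z : E × E, marginal vx f₁ z.1 * (bayesRule vx vy f₁ z.1 z.2 *
      Real.log (bayesRule vx vy f₁ z.1 z.2 / bayesRule vx vy f₂ z.1 z.2) -
        bayesRule vx vy f₁ z.1 z.2 + bayesRule vx vy f₂ z.1 z.2) =
      ((fun w => marginal (vx * vy / (vx + vy)) f₁ w *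
        (Real.log (marginal (vx * vy / (vx + vy)) f₁ w) -
          Real.log (marginal (vx * vy / (vx + vy)) f₂ w))) (z.1 + (vx / (vx + vy)) • (z.2 - z.1)) *
            normalDensity (vx + vy) z.1 z.2 -
      (fun x => marginal vx f₁ x * (Real.log (marginal vx f₁ x) - Real.log (marginal vx f₂ x))) z.1 *
        bayesRule vx vy f₁ z.1 z.2) -
      (marginal vx f₁ z.1 * bayesRule vx vy f₁ z.1 z.2 -
        marginal vx f₁ z.1 * bayesRule vx vy f₂ z.1 z.2) := by
    intro z
    have n := (normalDensity_pos (add_pos hvx hvy) z.1 z.2)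
    have m₁ := (h₁.marginal_pos hvx z.1)
    have m₂ := (h₂.marginal_pos hvx z.1)
    have u₁ := (h₁.marginal_pos hvw (z.1 + (vx / (vx + vy)) • (z.2 - z.1)))
    have u₂ := (h₂.marginal_pos hvw (z.1 + (vx / (vx + vy)) • (z.2 - z.1)))
    simp only [bayesRule_eq hvx hvy]
    rw [Real.log_div (by positivity) (by positivity), Real.log_div (by positivity) m₁.ne',
      Real.log_div (by positivity) m₂.ne', Real.log_mul u₁.ne' n.ne', Real.log_mul u₂.ne' n.ne']
    field_simp
    ring
  have hpos : ∀ z : E × E, 0 ≤ marginal vx f₁ z.1 * (bayesRule vx vy f₁ z.1 z.2 *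
      Real.log (bayesRule vx vy f₁ z.1 z.2 / bayesRule vx vy f₂ z.1 z.2) -
        bayesRule vx vy f₁ z.1 z.2 + bayesRule vx vy f₂ z.1 z.2) := fun z =>
    mul_nonneg (h₁.marginal_pos hvx z.1).le (mul_log_div_nonneg (hp₁.bayesRule_pos hvx hvy _ _)
      (hp₂.bayesRule_pos hvx hvy _ _))
  have hstep : bayesExcess vx vy f₁ (bayesRule vx vy f₂) = ∫⁻ z : E × E, ENNReal.ofReal
      (marginal vx f₁ z.1 * (bayesRule vx vy f₁ z.1 z.2 *
      Real.log (bayesRule vx vy f₁ z.1 z.2 / bayesRule vx vy f₂ z.1 z.2) -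
        bayesRule vx vy f₁ z.1 z.2 + bayesRule vx vy f₂ z.1 z.2)) := by
    refine lintegral_congr fun z => ?_
    rw [klIntegrand, if_pos (hp₂.bayesRule_pos hvx hvy _ _),
      ← ENNReal.ofReal_mul (h₁.marginal_pos hvx z.1).le]
  have hI := (hT1.1.sub hT2.1).sub (hT3.1.sub hT4.1)
  rw [hstep, ← ofReal_integral_eq_lintegral_ofReal (hI.congr (Filter.Eventually.of_forall fun z =>
    (hpt z).symm)) (Filter.Eventually.of_forall hpos), integral_congr_ae
      (Filter.Eventually.of_forall hpt)]
  have e1 := integral_sub (hT1.1.sub hT2.1) (hT3.1.sub hT4.1)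
  have e2 := integral_sub hT1.1 hT2.1
  have e3 := integral_sub hT3.1 hT4.1
  simp only [Pi.sub_apply] at e1
  rw [e1, e2, e3, hT1.2, hT2.2, hT3.2, hT4.2, sub_self, sub_zero]
  rfl

end

/-! ### Blyth's method -/

theorem IsPrior.tendsto_marginal {f : E → ℝ} {v : ℝ} (hf : IsPrior v f) (hv : 0 < v)
    {g : ℕ → E → ℝ} (hgm : ∀ n, Measurable (g n)) (hg0 : ∀ n μ, 0 ≤ g n μ)
    (hgf : ∀ n μ, g n μ ≤ f μ) (hlim : ∀ μ, Filter.Tendsto (fun n => g n μ) Filter.atTop (nhds (f μ)))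
    (z : E) : Filter.Tendsto (fun n => marginal v (g n) z) Filter.atTop (nhds (marginal v f z)) := by
  simp only [marginal_eq_integral_mul]
  refine tendsto_integral_of_dominated_convergence _
    (fun n => ((measurable_normalDensity_left v z).mul (hgm n)).aestronglyMeasurable)
    (hf.integrable z) (fun n => Filter.Eventually.of_forall fun μ => ?_)
    (Filter.Eventually.of_forall fun μ => (hlim μ).const_mul _)
  rw [Real.norm_of_nonneg (mul_nonneg (normalDensity_nonneg hv _ _) (hg0 n μ))]
  exact mul_le_mul_of_nonneg_left (hgf n μ) (normalDensity_nonneg hv _ _)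

theorem IsPrior.measurable_excess {f : E → ℝ} {vx vy : ℝ} (hf : IsPrior vx f) (hvx : 0 < vx)
    (hvy : 0 < vy) {q : E → E → ℝ} (hq : IsProcedure q) : Measurable fun z : E × E =>
      ENNReal.ofReal (marginal vx f z.1) * klIntegrand (bayesRule vx vy f z.1 z.2) (q z.1 z.2) :=
  ((measurable_marginal hf.measurable vx).comp measurable_fst).ennreal_ofReal.mul
    (measurable_klIntegrand.comp ((hf.measurable_bayesRule hvx hvy).prodMk hq.1))

/-- A procedure that dominates the formal Bayes rule of `f` is almost everywhere equal to it, as soon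
as the formal Bayes rule is asymptotically optimal along compactly supported priors tending to `f`
from below. The bound is required only between the Bayes rules of these priors; Fatou's lemma passes
to `f`. -/
theorem isAdmissible_of_bayesExcess_le {f : E → ℝ} {vx vy : ℝ} (hvx : 0 < vx) (hvy : 0 < vy)
    (hf : IsPrior vx f) {g : ℕ → E → ℝ} {R : ℕ → ℝ} (hg : ∀ n, IsCompactPrior (g n) (R n))
    (hgf : ∀ n μ, g n μ ≤ f μ) (hlim : ∀ μ, Filter.Tendsto (fun n => g n μ) Filter.atTop (nhds (f μ)))
    {ε : ℕ → ℝ≥0∞} (hε : Filter.Tendsto ε Filter.atTop (nhds 0))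
    (hbound : ∀ n m, n ≤ m → bayesExcess vx vy (g n) (bayesRule vx vy (g m)) ≤ ε n + ε m) :
    IsAdmissible vx vy (bayesRule vx vy f) := by
  have hvw : 0 < vx * vy / (vx + vy) := by positivity
  have hw : vx * vy / (vx + vy) ≤ vx := by
    rw [div_le_iff₀ (by positivity)]
    nlinarith
  have hgp := fun n => (hg n).isPrior hvx
  have hproc := hf.isProcedure_bayesRule hvx hvy
  have hm : ∀ z, Filter.Tendsto (fun n => marginal vx (g n) z) Filter.atTop
      (nhds (marginal vx f z)) :=
    hf.tendsto_marginal hvx (fun n => (hg n).measurable) (fun n => (hg n).nonneg) hgf hlim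
  have hB : ∀ x y, Filter.Tendsto (fun n => bayesRule vx vy (g n) x y) Filter.atTop
      (nhds (bayesRule vx vy f x y)) := fun x y => by
    simp only [bayesRule_eq hvx hvy]
    exact (((hf.of_le hvw hw).tendsto_marginal hvw (fun n => (hg n).measurable)
      (fun n => (hg n).nonneg) hgf hlim _).mul_const _).div (hm x) (hf.marginal_pos x).ne'
  have hexcess : ∀ n, bayesExcess vx vy (g n) (bayesRule vx vy f) ≤ ε n := by
    intro n
    calc bayesExcess vx vy (g n) (bayesRule vx vy f)
        ≤ Filter.liminf (fun m => bayesExcess vx vy (g n) (bayesRule vx vy (g m)))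
            Filter.atTop := by
          unfold bayesExcess
          refine le_trans (lintegral_mono fun z => ?_) (lintegral_liminf_le fun m =>
            (hgp n).measurable_excess hvx hvy ((hgp m).isProcedure_bayesRule hvx hvy))
          refine le_of_eq (Filter.Tendsto.liminf_eq ?_).symm
          exact ENNReal.Tendsto.const_mul (tendsto_klIntegrand_right
            ((hgp n).bayesRule_pos hvx hvy _ _) (hf.bayesRule_pos hvx hvy _ _) (hB _ _))
            (Or.inr ENNReal.ofReal_ne_top)
      _ ≤ Filter.liminf (fun m => ε n + ε m) Filter.atTop :=
          Filter.liminf_le_liminf (Filter.eventually_atTop.2 ⟨n, fun m hm => hbound n m hm⟩)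
      _ = ε n := by
          have h := (tendsto_const_nhds (x := ε n)).add hε
          rw [add_zero] at h
          exact h.liminf_eq
  refine ⟨hproc, ?_⟩
  rintro ⟨q, hq, hle, μ₀, hlt⟩
  have hq_excess : ∀ n, bayesExcess vx vy (g n) q ≤ ε n := by
    intro n
    have h1 : bayesRisk vx vy (g n) q ≤ bayesRisk vx vy (g n) (bayesRule vx vy f) :=
      lintegral_mono fun μ => mul_le_mul_left (hle μ) _
    rw [bayesRisk_eq_add_bayesExcess (hg n) hvx hvy hq,
      bayesRisk_eq_add_bayesExcess (hg n) hvx hvy hproc] at h1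
    exact ((ENNReal.add_le_add_iff_left
      (bayesRisk_bayesRule_lt_top (hg n) hvx hvy).ne).1 h1).trans (hexcess n)
  have hzero : ∫⁻ z : E × E, ENNReal.ofReal (marginal vx f z.1) *
      klIntegrand (bayesRule vx vy f z.1 z.2) (q z.1 z.2) = 0 := by
    refine le_antisymm ?_ zero_le
    calc ∫⁻ z : E × E, ENNReal.ofReal (marginal vx f z.1) *
          klIntegrand (bayesRule vx vy f z.1 z.2) (q z.1 z.2)
        ≤ Filter.liminf (fun n => bayesExcess vx vy (g n) q) Filter.atTop := by
          unfold bayesExcess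
          refine le_trans (lintegral_mono fun z => ?_) (lintegral_liminf_le fun n =>
            (hgp n).measurable_excess hvx hvy hq)
          refine le_of_eq (Filter.Tendsto.liminf_eq ?_).symm
          have hB' := hf.bayesRule_pos hvx hvy z.1 z.2
          refine ENNReal.Tendsto.mul ((ENNReal.continuous_ofReal.tendsto _).comp (hm z.1)) ?_
            (tendsto_klIntegrand_left _ hB' (hB _ _)) (Or.inr ENNReal.ofReal_ne_top)
          exact Or.inl (by simpa using hf.marginal_pos z.1)
      _ ≤ Filter.liminf ε Filter.atTop :=
          Filter.liminf_le_liminf (Filter.Eventually.of_forall hq_excess)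
      _ = 0 := hε.liminf_eq
  have hae : ∀ᵐ z : E × E, q z.1 z.2 = bayesRule vx vy f z.1 z.2 := by
    rw [lintegral_eq_zero_iff (hf.measurable_excess hvx hvy hq)] at hzero
    filter_upwards [hzero] with z hz
    have hz' := mul_eq_zero.1 hz
    refine eq_of_klIntegrand_eq_zero (hf.bayesRule_pos hvx hvy _ _) (hz'.resolve_left ?_)
    simpa using hf.marginal_pos z.1
  exact hlt.ne (klRisk_congr hvy μ₀ hq hproc hae)

/-! ### The weak gradient vanishes on the zero set of a nonnegative function -/

theorem inner_gradient_left (φ : E → ℝ) (x e : E) : inner ℝ e (gradient φ x) = fderiv ℝ φ x e := by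
  rw [real_inner_comm, gradient, InnerProductSpace.toDual_symm_apply]

theorem HasWeakGradient.integral_mul_fderiv {f : E → ℝ} {G : E → E} (h : HasWeakGradient f G)
    {φ : E → ℝ} (hφ : ContDiff ℝ ∞ φ) (hc : HasCompactSupport φ) (e : E) :
    ∫ x, f x * fderiv ℝ φ x e = -∫ x, φ x * inner ℝ e (G x) := by
  have hgc : Continuous (gradient φ) :=
    (InnerProductSpace.toDual ℝ E).symm.continuous.comp (hφ.continuous_fderiv (by simp))
  have hgs : HasCompactSupport (gradient φ) :=
    (hc.fderiv (𝕜 := ℝ)).comp_left (g := (InnerProductSpace.toDual ℝ E).symm) (map_zero _)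
  have h1 : Integrable fun x => f x • gradient φ x :=
    h.locallyIntegrable.integrable_smul_right_of_hasCompactSupport hgc hgs
  have h2 : Integrable fun x => φ x • G x :=
    h.locallyIntegrable_gradient.integrable_smul_left_of_hasCompactSupport hφ.continuous hc
  have e1 := (innerSL ℝ e).integral_comp_comm h1
  have e2 := (innerSL ℝ e).integral_comp_comm h2
  simp only [innerSL_apply_apply, inner_smul_right, inner_gradient_left] at e1 e2
  rw [e1, e2, h.integral_smul_gradient φ hφ hc, inner_neg_right]

theorem continuous_setIntegral_translate {γ : E → ℝ} (hγ : Integrable γ) (e : E) {A : Set E}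
    (hA : volume A < ⊤) : Continuous fun s : ℝ => ∫ x in A, γ (x + s • e) := by
  refine continuous_of_uniform_approx_of_continuous fun u hu => ?_
  obtain ⟨ε, hε, hu⟩ := Metric.mem_uniformity_dist.1 hu
  obtain ⟨g, hgs, hgle, hgc, hgi⟩ := hγ.exists_hasCompactSupport_integral_sub_le (half_pos hε)
  obtain ⟨C, hC⟩ := hgs.exists_bound_of_continuous hgc
  have : IsFiniteMeasure (volume.restrict A) := ⟨by simpa using hA⟩
  refine ⟨fun s => ∫ x in A, g (x + s • e), ?_, fun s => hu ?_⟩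
  · refine continuous_of_dominated (bound := fun _ => C)
      (fun s => (hgc.comp (by fun_prop : Continuous fun x : E => x + s • e)).aestronglyMeasurable)
      (fun s => Filter.Eventually.of_forall fun x => hC _) (integrable_const C)
      (Filter.Eventually.of_forall fun x => hgc.comp (by fun_prop))
  · have i1 := (hγ.comp_add_right (s • e))
    have i2 := (hgi.comp_add_right (s • e))
    rw [Real.dist_eq, ← integral_sub i1.integrableOn i2.integrableOn]
    rw [← Real.norm_eq_abs]
    calc ‖∫ x in A, (γ (x + s • e) - g (x + s • e))‖
        ≤ ∫ x in A, ‖γ (x + s • e) - g (x + s • e)‖ := norm_integral_le_integral_norm _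
      _ ≤ ∫ x, ‖γ (x + s • e) - g (x + s • e)‖ :=
          setIntegral_le_integral (i1.sub i2).norm
            (Filter.Eventually.of_forall fun x => norm_nonneg _)
      _ = ∫ x, ‖γ x - g x‖ := integral_add_right_eq_self (fun x => ‖γ x - g x‖) (s • e)
      _ < ε := by linarith

/-- `γ` is the weak derivative of `g` in the direction `e`, both being integrable. -/
structure HasWeakDirDeriv (g γ : E → ℝ) (e : E) : Prop where
  integrable : Integrable g
  integrable_deriv : Integrable γ
  measurable_deriv : Measurable γ
  integral_mul_fderiv : ∀ φ : E → ℝ, ContDiff ℝ ∞ φ → HasCompactSupport φ →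
    ∫ x, g x * fderiv ℝ φ x e = -∫ x, φ x * γ x

namespace HasWeakDirDeriv

variable {g γ : EuclideanSpace ℝ (Fin p) → ℝ} {e : EuclideanSpace ℝ (Fin p)}

theorem neg (h : HasWeakDirDeriv g γ e) : HasWeakDirDeriv g (fun x => -γ x) (-e) where
  integrable := h.integrable
  integrable_deriv := h.integrable_deriv.neg
  measurable_deriv := h.measurable_deriv.neg
  integral_mul_fderiv φ hφ hc := by
    simp only [map_neg, mul_neg, integral_neg, h.integral_mul_fderiv φ hφ hc]

theorem integral_mul_translate (h : HasWeakDirDeriv g γ e) {φ : E → ℝ} (hφ : ContDiff ℝ ∞ φ)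
    (hc : HasCompactSupport φ) (t : ℝ) :
    ∫ x, φ x * (g (x + t • e) - g x) = ∫ s in (0 : ℝ)..t, ∫ x, φ x * γ (x + s • e) := by
  obtain ⟨C, hC⟩ := hc.exists_bound_of_continuous hφ.continuous
  obtain ⟨C', hC'⟩ := (hc.fderiv (𝕜 := ℝ)).exists_bound_of_continuous
    (hφ.continuous_fderiv (by simp))
  have hshift : ∀ (k : E → ℝ) (s : ℝ), ∫ x, φ (x - s • e) * k x = ∫ x, φ x * k (x + s • e) := by
    intro k s
    rw [← integral_sub_right_eq_self (fun x => φ x * k (x + s • e)) (s • e)]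
    simp
  have hb : Continuous fun s : ℝ => ∫ x, φ x * γ (x + s • e) := by
    simp_rw [← hshift γ]
    refine continuous_of_dominated (bound := fun x => C * ‖γ x‖)
      (fun s => ((hφ.continuous.comp (by fun_prop :
        Continuous fun x : E => x - s • e)).aestronglyMeasurable.mul
          h.integrable_deriv.aestronglyMeasurable))
      (fun s => Filter.Eventually.of_forall fun x => ?_) (h.integrable_deriv.norm.const_mul C)
      (Filter.Eventually.of_forall fun x => ?_)
    · rw [norm_mul]
      exact mul_le_mul_of_nonneg_right (hC _) (norm_nonneg _)
    · exact (hφ.continuous.comp (by fun_prop)).mul continuous_const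
  have ha : ∀ s : ℝ, HasDerivAt (fun s : ℝ => ∫ x, φ (x - s • e) * g x)
      (∫ x, φ x * γ (x + s • e)) s := by
    intro s
    have hd : ∀ (x : E) (r : ℝ), HasDerivAt (fun r : ℝ => φ (x - r • e))
        (-(fderiv ℝ φ (x - r • e) e)) r := by
      intro x r
      have h1 : HasDerivAt (fun r : ℝ => x - r • e) (-e) r := by
        simpa using ((hasDerivAt_id r).smul_const e).const_sub x
      have h2 := ((hφ.differentiable (by simp)) (x - r • e)).hasFDerivAt.comp_hasDerivAt r h1
      rw [map_neg] at h2
      exact h2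
    have hfc : ∀ r : ℝ, Continuous fun x : E => -(fderiv ℝ φ (x - r • e) e) := fun r =>
      (((hφ.continuous_fderiv (by simp)).comp (by fun_prop :
        Continuous fun x : E => x - r • e)).clm_apply continuous_const).neg
    have key := hasDerivAt_integral_of_dominated_loc_of_deriv_le (μ := (volume : Measure E))
      (F := fun r x => φ (x - r • e) * g x)
      (F' := fun r x => -(fderiv ℝ φ (x - r • e) e) * g x) (x₀ := s)
      (bound := fun x => (C' * ‖e‖) * ‖g x‖) Filter.univ_mem
      (Filter.Eventually.of_forall fun r => ((hφ.continuous.comp (by fun_prop :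
        Continuous fun x : E => x - r • e)).aestronglyMeasurable.mul
          h.integrable.aestronglyMeasurable)) ?_
      ((hfc s).aestronglyMeasurable.mul h.integrable.aestronglyMeasurable)
      (Filter.Eventually.of_forall fun x r _ => ?_) (h.integrable.norm.const_mul _)
      (Filter.Eventually.of_forall fun x r _ => (hd x r).mul_const _)
    · refine key.2.congr_deriv ?_
      have hφs : ContDiff ℝ ∞ fun x => φ (x - s • e) := hφ.comp (by fun_prop)
      have hcs : HasCompactSupport fun x => φ (x - s • e) :=
        hc.comp_homeomorph (Homeomorph.subRight (s • e))
      have hw := h.integral_mul_fderiv _ hφs hcs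
      have hfd : ∀ x, fderiv ℝ (fun x => φ (x - s • e)) x = fderiv ℝ φ (x - s • e) := fun x =>
        fderiv_comp_sub (f := φ) (s • e)
      simp only [hfd] at hw
      rw [← hshift γ, ← neg_neg (∫ x, φ (x - s • e) * γ x), ← hw, ← integral_neg]
      refine integral_congr_ae (Filter.Eventually.of_forall fun x => ?_)
      simp only
      ring
    · refine (h.integrable.norm.const_mul C).mono' ((hφ.continuous.comp (by fun_prop :
        Continuous fun x : E => x - s • e)).aestronglyMeasurable.mul
          h.integrable.aestronglyMeasurable) (Filter.Eventually.of_forall fun x => ?_)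
      rw [norm_mul]
      exact mul_le_mul_of_nonneg_right (hC _) (norm_nonneg _)
    · rw [norm_mul, norm_neg]
      refine mul_le_mul_of_nonneg_right ?_ (norm_nonneg _)
      exact (ContinuousLinearMap.le_opNorm _ _).trans
        (mul_le_mul_of_nonneg_right (hC' _) (norm_nonneg _))
  rw [intervalIntegral.integral_eq_sub_of_hasDerivAt (fun s _ => ha s) (hb.intervalIntegrable _ _),
    hshift, hshift]
  have i1 : ∀ s : ℝ, Integrable fun x => φ x * g (x + s • e) := fun s =>
    (h.integrable.comp_add_right (s • e)).bdd_mul hφ.continuous.aestronglyMeasurable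
      (Filter.Eventually.of_forall hC)
  rw [← integral_sub (i1 t) (i1 0)]
  refine integral_congr_ae (Filter.Eventually.of_forall fun x => ?_)
  simp [mul_sub]

theorem integrable_translate_prod (h : HasWeakDirDeriv g γ e) (t : ℝ) :
    Integrable (fun a : E × ℝ => γ (a.1 + a.2 • e))
      ((volume : Measure E).prod (volume.restrict (Set.uIoc 0 t))) := by
  have hm : Measurable fun a : E × ℝ => γ (a.1 + a.2 • e) :=
    h.measurable_deriv.comp (by fun_prop)
  refine (integrable_prod_iff' hm.aestronglyMeasurable).2
    ⟨Filter.Eventually.of_forall fun s => h.integrable_deriv.comp_add_right (s • e), ?_⟩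
  have : ∀ s : ℝ, ∫ x, ‖γ (x + s • e)‖ = ∫ x, ‖γ x‖ := fun s =>
    integral_add_right_eq_self (fun x => ‖γ x‖) (s • e)
  simp only [this]
  have : IsFiniteMeasure (volume.restrict (Set.uIoc 0 t)) :=
    ⟨by simp [Set.uIoc, Real.volume_Ioc]⟩
  exact integrable_const _

/-- Along almost every line in the direction `e`, `g` is the primitive of its weak derivative. -/
theorem ae_translate_sub_eq (h : HasWeakDirDeriv g γ e) (t : ℝ) :
    ∀ᵐ x, g (x + t • e) - g x = ∫ s in (0 : ℝ)..t, γ (x + s • e) := by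
  have hprod := h.integrable_translate_prod t
  have hint : Integrable fun x => ∫ s in (0 : ℝ)..t, γ (x + s • e) := by
    simp only [intervalIntegral.intervalIntegral_eq_integral_uIoc]
    exact hprod.integral_prod_left.const_mul _
  refine ae_eq_of_integral_contDiff_smul_eq
    ((h.integrable.comp_add_right (t • e)).sub h.integrable).locallyIntegrable
    hint.locallyIntegrable fun φ hφ hc => ?_
  obtain ⟨C, hC⟩ := hc.exists_bound_of_continuous hφ.continuous
  simp only [smul_eq_mul]
  rw [h.integral_mul_translate hφ hc t]
  have hprod' : Integrable (Function.uncurry fun (x : E) (s : ℝ) => φ x * γ (x + s • e))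
      ((volume : Measure E).prod (volume.restrict (Set.uIoc 0 t))) :=
    hprod.bdd_mul (hφ.continuous.comp continuous_fst).aestronglyMeasurable
      (Filter.Eventually.of_forall fun a => hC a.1)
  simp only [intervalIntegral.intervalIntegral_eq_integral_uIoc, smul_eq_mul]
  rw [← integral_integral_swap hprod', ← integral_const_mul]
  refine integral_congr_ae (Filter.Eventually.of_forall fun x => ?_)
  simp only
  rw [integral_const_mul]
  ring

/-- On its zero set, a nonnegative function has nonnegative difference quotients in every direction;
hence so is its weak derivative there. -/
theorem setIntegral_nonneg_of_eq_zero (h : HasWeakDirDeriv g γ e) (hg : ∀ x, 0 ≤ g x) {A : Set E}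
    (hA : MeasurableSet A) (hAfin : volume A < ⊤) (hA0 : ∀ x ∈ A, g x = 0) :
    0 ≤ ∫ x in A, γ x := by
  set η : ℝ → ℝ := fun s => ∫ x in A, γ (x + s • e) with hη
  have hcont : Continuous η := continuous_setIntegral_translate h.integrable_deriv e hAfin
  have hnn : ∀ t : ℝ, 0 ≤ t → 0 ≤ ∫ s in (0 : ℝ)..t, η s := by
    intro t ht
    have hprod : Integrable (Function.uncurry fun (x : E) (s : ℝ) => γ (x + s • e))
        ((volume.restrict A).prod (volume.restrict (Set.uIoc 0 t))) :=
      (h.integrable_translate_prod t).mono_measure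
        (Measure.prod_mono Measure.restrict_le_self le_rfl)
    have e1 : ∫ s in (0 : ℝ)..t, η s = ∫ x in A, ∫ s in (0 : ℝ)..t, γ (x + s • e) := by
      simp only [intervalIntegral.intervalIntegral_eq_integral_uIoc, smul_eq_mul, hη]
      rw [← integral_integral_swap hprod, ← integral_const_mul]
    rw [e1]
    have e2 : ∫ x in A, ∫ s in (0 : ℝ)..t, γ (x + s • e) = ∫ x in A, g (x + t • e) := by
      refine setIntegral_congr_ae hA ?_
      filter_upwards [h.ae_translate_sub_eq t] with x hx hxA
      rw [← hx, hA0 x hxA, sub_zero]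
    rw [e2]
    exact setIntegral_nonneg hA fun x _ => hg _
  have h0 : η 0 = ∫ x in A, γ x := by simp [hη]
  rw [← h0]
  have hderiv : HasDerivAt (fun t => ∫ s in (0 : ℝ)..t, η s) (η 0) 0 :=
    intervalIntegral.integral_hasDerivAt_right (hcont.intervalIntegrable _ _)
      (hcont.stronglyMeasurableAtFilter _ _) hcont.continuousAt
  have hlim := hderiv.hasDerivWithinAt (s := Set.Ioi 0)
  rw [hasDerivWithinAt_iff_tendsto_slope' (by simp)] at hlim
  refine ge_of_tendsto hlim ?_
  filter_upwards [self_mem_nhdsWithin] with t ht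
  have ht' : (0 : ℝ) < t := ht
  simp only [slope_def_field, intervalIntegral.integral_same, sub_zero]
  exact div_nonneg (hnn t ht'.le) ht'.le

theorem ae_eq_zero (h : HasWeakDirDeriv g γ e) (hg : ∀ x, 0 ≤ g x) (hgm : Measurable g) :
    ∀ᵐ x, g x = 0 → γ x = 0 := by
  have hS : MeasurableSet {x | g x = 0} := hgm (measurableSet_singleton 0)
  have key : γ =ᵐ[volume.restrict {x | g x = 0}] 0 := by
    refine Integrable.ae_eq_zero_of_forall_setIntegral_eq_zero h.integrable_deriv.integrableOn
      fun s hs hfin => ?_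
    rw [Measure.restrict_apply hs] at hfin
    rw [Measure.restrict_restrict hs]
    have k1 := h.setIntegral_nonneg_of_eq_zero hg (hs.inter hS) hfin fun x hx => hx.2
    have k2 := h.neg.setIntegral_nonneg_of_eq_zero hg (hs.inter hS) hfin fun x hx => hx.2
    rw [integral_neg] at k2
    linarith
  exact (ae_restrict_iff' hS).1 key

end HasWeakDirDeriv

theorem HasWeakGradient.ae_gradient_eq_zero {f : E → ℝ} {G : E → E} (h : HasWeakGradient f G)
    (hf : ∀ x, 0 ≤ f x) (hfm : Measurable f) (hGm : Measurable G) :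
    ∀ᵐ x, f x = 0 → G x = 0 := by
  have key : ∀ (n : ℕ) (j : Fin p), ∀ᵐ x, ‖x‖ ≤ n → f x = 0 → G x j = 0 := by
    intro n j
    set e : E := EuclideanSpace.single j 1 with he
    let χ : ContDiffBump (0 : E) := ⟨n + 1, n + 2, by positivity, by linarith⟩
    have hχ : ContDiff ℝ ∞ χ := χ.contDiff
    have hχc := χ.hasCompactSupport
    have hdc : Continuous fun x => fderiv ℝ χ x e :=
      (hχ.continuous_fderiv (by simp)).clm_apply continuous_const
    have hds : HasCompactSupport fun x => fderiv ℝ χ x e :=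
      (hχc.fderiv (𝕜 := ℝ)).comp_left (g := fun L : E →L[ℝ] ℝ => L e) (by simp)
    have hGe : LocallyIntegrable fun x => inner ℝ e (G x) := by
      intro x
      obtain ⟨s, hs, hi⟩ := h.locallyIntegrable_gradient x
      exact ⟨s, hs, hi.const_inner e⟩
    have i1 : Integrable fun x => χ x * inner ℝ e (G x) :=
      hGe.integrable_smul_left_of_hasCompactSupport χ.continuous hχc
    have i2 : Integrable fun x => f x * fderiv ℝ χ x e :=
      h.locallyIntegrable.integrable_smul_right_of_hasCompactSupport hdc hds
    have hw : HasWeakDirDeriv (fun x => χ x * f x)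
        (fun x => χ x * inner ℝ e (G x) + f x * fderiv ℝ χ x e) e := by
      refine ⟨h.locallyIntegrable.integrable_smul_left_of_hasCompactSupport χ.continuous hχc,
        i1.add i2, ?_, fun φ hφ hc => ?_⟩
      · exact (χ.continuous.measurable.mul (by fun_prop)).add (hfm.mul hdc.measurable)
      · have hw := h.integral_mul_fderiv (hχ.mul hφ) hχc.mul_right e
        have hφd : Continuous fun x => fderiv ℝ φ x e :=
          (hφ.continuous_fderiv (by simp)).clm_apply continuous_const
        have hfd : ∀ x, fderiv ℝ (fun x => χ x * φ x) x e =
            χ x * fderiv ℝ φ x e + φ x * fderiv ℝ χ x e := fun x => by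
          have := fderiv_mul (hχ.differentiable (by simp) x) (hφ.differentiable (by simp) x)
          have e1 : (fun x => χ x * φ x) = (χ : E → ℝ) * φ := rfl
          rw [e1, this]
          simp
        have hfun : ∀ x, f x * fderiv ℝ (fun x => χ x * φ x) x e =
            χ x * f x * fderiv ℝ φ x e + φ x * (f x * fderiv ℝ χ x e) := fun x => by
          rw [hfd]; ring
        have hw' : ∫ x, f x * fderiv ℝ (fun x => χ x * φ x) x e =
            -∫ x, χ x * φ x * inner ℝ e (G x) := hw
        simp_rw [hfun] at hw'
        have j1 : Integrable fun x => χ x * f x * fderiv ℝ φ x e := by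
          have := h.locallyIntegrable.integrable_smul_right_of_hasCompactSupport
            (χ.continuous.mul hφd) (hχc.mul_right (f' := fun x => fderiv ℝ φ x e))
          refine this.congr (Filter.Eventually.of_forall fun x => ?_)
          simp only [smul_eq_mul, Pi.mul_apply]
          ring
        have j2 : Integrable fun x => φ x * (f x * fderiv ℝ χ x e) := by
          have := h.locallyIntegrable.integrable_smul_right_of_hasCompactSupport
            (hφ.continuous.mul hdc) (hc.mul_right (f' := fun x => fderiv ℝ χ x e))
          refine this.congr (Filter.Eventually.of_forall fun x => ?_)
          simp only [smul_eq_mul, Pi.mul_apply]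
          ring
        have j3 : Integrable fun x => φ x * (χ x * inner ℝ e (G x)) := by
          have := hGe.integrable_smul_left_of_hasCompactSupport (hφ.continuous.mul χ.continuous)
            (hc.mul_right (f' := χ))
          refine this.congr (Filter.Eventually.of_forall fun x => ?_)
          simp only [smul_eq_mul, Pi.mul_apply]
          ring
        rw [integral_add j1 j2] at hw'
        simp_rw [mul_add]
        rw [integral_add j3 j2]
        have e2 : ∫ x, χ x * φ x * inner ℝ e (G x) = ∫ x, φ x * (χ x * inner ℝ e (G x)) :=
          integral_congr_ae (Filter.Eventually.of_forall fun x => by simp only; ring)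
        rw [e2] at hw'
        linarith
    have := hw.ae_eq_zero (fun x => mul_nonneg χ.nonneg (hf x)) (χ.continuous.measurable.mul hfm)
    filter_upwards [this] with x hx hxn hx0
    have h1 : χ x = 1 := χ.one_of_mem_closedBall (by
      simp only [mem_closedBall_zero_iff]
      exact hxn.trans (by simp [χ]))
    have h2 := hx (by rw [hx0, mul_zero])
    rw [h1, hx0, zero_mul, add_zero, one_mul] at h2
    simpa [he, EuclideanSpace.inner_single_left] using h2
  have key' : ∀ᵐ x, ∀ (n : ℕ) (j : Fin p), ‖x‖ ≤ n → f x = 0 → G x j = 0 :=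
    ae_all_iff.2 fun n => ae_all_iff.2 fun j => key n j
  filter_upwards [key'] with x hx hx0
  obtain ⟨n, hn⟩ := exists_nat_ge ‖x‖
  ext j
  exact hx n j hn hx0

/-! ### Posterior means of the score of the prior -/

/-- `U` is a measurable vector field, standing for the score `∇π / π` of the prior `π`, whose
posterior means exist at variance `v`. -/
structure HasPosteriorMean (v : ℝ) (π : E → ℝ) (U : E → E) : Prop where
  prior : IsPrior v π
  measurable : Measurable U
  hasMarginal : HasMarginal v fun μ => π μ • U μ

/-- The posterior mean `∫ p(z|μ) π(μ) U(μ) dμ / ∫ p(z|μ) π(μ) dμ` of `U`. -/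
def posteriorMean (v : ℝ) (π : E → ℝ) (U : E → E) (z : E) : E :=
  (marginal v π z)⁻¹ • marginal v (fun μ => π μ • U μ) z

/-- The unnormalized posterior variance of `U`: the inner integral of the flatness condition. -/
def posteriorVar (v : ℝ) (π : E → ℝ) (U : E → E) (z : E) : ℝ≥0∞ :=
  ∫⁻ μ, ENNReal.ofReal (π μ * ‖posteriorMean v π U z - U μ‖ ^ 2 * normalDensity v μ z)

theorem measurable_vector_marginal {G : E → E} (hG : Measurable G) :
    Measurable fun a : ℝ × E => marginal a.1 G a.2 := by
  refine measurable_integral_of_measurable_uncurry (g := fun (a : ℝ × E) μ =>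
    normalDensity a.1 μ a.2 • G μ) ?_
  exact (measurable_normalDensity' (by fun_prop) (by fun_prop) (by fun_prop)).smul (by fun_prop)

theorem measurable_posteriorMean {π : E → ℝ} {U : E → E} (hπ : Measurable π) (hU : Measurable U) :
    Measurable fun a : ℝ × E => posteriorMean a.1 π U a.2 :=
  (measurable_marginal_uncurry hπ).inv.smul (measurable_vector_marginal (hπ.smul hU))

theorem measurable_posteriorMean_right {π : E → ℝ} {U : E → E} (hπ : Measurable π)
    (hU : Measurable U) (v : ℝ) : Measurable fun z => posteriorMean v π U z := by
  have h := (measurable_posteriorMean hπ hU).comp (measurable_prodMk_left (x := v))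
  exact h

/-- The mean minimizes the mean squared distance. -/
theorem lintegral_sq_mean_le {κ : E → ℝ} {U : E → E} (hκ : Integrable κ) (hκ0 : ∀ μ, 0 ≤ κ μ)
    (hκm : Measurable κ) (hU : Measurable U) (hκU : Integrable fun μ => κ μ • U μ)
    (hpos : 0 < ∫ μ, κ μ) (c : E) :
    ∫⁻ μ, ENNReal.ofReal (κ μ * ‖(∫ μ, κ μ)⁻¹ • (∫ μ, κ μ • U μ) - U μ‖ ^ 2) ≤
      ∫⁻ μ, ENNReal.ofReal (κ μ * ‖c - U μ‖ ^ 2) := by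
  set m := ∫ μ, κ μ with hm
  set a := m⁻¹ • ∫ μ, κ μ • U μ with ha
  by_cases htop : ∫⁻ μ, ENNReal.ofReal (κ μ * ‖c - U μ‖ ^ 2) = ⊤
  · rw [htop]; exact le_top
  have h0 : ∀ μ, 0 ≤ κ μ * ‖c - U μ‖ ^ 2 := fun μ => mul_nonneg (hκ0 μ) (sq_nonneg _)
  have hint : Integrable fun μ => κ μ * ‖c - U μ‖ ^ 2 := by
    refine ⟨by fun_prop, ?_⟩
    rw [hasFiniteIntegral_iff_ofReal (Filter.Eventually.of_forall h0)]
    exact lt_top_iff_ne_top.2 htop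
  have hsplit : Integrable fun μ => κ μ • (c - U μ) := by
    refine ((hκ.smul_const c).sub hκU).congr (Filter.Eventually.of_forall fun μ => ?_)
    simp [smul_sub]
  have hin : Integrable fun μ => inner ℝ (a - c) (κ μ • (c - U μ)) := hsplit.const_inner _
  have hexp : ∀ μ, κ μ * ‖a - U μ‖ ^ 2 = κ μ * ‖c - U μ‖ ^ 2 +
      (2 * inner ℝ (a - c) (κ μ • (c - U μ)) + ‖a - c‖ ^ 2 * κ μ) := fun μ => by
    have : a - U μ = (a - c) + (c - U μ) := by abel
    rw [this, norm_add_sq_real, inner_smul_right]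
    ring
  have hmean : ∫ μ, κ μ • U μ = m • a := by
    rw [ha, smul_smul, mul_inv_cancel₀ hpos.ne', one_smul]
  have hval : ∫ μ, inner ℝ (a - c) (κ μ • (c - U μ)) = -(m * ‖a - c‖ ^ 2) := by
    have e1 := (innerSL ℝ (a - c)).integral_comp_comm hsplit
    simp only [innerSL_apply_apply] at e1
    rw [e1]
    have e2 : ∫ μ, κ μ • (c - U μ) = -(m • (a - c)) := by
      simp_rw [smul_sub]
      rw [integral_sub (hκ.smul_const c) hκU, integral_smul_const, hmean, ← hm]
      abel
    rw [e2, inner_neg_right, inner_smul_right, real_inner_self_eq_norm_sq]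
  have hint' : Integrable fun μ => κ μ * ‖a - U μ‖ ^ 2 := by
    simp_rw [hexp]
    exact hint.add ((hin.const_mul 2).add (hκ.const_mul _))
  rw [← ofReal_integral_eq_lintegral_ofReal hint' (Filter.Eventually.of_forall fun μ =>
    mul_nonneg (hκ0 μ) (sq_nonneg _)), ← ofReal_integral_eq_lintegral_ofReal hint
      (Filter.Eventually.of_forall h0)]
  refine ENNReal.ofReal_le_ofReal ?_
  have e1 := integral_add hint ((hin.const_mul 2).add (hκ.const_mul (‖a - c‖ ^ 2)))
  have e2 := integral_add (hin.const_mul 2) (hκ.const_mul (‖a - c‖ ^ 2))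
  simp only [Pi.add_apply] at e1
  simp_rw [hexp]
  rw [e1, e2, integral_const_mul, integral_const_mul, hval, ← hm]
  nlinarith [mul_nonneg hpos.le (sq_nonneg ‖a - c‖)]

theorem HasPosteriorMean.posteriorVar_le {v : ℝ} {π : E → ℝ} {U : E → E}
    (h : HasPosteriorMean v π U) (hv : 0 < v) (z c : E) :
    posteriorVar v π U z ≤
      ∫⁻ μ, ENNReal.ofReal (π μ * ‖c - U μ‖ ^ 2) * ENNReal.ofReal (normalDensity v μ z) := by
  have hκm : Measurable fun μ => normalDensity v μ z * π μ :=
    (measurable_normalDensity_left v z).mul h.prior.measurable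
  have hκU : Integrable fun μ => (normalDensity v μ z * π μ) • U μ := by
    refine (h.hasMarginal z).congr (Filter.Eventually.of_forall fun μ => ?_)
    simp [mul_smul]
  have key := lintegral_sq_mean_le (h.prior.integrable z)
    (fun μ => mul_nonneg (normalDensity_nonneg hv _ _) (h.prior.nonneg μ)) hκm h.measurable hκU
    (h.prior.marginal_pos z) c
  have hmean : (∫ μ, normalDensity v μ z * π μ)⁻¹ • (∫ μ, (normalDensity v μ z * π μ) • U μ) =
      posteriorMean v π U z := by
    simp [posteriorMean, marginal, mul_smul]
  rw [hmean] at key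
  refine le_trans (le_of_eq ?_) (key.trans (le_of_eq ?_))
  · refine lintegral_congr fun μ => ?_
    congr 1
    ring
  · refine lintegral_congr fun μ => ?_
    rw [← ENNReal.ofReal_mul (mul_nonneg (h.prior.nonneg μ) (sq_nonneg _))]
    congr 1
    ring

/-- Observing with noise of variance `w = v + (w - v)` amounts to adding noise of variance `w - v`
to an observation with noise of variance `v`. -/
theorem lintegral_mul_normalDensity_add {v d : ℝ} (hv : 0 < v) (hd : 0 < d) {A : E → E → ℝ≥0∞}
    (hA : Measurable (Function.uncurry A)) :
    ∫⁻ z', ∫⁻ μ, A z' μ * ENNReal.ofReal (normalDensity (v + d) μ z') =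
      ∫⁻ z, ∫⁻ z', ENNReal.ofReal (normalDensity d z z') *
        ∫⁻ μ, A z' μ * ENNReal.ofReal (normalDensity v μ z) := by
  have hNv : Measurable fun a : (E × E) × E => ENNReal.ofReal (normalDensity v a.1.1 a.2) :=
    (measurable_normalDensity' measurable_const (by fun_prop) (by fun_prop)).ennreal_ofReal
  have hNd : Measurable fun a : (E × E) × E => ENNReal.ofReal (normalDensity d a.1.1 a.1.2) :=
    (measurable_normalDensity' measurable_const (by fun_prop) (by fun_prop)).ennreal_ofReal
  have hA' : Measurable fun a : (E × E) × E => A a.1.2 a.2 :=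
    hA.comp (f := fun a : (E × E) × E => (a.1.2, a.2)) (by fun_prop)
  have hF : Measurable fun a : (E × E) × E => A a.1.2 a.2 *
      (ENNReal.ofReal (normalDensity v a.1.1 a.2) *
        ENNReal.ofReal (normalDensity d a.1.1 a.1.2)) := hA'.mul (hNv.mul hNd)
  have e1 : ∀ z' μ, A z' μ * ENNReal.ofReal (normalDensity (v + d) μ z') =
      ∫⁻ z, A z' μ * (ENNReal.ofReal (normalDensity v z μ) *
        ENNReal.ofReal (normalDensity d z z')) := fun z' μ => by
    rw [lintegral_const_mul, lintegral_normalDensity_mul hv hd]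
    exact (hNv.mul hNd).comp (f := fun z => ((z, z'), μ)) (by fun_prop)
  have e2 : ∀ z z', ENNReal.ofReal (normalDensity d z z') *
      ∫⁻ μ, A z' μ * ENNReal.ofReal (normalDensity v μ z) =
      ∫⁻ μ, A z' μ * (ENNReal.ofReal (normalDensity v z μ) *
        ENNReal.ofReal (normalDensity d z z')) := fun z z' => by
    rw [← lintegral_const_mul]
    · refine lintegral_congr fun μ => ?_
      rw [normalDensity_comm v μ z]
      ring
    · exact (hA.comp measurable_prodMk_left).mul
        (measurable_normalDensity_left v z).ennreal_ofReal
  simp_rw [e1, e2]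
  have s1 : ∀ z' : E, ∫⁻ μ, ∫⁻ z, A z' μ * (ENNReal.ofReal (normalDensity v z μ) *
        ENNReal.ofReal (normalDensity d z z')) =
      ∫⁻ z, ∫⁻ μ, A z' μ * (ENNReal.ofReal (normalDensity v z μ) *
        ENNReal.ofReal (normalDensity d z z')) := fun z' =>
    lintegral_lintegral_swap
      (hF.comp (f := fun a : E × E => ((a.2, z'), a.1)) (by fun_prop)).aemeasurable
  simp_rw [s1]
  refine lintegral_lintegral_swap (f := fun z' z => ∫⁻ μ, A z' μ *
    (ENNReal.ofReal (normalDensity v z μ) * ENNReal.ofReal (normalDensity d z z')))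
    (Measurable.aemeasurable ?_)
  exact Measurable.lintegral_prod_right' (f := fun a : (E × E) × E => A a.1.1 a.2 *
      (ENNReal.ofReal (normalDensity v a.1.2 a.2) *
        ENNReal.ofReal (normalDensity d a.1.2 a.1.1)))
    (hF.comp (f := fun a : (E × E) × E => ((a.1.2, a.1.1), a.2)) (by fun_prop))

/-- The expected posterior variance increases with the noise level. -/
theorem HasPosteriorMean.lintegral_posteriorVar_mono {v w : ℝ} {π : E → ℝ} {U : E → E}
    (h : HasPosteriorMean v π U) (hv : 0 < v) (hvw : v ≤ w) :
    ∫⁻ z, posteriorVar v π U z ≤ ∫⁻ z, posteriorVar w π U z := by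
  rcases hvw.eq_or_lt with rfl | hlt
  · exact le_rfl
  have hd : 0 < w - v := sub_pos.2 hlt
  have hmean : Measurable fun z => posteriorMean w π U z :=
    measurable_posteriorMean_right h.prior.measurable h.measurable w
  have hA : Measurable (Function.uncurry fun z' μ : E =>
      ENNReal.ofReal (π μ * ‖posteriorMean w π U z' - U μ‖ ^ 2)) := by
    have h1 := h.prior.measurable
    have h2 := h.measurable
    exact ((h1.comp measurable_snd).mul (((hmean.comp measurable_fst).sub
      (h2.comp measurable_snd)).norm.pow_const 2)).ennreal_ofReal
  set A : E → E → ℝ≥0∞ := fun z' μ =>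
    ENNReal.ofReal (π μ * ‖posteriorMean w π U z' - U μ‖ ^ 2) with hAdef
  have key := lintegral_mul_normalDensity_add hv hd hA
  rw [add_sub_cancel] at key
  have hle : ∀ z z', posteriorVar v π U z ≤
      ∫⁻ μ, A z' μ * ENNReal.ofReal (normalDensity v μ z) := fun z z' =>
    h.posteriorVar_le hv z _
  have heq : ∀ z', posteriorVar w π U z' =
      ∫⁻ μ, A z' μ * ENNReal.ofReal (normalDensity w μ z') := fun z' => by
    refine lintegral_congr fun μ => ?_
    rw [hAdef, ← ENNReal.ofReal_mul (mul_nonneg (h.prior.nonneg μ) (sq_nonneg _))]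
  clear_value A
  calc ∫⁻ z, posteriorVar v π U z
      = ∫⁻ z, ∫⁻ z', ENNReal.ofReal (normalDensity (w - v) z z') * posteriorVar v π U z := by
        refine lintegral_congr fun z => ?_
        rw [lintegral_mul_const _ (measurable_normalDensity_right _ z).ennreal_ofReal,
          lintegral_normalDensity hd, one_mul]
    _ ≤ ∫⁻ z, ∫⁻ z', ENNReal.ofReal (normalDensity (w - v) z z') *
          ∫⁻ μ, A z' μ * ENNReal.ofReal (normalDensity v μ z) :=
        lintegral_mono fun z => lintegral_mono fun z' => mul_le_mul_right (hle z z') _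
    _ = ∫⁻ z', posteriorVar w π U z' := by
        rw [← key]
        exact lintegral_congr fun z' => (heq z').symm

/-- The Cauchy–Schwarz inequality for a weighted vector-valued integral. -/
theorem ofReal_norm_integral_sq_le {κ w : E → ℝ} {X : E → E} (hκ : Measurable κ)
    (hκ0 : ∀ μ, 0 ≤ κ μ) (hw : Measurable w) (hw0 : ∀ μ, 0 ≤ w μ) (hX : Measurable X) :
    ENNReal.ofReal (‖∫ μ, (κ μ * w μ) • X μ‖ ^ 2) ≤
      (∫⁻ μ, ENNReal.ofReal (κ μ * w μ ^ 2)) * ∫⁻ μ, ENNReal.ofReal (κ μ * ‖X μ‖ ^ 2) := by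
  have h1 : ENNReal.ofReal ‖∫ μ, (κ μ * w μ) • X μ‖ ≤
      ∫⁻ μ, ENNReal.ofReal (√(κ μ) * w μ) * ENNReal.ofReal (√(κ μ) * ‖X μ‖) := by
    rw [ofReal_norm]
    refine (enorm_integral_le_lintegral_enorm _).trans (le_of_eq (lintegral_congr fun μ => ?_))
    rw [← ofReal_norm, norm_smul, Real.norm_of_nonneg (mul_nonneg (hκ0 μ) (hw0 μ)),
      ← ENNReal.ofReal_mul (mul_nonneg (Real.sqrt_nonneg _) (hw0 μ))]
    congr 1
    have := Real.mul_self_sqrt (hκ0 μ)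
    linear_combination (-(w μ * ‖X μ‖)) * this
  have h2 := ENNReal.lintegral_mul_le_Lp_mul_Lq (volume : Measure E) Real.HolderConjugate.two_two
    (f := fun μ => ENNReal.ofReal (√(κ μ) * w μ))
    (g := fun μ => ENNReal.ofReal (√(κ μ) * ‖X μ‖)) (by fun_prop) (by fun_prop)
  have h3 := h1.trans h2
  rw [ENNReal.ofReal_pow (norm_nonneg _)]
  refine (pow_le_pow_left₀ zero_le h3 2).trans (le_of_eq ?_)
  rw [mul_pow, ← ENNReal.rpow_natCast, ← ENNReal.rpow_natCast, ← ENNReal.rpow_mul,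
    ← ENNReal.rpow_mul, show (1 : ℝ) / 2 * ((2 : ℕ) : ℝ) = 1 by norm_num, ENNReal.rpow_one,
    ENNReal.rpow_one]
  simp only [ENNReal.rpow_two]
  congr 1
  · refine lintegral_congr fun μ => ?_
    rw [← ENNReal.ofReal_pow (mul_nonneg (Real.sqrt_nonneg _) (hw0 μ)), mul_pow,
      Real.sq_sqrt (hκ0 μ)]
  · refine lintegral_congr fun μ => ?_
    rw [← ENNReal.ofReal_pow (mul_nonneg (Real.sqrt_nonneg _) (norm_nonneg _)), mul_pow,
      Real.sq_sqrt (hκ0 μ)]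

/-! ### Scores of the marginals of a prior cut off at infinity -/

/-- The prior `k² π`, for a cutoff function `k`. -/
def cutPrior (k π : E → ℝ) (μ : E) : ℝ := k μ ^ 2 * π μ

/-- The error made in replacing the posterior mean of `U` under `k² π` by its mean under `π`, up to
the normalization by the marginal of `k² π`. -/
def cutError (v : ℝ) (k π : E → ℝ) (U : E → E) (z : E) : E :=
  ∫ μ, (normalDensity v μ z * π μ * k μ) • (k μ • (U μ - posteriorMean v π U z))

theorem contDiff_normalDensity_left (v : ℝ) (z : E) :
    ContDiff ℝ ∞ fun μ : E => normalDensity v μ z := by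
  unfold normalDensity
  exact contDiff_const.mul (((contDiff_const.sub contDiff_id).norm_sq ℝ).div_const _).neg.exp

theorem continuous_gradient {k : E → ℝ} (hk : ContDiff ℝ ∞ k) : Continuous (gradient k) :=
  (InnerProductSpace.toDual ℝ E).symm.continuous.comp (hk.continuous_fderiv (by simp))

theorem gradient_sq_mul_normalDensity {k : E → ℝ} (hk : ContDiff ℝ ∞ k) (v : ℝ) (z μ : E) :
    gradient (fun μ => k μ ^ 2 * normalDensity v μ z) μ =
      (normalDensity v μ z * k μ) • ((2 : ℝ) • gradient k μ) -
        (normalDensity v μ z * k μ ^ 2) • (v⁻¹ • (μ - z)) := by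
  refine ext_inner_left ℝ fun e => ?_
  rw [inner_gradient_left, inner_sub_right, inner_smul_right, inner_smul_right, inner_gradient_left,
    inner_smul_right, inner_smul_right]
  have hφ : ContDiff ℝ ∞ fun μ => k μ ^ 2 * normalDensity v μ z :=
    (hk.pow 2).mul (contDiff_normalDensity_left v z)
  have hline : HasDerivAt (fun t : ℝ => μ + t • e) e 0 := by
    simpa using ((hasDerivAt_id (0 : ℝ)).smul_const e).const_add μ
  have hat : ∀ {g : E → ℝ}, ContDiff ℝ ∞ g →
      HasDerivAt (fun t : ℝ => g (μ + t • e)) (fderiv ℝ g μ e) 0 := fun {g} hg => by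
    have h := (hg.differentiable (by simp) (μ + (0 : ℝ) • e)).hasFDerivAt.comp_hasDerivAt 0 hline
    simpa [Function.comp_def] using h
  have hN : HasDerivAt (fun t : ℝ => normalDensity v (μ + t • e) z)
      (-(v⁻¹ * inner ℝ e (μ - z)) * normalDensity v μ z) 0 := by
    have h1 := ((((hline.const_sub z).norm_sq).div_const (2 * v)).neg).exp.const_mul
      ((2 * Real.pi * v) ^ (-((p : ℝ) / 2)))
    unfold normalDensity
    refine h1.congr_deriv ?_
    simp only [zero_smul, add_zero, Pi.neg_apply, inner_neg_right]
    rw [real_inner_comm, ← neg_sub μ z, inner_neg_right, norm_neg]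
    rcases eq_or_ne v 0 with rfl | hv
    · simp
    · field_simp
  have h2 := (hat hφ).unique (((hat hk).pow 2).mul hN)
  rw [h2]
  simp
  ring

/-- The gradient of the marginal of `k² π`, computed by moving the derivative in `z` onto the prior. -/
theorem gradMarginal_cutPrior {π : E → ℝ} {U : E → E}
    (hG : HasWeakGradient π fun μ => π μ • U μ) {k : E → ℝ} (hk : ContDiff ℝ ∞ k)
    (hc : HasCompactSupport k) (v : ℝ) (z : E) :
    gradMarginal v (cutPrior k π) z =
      (∫ μ, (normalDensity v μ z * π μ * k μ) • ((2 : ℝ) • gradient k μ)) +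
        ∫ μ, (normalDensity v μ z * π μ * k μ ^ 2) • U μ := by
  have hN : Continuous fun μ : E => normalDensity v μ z :=
    continuous_normalDensity v continuous_id continuous_const
  have hkc := hk.continuous
  have hφ : ContDiff ℝ ∞ fun μ => k μ ^ 2 * normalDensity v μ z :=
    (hk.pow 2).mul (contDiff_normalDensity_left v z)
  have hk2 : HasCompactSupport fun μ => k μ ^ 2 := hc.comp_left (g := fun t : ℝ => t ^ 2) (by simp)
  have hφc : HasCompactSupport fun μ => k μ ^ 2 * normalDensity v μ z := hk2.mul_right
  have hw := hG.integral_smul_gradient _ hφ hφc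
  have hg := continuous_gradient hk
  have hgc : Continuous fun μ => (2 : ℝ) • gradient k μ := by fun_prop
  have hfun : ∀ μ, π μ • gradient (fun μ => k μ ^ 2 * normalDensity v μ z) μ =
      π μ • ((normalDensity v μ z * k μ) • ((2 : ℝ) • gradient k μ)) -
        π μ • ((normalDensity v μ z * k μ ^ 2) • (v⁻¹ • (μ - z))) := fun μ => by
    rw [gradient_sq_mul_normalDensity hk v z μ, smul_sub]
  simp_rw [hfun] at hw
  have i1 : Integrable fun μ => π μ • ((normalDensity v μ z * k μ) • ((2 : ℝ) • gradient k μ)) := by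
    refine hG.locallyIntegrable.integrable_smul_right_of_hasCompactSupport
      ((hN.mul hkc).smul hgc) ?_
    exact (hc.mul_left (f := fun μ => normalDensity v μ z)).smul_right
  have i2 : Integrable fun μ => π μ • ((normalDensity v μ z * k μ ^ 2) • (v⁻¹ • (μ - z))) := by
    refine hG.locallyIntegrable.integrable_smul_right_of_hasCompactSupport
      ((hN.mul (hkc.pow 2)).smul (by fun_prop)) ?_
    exact (hk2.mul_left (f := fun μ => normalDensity v μ z)).smul_right
  rw [integral_sub i1 i2] at hw
  have e1 : ∫ μ, π μ • ((normalDensity v μ z * k μ ^ 2) • (v⁻¹ • (μ - z))) =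
      gradMarginal v (cutPrior k π) z := by
    refine integral_congr_ae (Filter.Eventually.of_forall fun μ => ?_)
    simp only [cutPrior, smul_smul]
    congr 1
    ring
  have e2 : ∫ μ, π μ • ((normalDensity v μ z * k μ) • ((2 : ℝ) • gradient k μ)) =
      ∫ μ, (normalDensity v μ z * π μ * k μ) • ((2 : ℝ) • gradient k μ) := by
    refine integral_congr_ae (Filter.Eventually.of_forall fun μ => ?_)
    simp only [smul_smul]
    congr 1
    ring
  have e3 : ∫ μ, (k μ ^ 2 * normalDensity v μ z) • (π μ • U μ) =
      ∫ μ, (normalDensity v μ z * π μ * k μ ^ 2) • U μ := by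
    refine integral_congr_ae (Filter.Eventually.of_forall fun μ => ?_)
    simp only [smul_smul]
    congr 1
    ring
  rw [e1, e2, e3, sub_eq_iff_eq_add] at hw
  rw [hw]
  abel

section

variable {π k : EuclideanSpace ℝ (Fin p) → ℝ}
  {U : EuclideanSpace ℝ (Fin p) → EuclideanSpace ℝ (Fin p)} {v R : ℝ}

theorem integrable_smul_sub_posteriorMean (h : HasPosteriorMean v π U) (z : E) :
    Integrable fun μ => (normalDensity v μ z * π μ) • (U μ - posteriorMean v π U z) := by
  refine ((h.hasMarginal z).sub ((h.prior.integrable z).smul_const (posteriorMean v π U z))).congr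
    (Filter.Eventually.of_forall fun μ => ?_)
  simp [smul_sub, mul_smul]

theorem score_cutPrior_sub (h : HasPosteriorMean v π U) (hG : HasWeakGradient π fun μ => π μ • U μ)
    (hk : ContDiff ℝ ∞ k) (hc : HasCompactSupport k) (hf : IsCompactPrior (cutPrior k π) R)
    (hv : 0 < v) (z : E) :
    score v (cutPrior k π) z - posteriorMean v π U z = (marginal v (cutPrior k π) z)⁻¹ •
      ((∫ μ, (normalDensity v μ z * π μ * k μ) • ((2 : ℝ) • gradient k μ)) +
        cutError v k π U z) := by
  have hu := hf.marginal_pos hv z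
  obtain ⟨C, hC⟩ := hc.exists_bound_of_continuous hk.continuous
  have i1 := hf.isPrior hv |>.integrable z
  have i2 : Integrable fun μ =>
      (normalDensity v μ z * π μ * k μ) • (k μ • (U μ - posteriorMean v π U z)) := by
    have hb : ∀ μ, ‖k μ ^ 2‖ ≤ C ^ 2 := fun μ => by
      rw [norm_pow]
      exact pow_le_pow_left₀ (norm_nonneg _) (hC μ) 2
    refine ((integrable_smul_sub_posteriorMean h z).bdd_smul (φ := fun μ => k μ ^ 2) (C ^ 2)
      (hk.continuous.pow 2).aestronglyMeasurable (Filter.Eventually.of_forall hb)).congr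
      (Filter.Eventually.of_forall fun μ => ?_)
    simp only [Pi.smul_apply', smul_smul]
    congr 1
    ring
  have e1 : ∫ μ, (normalDensity v μ z * π μ * k μ ^ 2) • U μ =
      cutError v k π U z + marginal v (cutPrior k π) z • posteriorMean v π U z := by
    rw [cutError, marginal_eq_integral_mul, ← integral_smul_const,
      ← integral_add i2 (i1.smul_const _)]
    refine integral_congr_ae (Filter.Eventually.of_forall fun μ => ?_)
    simp only [cutPrior, smul_smul, smul_sub]
    rw [show normalDensity v μ z * (k μ ^ 2 * π μ) = normalDensity v μ z * π μ * k μ * k μ by ring,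
      show normalDensity v μ z * π μ * k μ ^ 2 = normalDensity v μ z * π μ * k μ * k μ by ring]
    abel
  rw [score, gradMarginal_cutPrior hG hk hc, e1, ← add_assoc, smul_add _ _ (_ • _), smul_smul,
    inv_mul_cancel₀ hu.ne', one_smul, add_sub_cancel_right]

theorem lintegral_cutPrior_eq (hf : IsCompactPrior (cutPrior k π) R) (hv : 0 < v) (z : E) :
    ∫⁻ μ, ENNReal.ofReal (normalDensity v μ z * π μ * k μ ^ 2) =
      ENNReal.ofReal (marginal v (cutPrior k π) z) := by
  rw [marginal_eq_integral_mul, ofReal_integral_eq_lintegral_ofReal ((hf.isPrior hv).integrable z)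
    (Filter.Eventually.of_forall fun μ =>
      mul_nonneg (normalDensity_nonneg hv _ _) (hf.nonneg μ))]
  refine lintegral_congr fun μ => ?_
  rw [cutPrior]
  congr 1
  ring

/-- The Cauchy–Schwarz inequality for an average against `k² π`, normalized by its marginal. -/
theorem ofReal_norm_sq_div_marginal_le (h : HasPosteriorMean v π U) (hk : ContDiff ℝ ∞ k)
    (hk0 : ∀ μ, 0 ≤ k μ) (hf : IsCompactPrior (cutPrior k π) R) (hv : 0 < v) (z : E) {X : E → E}
    (hX : Measurable X) :
    ENNReal.ofReal (‖∫ μ, (normalDensity v μ z * π μ * k μ) • X μ‖ ^ 2 /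
        marginal v (cutPrior k π) z) ≤
      ∫⁻ μ, ENNReal.ofReal (normalDensity v μ z * π μ * ‖X μ‖ ^ 2) := by
  have hu := hf.marginal_pos hv z
  have key := ofReal_norm_integral_sq_le (κ := fun μ => normalDensity v μ z * π μ) (w := k) (X := X)
    ((measurable_normalDensity_left v z).mul h.prior.measurable)
    (fun μ => mul_nonneg (normalDensity_nonneg hv _ _) (h.prior.nonneg μ))
    hk.continuous.measurable hk0 hX
  rw [lintegral_cutPrior_eq hf hv z] at key
  rw [ENNReal.ofReal_div_of_pos hu]
  exact ENNReal.div_le_of_le_mul' key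

theorem cutError_le_posteriorVar (h : HasPosteriorMean v π U) (hk : ContDiff ℝ ∞ k)
    (hk0 : ∀ μ, 0 ≤ k μ) (hk1 : ∀ μ, k μ ≤ 1) (hf : IsCompactPrior (cutPrior k π) R) (hv : 0 < v)
    (z : E) :
    ENNReal.ofReal (‖cutError v k π U z‖ ^ 2 / marginal v (cutPrior k π) z) ≤
      posteriorVar v π U z := by
  have hU := h.measurable
  have hkm := hk.continuous.measurable
  refine (ofReal_norm_sq_div_marginal_le h hk hk0 hf hv z
    (X := fun μ => k μ • (U μ - posteriorMean v π U z)) (by fun_prop)).trans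
    (lintegral_mono fun μ => ENNReal.ofReal_le_ofReal ?_)
  have h1 : ‖k μ • (U μ - posteriorMean v π U z)‖ ≤ ‖posteriorMean v π U z - U μ‖ := by
    rw [norm_smul, norm_sub_rev, Real.norm_of_nonneg (hk0 μ)]
    exact mul_le_of_le_one_left (norm_nonneg _) (hk1 μ)
  have h2 := normalDensity_nonneg hv μ z
  have h3 := h.prior.nonneg μ
  calc normalDensity v μ z * π μ * ‖k μ • (U μ - posteriorMean v π U z)‖ ^ 2
      ≤ normalDensity v μ z * π μ * ‖posteriorMean v π U z - U μ‖ ^ 2 := by gcongr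
    _ = _ := by ring

/-- The integrated squared distance between the score of the marginal of `k² π` and the posterior
mean of the score of `π` itself. -/
def scoreGap (v : ℝ) (π : E → ℝ) (U : E → E) (k : E → ℝ) : ℝ≥0∞ :=
  ∫⁻ z, ENNReal.ofReal (marginal v (cutPrior k π) z *
    ‖score v (cutPrior k π) z - posteriorMean v π U z‖ ^ 2)

theorem scoreGap_le (h : HasPosteriorMean v π U) (hG : HasWeakGradient π fun μ => π μ • U μ)
    (hk : ContDiff ℝ ∞ k) (hc : HasCompactSupport k) (hk0 : ∀ μ, 0 ≤ k μ)
    (hf : IsCompactPrior (cutPrior k π) R) (hv : 0 < v) :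
    scoreGap v π U k ≤ 8 * (∫⁻ μ, ENNReal.ofReal (π μ * ‖gradient k μ‖ ^ 2)) +
      2 * ∫⁻ z, ENNReal.ofReal (‖cutError v k π U z‖ ^ 2 / marginal v (cutPrior k π) z) := by
  have hgm := (continuous_gradient hk).measurable
  have hgm2 : Measurable fun μ => (2 : ℝ) • gradient k μ := by fun_prop
  have hπm := h.prior.measurable
  have hm : Measurable fun a : E × E =>
      ENNReal.ofReal (normalDensity v a.2 a.1 * (π a.2 * ‖gradient k a.2‖ ^ 2)) :=
    ((measurable_normalDensity' measurable_const measurable_snd measurable_fst).mul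
      (by fun_prop)).ennreal_ofReal
  have hswap : ∫⁻ z, ∫⁻ μ, ENNReal.ofReal (normalDensity v μ z * (π μ * ‖gradient k μ‖ ^ 2)) =
      ∫⁻ μ, ENNReal.ofReal (π μ * ‖gradient k μ‖ ^ 2) := by
    rw [lintegral_lintegral_swap hm.aemeasurable]
    refine lintegral_congr fun μ => ?_
    simp_rw [ENNReal.ofReal_mul (normalDensity_nonneg hv _ _)]
    rw [lintegral_mul_const _ (measurable_normalDensity_right v μ).ennreal_ofReal,
      lintegral_normalDensity hv, one_mul]
  have hpt : ∀ z, ENNReal.ofReal (marginal v (cutPrior k π) z *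
      ‖score v (cutPrior k π) z - posteriorMean v π U z‖ ^ 2) ≤
      8 * (∫⁻ μ, ENNReal.ofReal (normalDensity v μ z * (π μ * ‖gradient k μ‖ ^ 2))) +
        2 * ENNReal.ofReal (‖cutError v k π U z‖ ^ 2 / marginal v (cutPrior k π) z) := by
    intro z
    have hu := hf.marginal_pos hv z
    rw [score_cutPrior_sub h hG hk hc hf hv z]
    have hA := ofReal_norm_sq_div_marginal_le h hk hk0 hf hv z
      (X := fun μ => (2 : ℝ) • gradient k μ) hgm2
    set a := ∫ μ, (normalDensity v μ z * π μ * k μ) • ((2 : ℝ) • gradient k μ)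
    set b := cutError v k π U z
    set u := marginal v (cutPrior k π) z
    have e1 : u * ‖u⁻¹ • (a + b)‖ ^ 2 ≤ 2 * (‖a‖ ^ 2 / u) + 2 * (‖b‖ ^ 2 / u) := by
      rw [norm_smul, norm_inv, Real.norm_of_nonneg hu.le]
      have : ‖a + b‖ ^ 2 ≤ 2 * ‖a‖ ^ 2 + 2 * ‖b‖ ^ 2 := by
        have := norm_add_le a b
        nlinarith [norm_nonneg (a + b), sq_nonneg (‖a‖ - ‖b‖), norm_nonneg a, norm_nonneg b]
      calc u * (u⁻¹ * ‖a + b‖) ^ 2 = ‖a + b‖ ^ 2 / u := by field_simp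
        _ ≤ (2 * ‖a‖ ^ 2 + 2 * ‖b‖ ^ 2) / u := by gcongr
        _ = _ := by ring
    have e2 : ∫⁻ μ, ENNReal.ofReal (normalDensity v μ z * π μ * ‖(2 : ℝ) • gradient k μ‖ ^ 2) =
        4 * ∫⁻ μ, ENNReal.ofReal (normalDensity v μ z * (π μ * ‖gradient k μ‖ ^ 2)) := by
      rw [← lintegral_const_mul' _ _ (by simp)]
      refine lintegral_congr fun μ => ?_
      rw [norm_smul, show (4 : ℝ≥0∞) = ENNReal.ofReal 4 by simp,
        ← ENNReal.ofReal_mul (by norm_num)]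
      congr 1
      norm_num
      ring
    calc ENNReal.ofReal (u * ‖u⁻¹ • (a + b)‖ ^ 2)
        ≤ ENNReal.ofReal (2 * (‖a‖ ^ 2 / u) + 2 * (‖b‖ ^ 2 / u)) := ENNReal.ofReal_le_ofReal e1
      _ = 2 * ENNReal.ofReal (‖a‖ ^ 2 / u) + 2 * ENNReal.ofReal (‖b‖ ^ 2 / u) := by
          rw [ENNReal.ofReal_add (by positivity) (by positivity),
            ENNReal.ofReal_mul (by norm_num), ENNReal.ofReal_mul (by norm_num)]
          simp
      _ ≤ 2 * (4 * ∫⁻ μ, ENNReal.ofReal (normalDensity v μ z * (π μ * ‖gradient k μ‖ ^ 2))) +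
          2 * ENNReal.ofReal (‖b‖ ^ 2 / u) := by
          rw [← e2]
          gcongr
      _ = _ := by
          rw [← mul_assoc]
          norm_num
  calc scoreGap v π U k
      ≤ ∫⁻ z, (8 * (∫⁻ μ, ENNReal.ofReal (normalDensity v μ z * (π μ * ‖gradient k μ‖ ^ 2))) +
        2 * ENNReal.ofReal (‖cutError v k π U z‖ ^ 2 / marginal v (cutPrior k π) z)) :=
        lintegral_mono hpt
    _ = _ := by
        rw [lintegral_add_left, lintegral_const_mul' _ _ (by simp),
          lintegral_const_mul' _ _ (by simp), hswap]
        exact (Measurable.lintegral_prod_right' hm).const_mul 8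

end

/-! ### Convergence of the scores of the cut-off priors -/

/-- Smooth cutoff functions `k n` increasing to one, whose energies with respect to `π` tend to zero
and for which the cut-off priors `(k n)² π` are nonzero and compactly supported. -/
structure IsCutoffSequence (π : E → ℝ) (k : ℕ → E → ℝ) (R : ℕ → ℝ) : Prop where
  contDiff : ∀ n, ContDiff ℝ ∞ (k n)
  hasCompactSupport : ∀ n, HasCompactSupport (k n)
  nonneg : ∀ n μ, 0 ≤ k n μ
  le_one : ∀ n μ, k n μ ≤ 1
  mono : ∀ n m, n ≤ m → ∀ μ, k n μ ≤ k m μ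
  tendsto_one : ∀ μ, Filter.Tendsto (fun n => k n μ) Filter.atTop (nhds 1)
  tendsto_energy : Filter.Tendsto
    (fun n => ∫⁻ μ, ENNReal.ofReal (π μ * ‖gradient (k n) μ‖ ^ 2)) Filter.atTop (nhds 0)
  isCompactPrior : ∀ n, IsCompactPrior (cutPrior (k n) π) (R n)

theorem measurable_score_uncurry {f : E → ℝ} (hf : Measurable f) :
    Measurable fun a : ℝ × E => score a.1 f a.2 := by
  have h : Measurable fun a : ℝ × E => gradMarginal a.1 f a.2 := by
    refine measurable_integral_of_measurable_uncurry (g := fun (a : ℝ × E) μ =>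
      (normalDensity a.1 μ a.2 * f μ) • (a.1⁻¹ • (μ - a.2))) ?_
    exact ((measurable_normalDensity' (by fun_prop) (by fun_prop) (by fun_prop)).mul
      (by fun_prop)).smul (by fun_prop)
  exact (measurable_marginal_uncurry hf).inv.smul h

theorem measurable_scoreGap {π k : E → ℝ} {U : E → E} (hπ : Measurable π) (hU : Measurable U)
    (hk : Measurable (cutPrior k π)) : Measurable fun v => scoreGap v π U k := by
  have h : Measurable fun a : ℝ × E => ENNReal.ofReal (marginal a.1 (cutPrior k π) a.2 *
      ‖score a.1 (cutPrior k π) a.2 - posteriorMean a.1 π U a.2‖ ^ 2) :=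
    ((measurable_marginal_uncurry hk).mul (((measurable_score_uncurry hk).sub
      (measurable_posteriorMean hπ hU)).norm.pow_const 2)).ennreal_ofReal
  exact h.lintegral_prod_right'

theorem measurable_cutError {π k : E → ℝ} {U : E → E} (hπ : Measurable π) (hU : Measurable U)
    (hk : Measurable k) (v : ℝ) : Measurable (cutError v k π U) := by
  have hm := measurable_posteriorMean_right hπ hU v
  refine measurable_integral_of_measurable_uncurry (g := fun (z : E) μ =>
    (normalDensity v μ z * π μ * k μ) • (k μ • (U μ - posteriorMean v π U z))) ?_
  exact (((measurable_normalDensity' measurable_const measurable_snd measurable_fst).mul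
    (by fun_prop)).mul (by fun_prop)).smul (by fun_prop)

section

variable {π : EuclideanSpace ℝ (Fin p) → ℝ} {k : ℕ → EuclideanSpace ℝ (Fin p) → ℝ}
  {U : EuclideanSpace ℝ (Fin p) → EuclideanSpace ℝ (Fin p)} {v : ℝ} {R : ℕ → ℝ}

theorem IsCutoffSequence.cutPrior_le (hk : IsCutoffSequence π k R) (hπ : ∀ μ, 0 ≤ π μ) (n : ℕ)
    (μ : E) : cutPrior (k n) π μ ≤ π μ :=
  mul_le_of_le_one_left (hπ μ) (pow_le_one₀ (hk.nonneg n μ) (hk.le_one n μ))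

theorem IsCutoffSequence.cutPrior_mono (hk : IsCutoffSequence π k R) (hπ : ∀ μ, 0 ≤ π μ) {n m : ℕ}
    (hnm : n ≤ m) (μ : E) : cutPrior (k n) π μ ≤ cutPrior (k m) π μ :=
  mul_le_mul_of_nonneg_right (pow_le_pow_left₀ (hk.nonneg n μ) (hk.mono n m hnm μ) 2) (hπ μ)

theorem IsCutoffSequence.tendsto_cutPrior (hk : IsCutoffSequence π k R) (μ : E) :
    Filter.Tendsto (fun n => cutPrior (k n) π μ) Filter.atTop (nhds (π μ)) := by
  simpa [cutPrior] using ((hk.tendsto_one μ).pow 2).mul_const (π μ)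

theorem tendsto_cutError (h : HasPosteriorMean v π U) (hk : IsCutoffSequence π k R) (z : E) :
    Filter.Tendsto (fun n => cutError v (k n) π U z) Filter.atTop (nhds 0) := by
  have hm := h.prior.marginal_pos z
  have hi := integrable_smul_sub_posteriorMean h z
  have h0 : ∫ μ, (normalDensity v μ z * π μ) • (U μ - posteriorMean v π U z) = 0 := by
    have e := integral_sub (h.hasMarginal z)
      ((h.prior.integrable z).smul_const (posteriorMean v π U z))
    have e0 : marginal v π z • posteriorMean v π U z =
        ∫ μ, normalDensity v μ z • (π μ • U μ) := by
      rw [posteriorMean, smul_smul, mul_inv_cancel₀ hm.ne', one_smul]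
      rfl
    rw [integral_smul_const, ← marginal_eq_integral_mul, e0, sub_self] at e
    rw [← e]
    refine integral_congr_ae (Filter.Eventually.of_forall fun μ => ?_)
    simp only [smul_sub, smul_smul]
  rw [← h0]
  have hU := h.measurable
  have hπ := h.prior.measurable
  have hN := measurable_normalDensity_left v z
  refine tendsto_integral_of_dominated_convergence
    (fun μ => ‖(normalDensity v μ z * π μ) • (U μ - posteriorMean v π U z)‖) (fun n => ?_) hi.norm
    (fun n => Filter.Eventually.of_forall fun μ => ?_) (Filter.Eventually.of_forall fun μ => ?_)
  · have hkm := (hk.contDiff n).continuous.measurable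
    exact Measurable.aestronglyMeasurable (by fun_prop)
  · have e : (normalDensity v μ z * π μ * k n μ) • (k n μ • (U μ - posteriorMean v π U z)) =
        (k n μ ^ 2) • ((normalDensity v μ z * π μ) • (U μ - posteriorMean v π U z)) := by
      simp only [smul_smul]
      congr 1
      ring
    rw [e, norm_smul, Real.norm_of_nonneg (sq_nonneg _)]
    exact mul_le_of_le_one_left (norm_nonneg _) (pow_le_one₀ (hk.nonneg n μ) (hk.le_one n μ))
  · have h1 := hk.tendsto_one μ
    simpa using (h1.const_mul (normalDensity v μ z * π μ)).smul
      (h1.smul_const (U μ - posteriorMean v π U z))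

/-- The scores of the cut-off priors converge to the posterior mean of the score of `π`. -/
theorem tendsto_scoreGap (h : HasPosteriorMean v π U) (hG : HasWeakGradient π fun μ => π μ • U μ)
    (hk : IsCutoffSequence π k R) (hv : 0 < v) (hfin : ∫⁻ z, posteriorVar v π U z ≠ ⊤) :
    Filter.Tendsto (fun n => scoreGap v π U (k n)) Filter.atTop (nhds 0) := by
  have hT : Filter.Tendsto (fun n => ∫⁻ z, ENNReal.ofReal
      (‖cutError v (k n) π U z‖ ^ 2 / marginal v (cutPrior (k n) π) z)) Filter.atTop
      (nhds (∫⁻ _ : E, 0)) := by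
    refine tendsto_lintegral_of_dominated_convergence (posteriorVar v π U) (fun n => ?_)
      (fun n => Filter.Eventually.of_forall fun z => cutError_le_posteriorVar h (hk.contDiff n)
        (hk.nonneg n) (hk.le_one n) (hk.isCompactPrior n) hv z) hfin
      (Filter.Eventually.of_forall fun z => ?_)
    · exact (((measurable_cutError h.prior.measurable h.measurable
        (hk.contDiff n).continuous.measurable v).norm.pow_const 2).div
        (measurable_marginal (hk.isCompactPrior n).measurable v)).ennreal_ofReal
    · have h1 := h.prior.tendsto_marginal hv (fun n => (hk.isCompactPrior n).measurable)
        (fun n => (hk.isCompactPrior n).nonneg) (hk.cutPrior_le h.prior.nonneg)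
        hk.tendsto_cutPrior z
      have h2 := ENNReal.tendsto_ofReal
        (((tendsto_cutError h hk z).norm.pow 2).div h1 (h.prior.marginal_pos z).ne')
      simpa using h2
  rw [lintegral_zero] at hT
  refine tendsto_of_tendsto_of_tendsto_of_le_of_le tendsto_const_nhds
    (h := fun n => 8 * (∫⁻ μ, ENNReal.ofReal (π μ * ‖gradient (k n) μ‖ ^ 2)) +
      2 * ∫⁻ z, ENNReal.ofReal (‖cutError v (k n) π U z‖ ^ 2 / marginal v (cutPrior (k n) π) z))
    ?_ (fun _ => zero_le) (fun n => scoreGap_le h hG (hk.contDiff n) (hk.hasCompactSupport n)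
      (hk.nonneg n) (hk.isCompactPrior n) hv)
  simpa using (ENNReal.Tendsto.const_mul hk.tendsto_energy (Or.inr (by simp))).add
    (ENNReal.Tendsto.const_mul hT (Or.inr (by simp)))

theorem scoreGap_le_add_posteriorVar (h : HasPosteriorMean v π U)
    (hG : HasWeakGradient π fun μ => π μ • U μ) (hk : IsCutoffSequence π k R) (hv : 0 < v) (n : ℕ) :
    scoreGap v π U (k n) ≤ 8 * (∫⁻ μ, ENNReal.ofReal (π μ * ‖gradient (k n) μ‖ ^ 2)) +
      2 * ∫⁻ z, posteriorVar v π U z := by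
  refine (scoreGap_le h hG (hk.contDiff n) (hk.hasCompactSupport n) (hk.nonneg n)
    (hk.isCompactPrior n) hv).trans (add_le_add le_rfl (mul_le_mul_right (lintegral_mono fun z => ?_) 2))
  exact cutError_le_posteriorVar h (hk.contDiff n) (hk.nonneg n) (hk.le_one n)
    (hk.isCompactPrior n) hv z

/-- Comparing both scores with the posterior mean of the score of `π`. -/
theorem ofReal_relFisher_le (hπ : Measurable π) (hU : Measurable U) {k₁ k₂ : E → ℝ} {R₁ R₂ : ℝ}
    (h₁ : IsCompactPrior (cutPrior k₁ π) R₁) (h₂ : IsCompactPrior (cutPrior k₂ π) R₂)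
    (hle : ∀ μ, cutPrior k₁ π μ ≤ cutPrior k₂ π μ) (hv : 0 < v) :
    ENNReal.ofReal (1 / 2 * relFisher (cutPrior k₁ π) (cutPrior k₂ π) v) ≤
      scoreGap v π U k₁ + scoreGap v π U k₂ := by
  have hc := measurable_posteriorMean_right hπ hU v
  rw [relFisher, ← integral_const_mul,
    ofReal_integral_eq_lintegral_ofReal ((integrable_relFisher h₁ h₂ hv).const_mul _)
      (Filter.Eventually.of_forall fun z => mul_nonneg (by norm_num)
        (mul_nonneg (h₁.marginal_pos hv z).le (sq_nonneg _))), scoreGap, scoreGap,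
    ← lintegral_add_left]
  · refine lintegral_mono fun z => ?_
    have hu₁ := (h₁.marginal_pos hv z).le
    have hu₂ := (h₂.marginal_pos hv z).le
    have hu : marginal v (cutPrior k₁ π) z ≤ marginal v (cutPrior k₂ π) z :=
      integral_mono ((h₁.isPrior hv).integrable z) ((h₂.isPrior hv).integrable z) fun μ =>
        mul_le_mul_of_nonneg_left (hle μ) (normalDensity_nonneg hv μ z)
    rw [← ENNReal.ofReal_add (by positivity) (by positivity)]
    refine ENNReal.ofReal_le_ofReal ?_
    set u₁ := marginal v (cutPrior k₁ π) z
    set u₂ := marginal v (cutPrior k₂ π) z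
    set c := posteriorMean v π U z
    set s₁ := score v (cutPrior k₁ π) z
    set s₂ := score v (cutPrior k₂ π) z
    have h3 : ‖s₁ - s₂‖ ^ 2 ≤ 2 * ‖s₁ - c‖ ^ 2 + 2 * ‖s₂ - c‖ ^ 2 := by
      have := norm_sub_le (s₁ - c) (s₂ - c)
      rw [sub_sub_sub_cancel_right] at this
      nlinarith [norm_nonneg (s₁ - s₂), sq_nonneg (‖s₁ - c‖ - ‖s₂ - c‖), norm_nonneg (s₁ - c),
        norm_nonneg (s₂ - c)]
    calc 1 / 2 * (u₁ * ‖s₁ - s₂‖ ^ 2)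
        ≤ 1 / 2 * (u₁ * (2 * ‖s₁ - c‖ ^ 2 + 2 * ‖s₂ - c‖ ^ 2)) := by gcongr
      _ = u₁ * ‖s₁ - c‖ ^ 2 + u₁ * ‖s₂ - c‖ ^ 2 := by ring
      _ ≤ u₁ * ‖s₁ - c‖ ^ 2 + u₂ * ‖s₂ - c‖ ^ 2 := by gcongr
  · exact ((measurable_marginal h₁.measurable v).mul
      (((measurable_score h₁.measurable v).sub hc).norm.pow_const 2)).ennreal_ofReal

/-- A relative entropy decreases along the heat flow at half the rate of the relative Fisher
information. -/
theorem ofReal_relEntropy_sub_le (hπ : Measurable π) (hU : Measurable U) {k₁ k₂ : E → ℝ} {R₁ R₂ : ℝ}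
    (h₁ : IsCompactPrior (cutPrior k₁ π) R₁) (h₂ : IsCompactPrior (cutPrior k₂ π) R₂)
    (hle : ∀ μ, cutPrior k₁ π μ ≤ cutPrior k₂ π μ) {a b : ℝ} (ha : 0 < a) (hab : a ≤ b) :
    ENNReal.ofReal (relEntropy (cutPrior k₁ π) (cutPrior k₂ π) a -
        relEntropy (cutPrior k₁ π) (cutPrior k₂ π) b) ≤
      (∫⁻ v in Set.Icc a b, scoreGap v π U k₁) + ∫⁻ v in Set.Icc a b, scoreGap v π U k₂ := by
  have hd : ∀ v, 0 < v → HasDerivAt (fun v => -relEntropy (cutPrior k₁ π) (cutPrior k₂ π) v)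
      (1 / 2 * relFisher (cutPrior k₁ π) (cutPrior k₂ π) v) v := fun v hv =>
    (hasDerivAt_relEntropy h₁ h₂ hv).neg.congr_deriv (by ring)
  have h0 : ∀ v, 0 < v → 0 ≤ 1 / 2 * relFisher (cutPrior k₁ π) (cutPrior k₂ π) v := fun v hv =>
    mul_nonneg (by norm_num) (integral_nonneg fun z =>
      mul_nonneg (h₁.marginal_pos hv z).le (sq_nonneg _))
  have hcont : ContinuousOn (fun v => -relEntropy (cutPrior k₁ π) (cutPrior k₂ π) v)
      (Set.Icc a b) := fun v hv => (hd v (ha.trans_le hv.1)).continuousAt.continuousWithinAt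
  have hint := intervalIntegral.integrableOn_deriv_of_nonneg hcont
    (fun v hv => hd v (ha.trans hv.1)) (fun v hv => h0 v (ha.trans hv.1))
  have hftc := intervalIntegral.integral_eq_sub_of_hasDerivAt_of_le hab hcont
    (fun v hv => hd v (ha.trans hv.1)) ((intervalIntegrable_iff_integrableOn_Ioc_of_le hab).2 hint)
  rw [← lintegral_add_left (measurable_scoreGap hπ hU h₁.measurable),
    show relEntropy (cutPrior k₁ π) (cutPrior k₂ π) a - relEntropy (cutPrior k₁ π) (cutPrior k₂ π) b
      = -relEntropy (cutPrior k₁ π) (cutPrior k₂ π) b - -relEntropy (cutPrior k₁ π) (cutPrior k₂ π) a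
      by ring, ← hftc, intervalIntegral.integral_of_le hab, ofReal_integral_eq_lintegral_ofReal hint
      ((ae_restrict_iff' measurableSet_Ioc).2 (Filter.Eventually.of_forall fun v hv =>
        h0 v (ha.trans hv.1)))]
  refine (setLIntegral_mono' measurableSet_Ioc fun v hv => ?_).trans
    (lintegral_mono_set Set.Ioc_subset_Icc_self)
  exact ofReal_relFisher_le hπ hU h₁ h₂ hle (ha.trans hv.1)

/-- The score gaps tend to zero at each variance, and are bounded uniformly since the posterior
variance is monotone in the noise level. -/
theorem tendsto_lintegral_scoreGap {a b : ℝ} (ha : 0 < a)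
    (h : ∀ v ∈ Set.Icc a b, HasPosteriorMean v π U) (hG : HasWeakGradient π fun μ => π μ • U μ)
    (hk : IsCutoffSequence π k R) (hfin : ∫⁻ z, posteriorVar b π U z ≠ ⊤) :
    Filter.Tendsto (fun n => ∫⁻ v in Set.Icc a b, scoreGap v π U (k n)) Filter.atTop (nhds 0) := by
  rcases lt_or_ge b a with hba | hab
  · simp [Set.Icc_eq_empty (not_le.2 hba)]
  have hb := h b ⟨hab, le_rfl⟩
  obtain ⟨N, hN⟩ := Filter.eventually_atTop.1
    (hk.tendsto_energy.eventually (gt_mem_nhds (zero_lt_one' ℝ≥0∞)))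
  rw [← lintegral_zero (μ := volume.restrict (Set.Icc a b))]
  refine tendsto_lintegral_filter_of_dominated_convergence
    (fun _ => 8 * 1 + 2 * ∫⁻ z, posteriorVar b π U z)
    (Filter.Eventually.of_forall fun n => measurable_scoreGap hb.prior.measurable hb.measurable
      (hk.isCompactPrior n).measurable)
    (Filter.eventually_atTop.2 ⟨N, fun n hn => (ae_restrict_iff' measurableSet_Icc).2
      (Filter.Eventually.of_forall fun v hv => ?_)⟩) ?_
    ((ae_restrict_iff' measurableSet_Icc).2 (Filter.Eventually.of_forall fun v hv => ?_))
  · refine (scoreGap_le_add_posteriorVar (h v hv) hG hk (ha.trans_le hv.1) n).trans ?_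
    have h1 := (hN n hn).le
    have h2 := (h v hv).lintegral_posteriorVar_mono (ha.trans_le hv.1) hv.2
    gcongr
  · rw [lintegral_const]
    exact ENNReal.mul_ne_top (ENNReal.add_ne_top.2 ⟨by simp, ENNReal.mul_ne_top (by simp) hfin⟩) (by simp)
  · refine tendsto_scoreGap (h v hv) hG hk (ha.trans_le hv.1) (ne_top_of_le_ne_top hfin ?_)
    exact (h v hv).lintegral_posteriorVar_mono (ha.trans_le hv.1) hv.2

end

/-! ### Logarithmic cutoffs -/

/-- The smooth cutoff at logarithmic scale `s`: it is one where `log (1 + ‖μ‖²) ≤ s` and zero where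
`2 s ≤ log (1 + ‖μ‖²)`. -/
def logCutoff (s : ℝ) (μ : E) : ℝ := Real.smoothTransition (2 - Real.log (1 + ‖μ‖ ^ 2) / s)

theorem contDiff_logCutoff (s : ℝ) : ContDiff ℝ ∞ (logCutoff s : E → ℝ) := by
  refine Real.smoothTransition.contDiff.comp (contDiff_const.sub ((ContDiff.log ?_ ?_).div_const s))
  · exact contDiff_const.add (contDiff_norm_sq ℝ)
  · intro μ
    positivity

theorem log_one_add_norm_sq_nonneg (μ : E) : 0 ≤ Real.log (1 + ‖μ‖ ^ 2) :=
  Real.log_nonneg (by nlinarith [sq_nonneg ‖μ‖])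

theorem logCutoff_eq_zero {s : ℝ} (hs : 0 < s) {μ : E} (hμ : Real.exp s < ‖μ‖) :
    logCutoff s μ = 0 := by
  refine Real.smoothTransition.zero_of_nonpos ?_
  have h1 : 2 * s ≤ Real.log (1 + ‖μ‖ ^ 2) := by
    rw [Real.le_log_iff_exp_le (by positivity), two_mul, Real.exp_add]
    nlinarith [Real.exp_pos s]
  rw [sub_nonpos, le_div_iff₀ hs]
  exact h1

theorem hasCompactSupport_logCutoff {s : ℝ} (hs : 0 < s) :
    HasCompactSupport (logCutoff s : E → ℝ) := by
  refine HasCompactSupport.intro (isCompact_closedBall (0 : E) (Real.exp s)) fun μ hμ => ?_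
  exact logCutoff_eq_zero hs (by simpa using hμ)

theorem logCutoff_mono {s t : ℝ} (hs : 0 < s) (hst : s ≤ t) (μ : E) :
    logCutoff s μ ≤ logCutoff t μ := by
  refine Real.smoothTransition.monotone (sub_le_sub_left ?_ 2)
  exact div_le_div_of_nonneg_left (log_one_add_norm_sq_nonneg μ) hs hst

theorem norm_gradient_logCutoff_le (s : ℝ) (hs : 0 < s) (μ : E) :
    ‖gradient (logCutoff s) μ‖ ≤
      |deriv Real.smoothTransition (2 - Real.log (1 + ‖μ‖ ^ 2) / s)| *
        (2 * ‖μ‖ / ((1 + ‖μ‖ ^ 2) * s)) := by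
  have hpos : 0 < 1 + ‖μ‖ ^ 2 := by positivity
  have h1 : HasFDerivAt (fun μ : E => 1 + ‖μ‖ ^ 2) (2 • innerSL ℝ μ) μ :=
    (hasStrictFDerivAt_norm_sq μ).hasFDerivAt.const_add 1
  have h2 := ((h1.log hpos.ne').const_mul s⁻¹).const_sub 2
  have h3 : HasDerivAt Real.smoothTransition
      (deriv Real.smoothTransition (2 - s⁻¹ * Real.log (1 + ‖μ‖ ^ 2)))
      (2 - s⁻¹ * Real.log (1 + ‖μ‖ ^ 2)) :=
    ((Real.smoothTransition.contDiff (n := 1)).differentiable (by simp) _).hasDerivAt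
  have h4 := h3.comp_hasFDerivAt μ h2
  have h5 : (Real.smoothTransition ∘ fun μ : E => 2 - s⁻¹ * Real.log (1 + ‖μ‖ ^ 2)) =
      logCutoff s := by
    funext μ
    simp [logCutoff, div_eq_inv_mul]
  rw [h5] at h4
  rw [gradient, LinearIsometryEquiv.norm_map, h4.fderiv, norm_smul, norm_neg, norm_smul, norm_smul,
    Real.norm_eq_abs, div_eq_inv_mul (Real.log _) s]
  gcongr
  have h6 : ‖(2 • innerSL ℝ μ : E →L[ℝ] ℝ)‖ ≤ 2 * ‖μ‖ := by
    refine norm_nsmul_le.trans ?_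
    simp
  rw [Real.norm_of_nonneg (by positivity), Real.norm_of_nonneg (by positivity)]
  calc s⁻¹ * ((1 + ‖μ‖ ^ 2)⁻¹ * ‖(2 • innerSL ℝ μ : E →L[ℝ] ℝ)‖)
      ≤ s⁻¹ * ((1 + ‖μ‖ ^ 2)⁻¹ * (2 * ‖μ‖)) := by gcongr
    _ = _ := by field_simp

theorem deriv_smoothTransition_of_one_lt {x : ℝ} (hx : 1 < x) :
    deriv Real.smoothTransition x = 0 := by
  have h : Real.smoothTransition =ᶠ[nhds x] fun _ => 1 := by
    filter_upwards [lt_mem_nhds hx] with y hy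
    exact Real.smoothTransition.one_of_one_le hy.le
  rw [h.deriv_eq, deriv_const]

theorem deriv_smoothTransition_of_neg {x : ℝ} (hx : x < 0) :
    deriv Real.smoothTransition x = 0 := by
  have h : Real.smoothTransition =ᶠ[nhds x] fun _ => 0 := by
    filter_upwards [gt_mem_nhds hx] with y hy
    exact Real.smoothTransition.zero_of_nonpos hy.le
  rw [h.deriv_eq, deriv_const]

theorem exists_abs_deriv_smoothTransition_le :
    ∃ C, ∀ x, |deriv Real.smoothTransition x| ≤ C := by
  obtain ⟨C, hC⟩ := (isCompact_Icc (a := (0 : ℝ)) (b := 1)).exists_bound_of_continuousOn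
    ((Real.smoothTransition.contDiff (n := 1)).continuous_deriv le_rfl).continuousOn
  refine ⟨C, fun x => ?_⟩
  have hC0 : 0 ≤ C := (norm_nonneg _).trans (hC 0 (by simp))
  rcases lt_or_ge x 0 with h0 | h0
  · simpa [deriv_smoothTransition_of_neg h0]
  rcases lt_or_ge 1 x with h1 | h1
  · simpa [deriv_smoothTransition_of_one_lt h1]
  · exact hC x ⟨h0, h1⟩

theorem gradient_logCutoff_eq_zero {s : ℝ} (hs : 0 < s) {μ : E}
    (hμ : Real.log (1 + ‖μ‖ ^ 2) < s) : gradient (logCutoff s) μ = 0 := by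
  have h := norm_gradient_logCutoff_le s hs μ
  rw [deriv_smoothTransition_of_one_lt, abs_zero, zero_mul] at h
  · exact norm_le_zero_iff.1 h
  · have : Real.log (1 + ‖μ‖ ^ 2) / s < 1 := (div_lt_one hs).2 hμ
    linarith

/-- The gradient lives where `s ≤ log (1 + ‖μ‖²) ≤ 2 s`, so that the scale `s` in its bound can be
replaced by `log ‖μ‖`. -/
theorem norm_gradient_logCutoff_sq_le {C : ℝ} (hC : ∀ x, |deriv Real.smoothTransition x| ≤ C)
    {s : ℝ} (hs : 1 ≤ s) {μ : E} (hμ : gradient (logCutoff s) μ ≠ 0) :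
    1 < ‖μ‖ ∧ ‖gradient (logCutoff s) μ‖ ^ 2 ≤
      16 * C ^ 2 / (‖μ‖ ^ 2 * Real.log (max ‖μ‖ 2) ^ 2) := by
  have hs0 : 0 < s := one_pos.trans_le hs
  set L := Real.log (1 + ‖μ‖ ^ 2) with hL
  have h := norm_gradient_logCutoff_le s hs0 μ
  have hsL : s ≤ L := by
    by_contra h'
    exact hμ (gradient_logCutoff_eq_zero hs0 (not_le.1 h'))
  have hLs : L ≤ 2 * s := by
    by_contra h'
    rw [deriv_smoothTransition_of_neg, abs_zero, zero_mul] at h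
    · exact hμ (norm_le_zero_iff.1 h)
    · have : 2 < L / s := (lt_div_iff₀ hs0).2 (not_le.1 h')
      linarith
  have hexp : 2 < 1 + ‖μ‖ ^ 2 := by
    have h1 : Real.exp 1 ≤ 1 + ‖μ‖ ^ 2 :=
      (Real.le_log_iff_exp_le (by positivity)).1 (hs.trans hsL)
    have := Real.exp_one_gt_d9
    linarith
  have hμ1 : 1 < ‖μ‖ := by nlinarith [norm_nonneg μ]
  refine ⟨hμ1, ?_⟩
  have hl0 : 0 < Real.log (max ‖μ‖ 2) := Real.log_pos (lt_max_of_lt_right (by norm_num))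
  have hlL : Real.log (max ‖μ‖ 2) ≤ 2 * s := by
    refine le_trans (Real.log_le_log (by positivity) (max_le ?_ hexp.le)) hLs
    nlinarith
  have hC0 : 0 ≤ C := (abs_nonneg _).trans (hC 0)
  have hb : ‖gradient (logCutoff s) μ‖ ≤ 4 * C / (‖μ‖ * Real.log (max ‖μ‖ 2)) := by
    refine h.trans ?_
    calc |deriv Real.smoothTransition (2 - L / s)| * (2 * ‖μ‖ / ((1 + ‖μ‖ ^ 2) * s))
        ≤ C * (2 * ‖μ‖ / (‖μ‖ ^ 2 * (Real.log (max ‖μ‖ 2) / 2))) := by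
          gcongr
          · exact hC _
          · linarith
          · linarith
      _ = _ := by
          field_simp
          ring
  calc ‖gradient (logCutoff s) μ‖ ^ 2 ≤ (4 * C / (‖μ‖ * Real.log (max ‖μ‖ 2))) ^ 2 := by gcongr
    _ = _ := by
        rw [div_pow, mul_pow, mul_pow]
        norm_num

/-- The growth condition makes the energies of the logarithmic cutoffs vanish in the limit. -/
theorem tendsto_energy_logCutoff {π : E → ℝ} (hπ : Measurable π) (hπ0 : ∀ μ, 0 ≤ π μ)
    (hgrowth : GrowthCondition π) {s : ℕ → ℝ} (hs : ∀ n, 1 ≤ s n)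
    (hlim : Filter.Tendsto s Filter.atTop Filter.atTop) :
    Filter.Tendsto (fun n => ∫⁻ μ, ENNReal.ofReal (π μ * ‖gradient (logCutoff (s n)) μ‖ ^ 2))
      Filter.atTop (nhds 0) := by
  obtain ⟨C, hC⟩ := exists_abs_deriv_smoothTransition_le
  have hset : MeasurableSet {μ : E | 1 < ‖μ‖} := measurableSet_lt measurable_const measurable_norm
  set w : E → ℝ≥0∞ := fun μ =>
    ENNReal.ofReal (π μ / (‖μ‖ ^ 2 * Real.log (max ‖μ‖ 2) ^ 2)) with hw
  rw [← lintegral_zero (μ := (volume : Measure E))]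
  refine tendsto_lintegral_of_dominated_convergence
    ({μ : E | 1 < ‖μ‖}.indicator fun μ => ENNReal.ofReal (16 * C ^ 2) * w μ) (fun n => ?_)
    (fun n => Filter.Eventually.of_forall fun μ => ?_) ?_
    (Filter.Eventually.of_forall fun μ => ?_)
  · have := (continuous_gradient (contDiff_logCutoff (p := p) (s n))).measurable
    fun_prop
  · by_cases hμ : gradient (logCutoff (s n)) μ = 0
    · simp [hμ]
    · obtain ⟨h1, h2⟩ := norm_gradient_logCutoff_sq_le hC (hs n) hμ
      rw [Set.indicator_of_mem (show μ ∈ {μ : E | 1 < ‖μ‖} from h1), hw,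
        ← ENNReal.ofReal_mul (by positivity)]
      refine ENNReal.ofReal_le_ofReal ?_
      refine (mul_le_mul_of_nonneg_left h2 (hπ0 μ)).trans (le_of_eq ?_)
      ring
  · rw [lintegral_indicator hset, lintegral_const_mul' _ _ ENNReal.ofReal_ne_top]
    exact ENNReal.mul_ne_top ENNReal.ofReal_ne_top hgrowth.ne
  · refine tendsto_const_nhds.congr' ?_
    filter_upwards [hlim.eventually_gt_atTop (Real.log (1 + ‖μ‖ ^ 2))] with n hn
    simp [gradient_logCutoff_eq_zero (one_pos.trans_le (hs n)) hn]

theorem tendsto_logCutoff {s : ℕ → ℝ} (hlim : Filter.Tendsto s Filter.atTop Filter.atTop) (μ : E) :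
    Filter.Tendsto (fun n => logCutoff (s n) μ) Filter.atTop (nhds 1) := by
  refine tendsto_const_nhds.congr' ?_
  filter_upwards [hlim.eventually_ge_atTop (Real.log (1 + ‖μ‖ ^ 2)),
    hlim.eventually_gt_atTop 0] with n hn h0
  refine (Real.smoothTransition.one_of_one_le ?_).symm
  have : Real.log (1 + ‖μ‖ ^ 2) / s n ≤ 1 := (div_le_one h0).2 hn
  linarith

theorem integrable_cutPrior {π k : E → ℝ} (hloc : LocallyIntegrable π) (hk : ContDiff ℝ ∞ k)
    (hc : HasCompactSupport k) : Integrable (cutPrior k π) :=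
  hloc.integrable_smul_left_of_hasCompactSupport (g := fun μ => k μ ^ 2) (hk.continuous.pow 2)
    (hc.comp_left (g := fun t : ℝ => t ^ 2) (by simp))

theorem exists_isCutoffSequence {π : E → ℝ} (hπ : Measurable π) (hπ0 : ∀ μ, 0 ≤ π μ)
    (hloc : LocallyIntegrable π) (hne : ¬ π =ᵐ[volume] 0) (hgrowth : GrowthCondition π) :
    ∃ k R, IsCutoffSequence π k R := by
  have hcont := fun s : ℝ => contDiff_logCutoff (p := p) s
  have hnn : ∀ s (μ : E), 0 ≤ cutPrior (logCutoff s) π μ := fun s μ =>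
    mul_nonneg (sq_nonneg _) (hπ0 μ)
  have hint : ∀ s, 0 < s → Integrable (cutPrior (logCutoff s) π) := fun s hs =>
    integrable_cutPrior hloc (hcont s) (hasCompactSupport_logCutoff hs)
  have hcast : Filter.Tendsto (fun n : ℕ => (n : ℝ) + 1) Filter.atTop Filter.atTop :=
    Filter.tendsto_atTop_add_const_right _ _ tendsto_natCast_atTop_atTop
  obtain ⟨N, hN⟩ : ∃ N : ℕ, 0 < ∫ μ, cutPrior (logCutoff ((N : ℝ) + 1)) π μ := by
    by_contra! h
    refine hne ?_
    have hz : ∀ n : ℕ, ∀ᵐ μ, cutPrior (logCutoff ((n : ℝ) + 1)) π μ = 0 := fun n =>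
      (integral_eq_zero_iff_of_nonneg (hnn _) (hint _ (by positivity))).1
        (le_antisymm (h n) (integral_nonneg (hnn _)))
    filter_upwards [ae_all_iff.2 hz] with μ hμ
    have h1 := ((tendsto_logCutoff hcast μ).pow 2).mul_const (π μ)
    simp only [cutPrior] at hμ
    simp only [hμ, one_pow, one_mul] at h1
    exact (tendsto_nhds_unique h1 tendsto_const_nhds)
  have hs1 : ∀ n : ℕ, (1 : ℝ) ≤ N + n + 1 := fun n => by
    have : (0 : ℝ) ≤ N + n := by positivity
    linarith
  have hs0 : ∀ n : ℕ, (0 : ℝ) < N + n + 1 := fun n => one_pos.trans_le (hs1 n)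
  have hlim : Filter.Tendsto (fun n : ℕ => (N : ℝ) + n + 1) Filter.atTop Filter.atTop :=
    Filter.tendsto_atTop_add_const_right _ _
      (Filter.tendsto_atTop_add_const_left _ _ tendsto_natCast_atTop_atTop)
  refine ⟨fun n => logCutoff (N + n + 1), fun n => Real.exp (N + n + 1), ?_⟩
  refine ⟨fun n => hcont _, fun n => hasCompactSupport_logCutoff (hs0 n),
    fun n μ => Real.smoothTransition.nonneg _, fun n μ => Real.smoothTransition.le_one _,
    fun n m hnm μ => logCutoff_mono (hs0 n) (by gcongr) μ, tendsto_logCutoff hlim,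
    tendsto_energy_logCutoff hπ hπ0 hgrowth hs1 hlim, fun n => ?_⟩
  refine ⟨((hcont _).continuous.measurable.pow_const 2).mul hπ, hnn _, hint _ (hs0 n),
    fun μ hμ => by simp [cutPrior, logCutoff_eq_zero (hs0 n) hμ], hN.trans_le ?_⟩
  refine integral_mono (hint _ (by positivity)) (hint _ (hs0 n)) fun μ => ?_
  refine mul_le_mul_of_nonneg_right (pow_le_pow_left₀ (Real.smoothTransition.nonneg _)
    (logCutoff_mono (by positivity) ?_ μ) 2) (hπ0 μ)
  have : (0 : ℝ) ≤ n := by positivity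
  linarith

/-! ### Admissibility of the formal Bayes rule -/

theorem HasWeakGradient.congr {f : E → ℝ} {G G' : E → E} (h : HasWeakGradient f G)
    (hG : G =ᵐ[volume] G') : HasWeakGradient f G' where
  locallyIntegrable := h.locallyIntegrable
  locallyIntegrable_gradient := h.locallyIntegrable_gradient.congr hG
  integral_smul_gradient φ hφ hc := by
    rw [h.integral_smul_gradient φ hφ hc]
    congr 1
    refine integral_congr_ae ?_
    filter_upwards [hG] with μ hμ
    rw [hμ]

/-- A measurable version `U` of the score `∇π / π`, with `π U = ∇π` also where `π` vanishes. -/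
theorem HasWeakGradient.exists_measurable_score {π : E → ℝ} {G : E → E} (h : HasWeakGradient π G)
    (hπ : Measurable π) (hπ0 : ∀ μ, 0 ≤ π μ) :
    ∃ U : E → E, Measurable U ∧ (G =ᵐ[volume] fun μ => π μ • U μ) ∧
      U =ᵐ[volume] fun μ => (π μ)⁻¹ • G μ := by
  have hGs := h.locallyIntegrable_gradient.aestronglyMeasurable
  have hmk := hGs.stronglyMeasurable_mk.measurable
  have hae := hGs.ae_eq_mk
  refine ⟨fun μ => (π μ)⁻¹ • hGs.mk G μ, hπ.inv.smul hmk, ?_, ?_⟩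
  · filter_upwards [hae, (h.congr hae).ae_gradient_eq_zero hπ0 hπ hmk] with μ h1 h2
    by_cases hμ : π μ = 0
    · rw [h1, h2 hμ, smul_zero, smul_zero]
    · rw [smul_smul, mul_inv_cancel₀ hμ, one_smul, h1]
  · filter_upwards [hae] with μ h1
    rw [h1]

theorem isPrior_of_not_ae_zero {π : E → ℝ} {v : ℝ} (hv : 0 < v) (hπ : Measurable π)
    (hπ0 : ∀ μ, 0 ≤ π μ) (hm : HasMarginal v π) (hne : ¬ π =ᵐ[volume] 0) : IsPrior v π := by
  refine ⟨hπ, hπ0, hm, fun z => ?_⟩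
  have h0 : ∀ μ, 0 ≤ normalDensity v μ z • π μ := fun μ =>
    mul_nonneg (normalDensity_nonneg hv μ z) (hπ0 μ)
  refine lt_of_le_of_ne (integral_nonneg h0) fun h => hne ?_
  filter_upwards [(integral_eq_zero_iff_of_nonneg h0 (hm z)).1 h.symm] with μ hμ
  exact (mul_eq_zero.1 hμ).resolve_left (normalDensity_pos hv μ z).ne'

theorem lintegral_posteriorVar_lt_top {π : E → ℝ} {G U : E → E} {v : ℝ}
    (hflat : FlatnessCondition v π G) (hG : G =ᵐ[volume] fun μ => π μ • U μ)
    (hU : U =ᵐ[volume] fun μ => (π μ)⁻¹ • G μ) : ∫⁻ z, posteriorVar v π U z < ⊤ := by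
  refine lt_of_eq_of_lt (lintegral_congr fun z => lintegral_congr_ae ?_) hflat.2
  have hm : marginal v G z = marginal v (fun μ => π μ • U μ) z := by
    refine integral_congr_ae ?_
    filter_upwards [hG] with μ hμ
    rw [hμ]
  filter_upwards [hU] with μ hμ
  rw [posteriorMean, hm, hμ]

end PredictiveDensity

end

open PredictiveDensity in
theorem theorem2 {p : ℕ} (vx vy : ℝ) (hvx : 0 < vx) (hvy : 0 < vy)
    (π : EuclideanSpace ℝ (Fin p) → ℝ)
    (gradπ : EuclideanSpace ℝ (Fin p) → EuclideanSpace ℝ (Fin p))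
    (hπ_meas : Measurable π) (hπ_nonneg : ∀ μ, 0 ≤ π μ)
    (hπ_grad : PredictiveDensity.HasWeakGradient π gradπ)
    (hπ_improper : ∫⁻ μ, ENNReal.ofReal (π μ) = ⊤)
    (hπ_marginal : PredictiveDensity.HasMarginal vx π)
    (hπ_risk : ∀ μ, PredictiveDensity.klRisk vx vy μ (PredictiveDensity.bayesRule vx vy π) < ⊤)
    (hcond : ∀ v ∈ Set.Icc (vx * vy / (vx + vy)) vx,
      PredictiveDensity.GrowthCondition π ∧ PredictiveDensity.FlatnessCondition v π gradπ) :
    PredictiveDensity.IsAdmissible vx vy (PredictiveDensity.bayesRule vx vy π) := by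
  have hvw : 0 < vx * vy / (vx + vy) := by positivity
  have hle : vx * vy / (vx + vy) ≤ vx := by
    rw [div_le_iff₀ (by positivity)]
    nlinarith
  have hne : ¬ π =ᵐ[volume] 0 := fun h => by
    have h0 : ∫⁻ μ, ENNReal.ofReal (π μ) = 0 := by
      rw [← lintegral_zero (μ := (volume : Measure (EuclideanSpace ℝ (Fin p))))]
      refine lintegral_congr_ae ?_
      filter_upwards [h] with μ hμ
      simp [hμ]
    simp [h0] at hπ_improper
  have hprior := isPrior_of_not_ae_zero hvx hπ_meas hπ_nonneg hπ_marginal hne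
  have hright : vx ∈ Set.Icc (vx * vy / (vx + vy)) vx := ⟨hle, le_rfl⟩
  obtain ⟨U, hU, hGU, hUG⟩ := hπ_grad.exists_measurable_score hπ_meas hπ_nonneg
  obtain ⟨k, R, hk⟩ := exists_isCutoffSequence hπ_meas hπ_nonneg hπ_grad.locallyIntegrable hne
    (hcond vx hright).1
  have hmean : ∀ v ∈ Set.Icc (vx * vy / (vx + vy)) vx, HasPosteriorMean v π U := fun v hv =>
    ⟨hprior.of_le (hvw.trans_le hv.1) hv.2, hU, fun z => by
      refine ((hcond v hv).2.1 z).congr ?_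
      filter_upwards [hGU] with μ hμ
      rw [hμ]⟩
  have hfin := lintegral_posteriorVar_lt_top (hcond vx hright).2 hGU hUG
  refine isAdmissible_of_bayesExcess_le hvx hvy hprior hk.isCompactPrior
    (hk.cutPrior_le hπ_nonneg) hk.tendsto_cutPrior
    (tendsto_lintegral_scoreGap hvw hmean (hπ_grad.congr hGU) hk hfin.ne) fun n m hnm => ?_
  rw [bayesExcess_bayesRule (hk.isCompactPrior n) (hk.isCompactPrior m) hvx hvy]
  exact ofReal_relEntropy_sub_le hπ_meas hU (hk.isCompactPrior n) (hk.isCompactPrior m)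
    (hk.cutPrior_mono hπ_nonneg hnm) hvw hle
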